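/- **Cauchy-type kernel function identity for a pair of Koornwinder–van Diejen operators.** *Cases.* Let $r,a>0$. Let $s(x)$ be one of $x$ (rational case I), $\frac1r\sin(rx)$ (trigonometric case II), $\frac a\pi\sinh(\pi x/a)$ (hyperbolic case III), $\frac1r e^{ra/4}\vartheta_1(rx\,|\,ira/\pi)$ (elliptic case IV), where $\vartheta_1(z|\tau)=2q^{1/4}\sin z\prod_{n\ge1}(1-q^{2n})(1-2q^{2n}\cos 2z+q^{4n})$, $q=e^{i\pi\tau}$, $q^{1/4}=e^{i\pi\tau/4}$, is the odd Jacobi theta function. Put $\rho=0,1,1,3$ in the cases I, II, III, IV, let $\omega_0=0$, $\omega_1=\pi/r$ (II, IV) or $\omega_1=ia$ (III), $\omega_2=ia$ and $\omega_3=-\omega_1-\omega_2$ (IV), let $\Omega=\sum_{\nu=0}^{\rho}\mathbb Z\omega_\nu$ (the set of zeros of $s$), $|\omega|=\sum_{\nu=0}^\rho\omega_\nu$, and $(\xi_0,\xi_1,\xi_2,\xi_3)=(0,0,-1,1)$. *Parameters.* Let $\beta>0$, $\lambda\in\mathbb R$, $g=(g_0,\dots,g_{2\rho+1})\in\mathbb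 R^{2\rho+2}$, $|g|=\sum_\nu g_\nu$, $\tilde g_\nu=\frac{\lambda+1}2-g_\nu$, and let $N,M\ge0$ be integers. Assume that $in\beta\notin\Omega$ for all integers $n\ne0$ and that $i(1-\lambda)\beta\notin\Omega$. *Gamma function.* Let $G=G(\cdot\,;\beta)$ be a meromorphic function on $\mathbb C$, not identically zero, with $G(z+\tfrac{i\beta}2)/G(z-\tfrac{i\beta}2)=c\,s(z)$ for some constant $c\ne0$. *Operator.* For $x\in\mathbb C^N$ let $$H_N(x;g)=s(i\lambda\beta)\sum_{\varepsilon=\pm}\sum_{j=1}^N V_j^{\varepsilon}(x;g)^{1/2}\,e^{-\varepsilon i\beta\,\partial/\partial x_j}\,V_j^{-\varepsilon}(x;g)^{1/2}+V^0(x;g),$$ where $e^{-\varepsilon i\beta\,\partial/\partial x_j}$ is the shift $x_j\mapsto x_j-\varepsilon i\beta$, $$V_j^{\pm}(x;g)=\frac{\prod_{\nu=0}^{2\rho+1}s(\pm x_j-ig_\nu\beta)}{s(\pm2x_j)\,s(\pm2x_j-i\beta)}\prod_{\delta=\pm}\prod_{k\ne j}\frac{s(x_j+\delta x_k\mp i\lambda\beta)}{s(x_j+\delta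 x_k)},$$ $$V^0(x;g)=-\frac{\prod_{\nu=1}^\rho s(\frac{\omega_\nu}2)^2}{4}\sum_{\nu=0}^\rho\frac{e^{-r\xi_\nu(2\lambda N+|g|-\frac12(\rho+1)(\lambda+1))\beta}}{\prod_{\mu\ne\nu}s(\frac12(\omega_\nu-\omega_\mu))}\,\frac{\prod_{\mu=0}^{2\rho+1}s(\frac{\omega_\nu}2+\frac{i\beta}2-ig_\mu\beta)}{\prod_{\mu=0}^{\rho}s(\frac12(\omega_\nu-\omega_\mu+i(1-\lambda)\beta))}\prod_{\delta=\pm}\prod_{j=1}^N\frac{s(\delta x_j+\frac{\omega_\nu}2+\frac{i\beta}2-i\lambda\beta)}{s(\delta x_j+\frac{\omega_\nu}2+\frac{i\beta}2)}$$ (the exponential is $1$ in the cases I–III). *Kernel function.* Let $$\Psi_N(x;g)=\prod_{j=1}^N\left(\frac{G(2x_j+\frac{i\beta}2)G(-2x_j+\frac{i\beta}2)}{\prod_{\nu=0}^{2\rho+1}G(x_j+\frac{i\beta}2-ig_\nu\beta)G(-x_j+\frac{i\beta}2-ig_\nu\beta)}\right)^{1/2}\prod_{1\le j<k\le N}\prod_{\varepsilon,\varepsilon'=\pm}\left(\frac{G(\varepsilon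 x_j+\varepsilon'x_k+\frac{i\beta}2)}{G(\varepsilon x_j+\varepsilon'x_k-i\lambda\beta+\frac{i\beta}2)}\right)^{1/2}$$ and, for $x\in\mathbb C^N$, $y\in\mathbb C^M$, $$F_{N,M}(x,y)=\Psi_N(x;g)\,\Psi_M(y;\tilde g)\prod_{j=1}^N\prod_{k=1}^M\prod_{\varepsilon,\varepsilon'=\pm}G(\varepsilon x_j+\varepsilon'y_k-\tfrac{i\lambda\beta}2).$$ *Square roots.* Fix arbitrary, not necessarily continuous, branches $G^{1/2}$, $s^{1/2}$, $c^{1/2}$ of the square roots of $G$, $s$, $c$ that are compatible with the functional equation, $G^{1/2}(z+\frac{i\beta}2)/G^{1/2}(z-\frac{i\beta}2)=c^{1/2}s^{1/2}(z)$; such $s^{1/2}$ exists for every choice of $G^{1/2}$ and $c^{1/2}$. All square roots above are taken factor by factor with these branches, where in $V_j^-$ the factors $s(x_j+\delta x_k+i\lambda\beta)/s(x_j+\delta x_k)$ are first written as $s(-x_j-\delta x_k-i\lambda\beta)/s(-x_j-\delta x_k)$. *Claim.* Let $$C_{N,M}=\frac{\prod_{\nu=1}^\rho s(\frac{\omega_\nu}2)^2}{4}\;s\Bigl(i\beta\bigl[2\lambda(N-M)+|g|-\tfrac12(\rho+1)(\lambda+1)\bigr]-|\omega|\Bigr).$$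 In the elliptic case IV assume moreover the balancing condition $2\lambda(N-M-1)+\sum_{\nu=0}^7g_\nu-2=0$. Then $$\bigl(H_N(x;g)-H_M(y;\tilde g)-C_{N,M}\bigr)F_{N,M}(x,y)=0$$ at every $(x,y)\in\mathbb C^N\times\mathbb C^M$ for which no argument of $G$ in the formula for $F_{N,M}(x,y)$, shifted by $ni\beta$ with $n\in\{-2,-1,0,1,2\}$, is a zero or a singularity of $G$; the set of these $(x,y)$ is open and dense in $\mathbb C^N\times\mathbb C^M$. -/

import Mathlib

open scoped BigOperators

noncomputable section

namespace KvD

/-! ### The four cases and their building blocks -/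

/-- The odd Jacobi theta function `ϑ₁(z | τ)` (for `0 < Im τ`), in its product form
`2 q^{1/4} sin z ∏_{n ≥ 1} (1 - q^{2n}) (1 - 2 q^{2n} cos 2z + q^{4n})` with `q = e^{iπτ}`. -/
def theta1 (z τ : ℂ) : ℂ :=
  2 * Complex.exp (Complex.I * Real.pi * τ / 4) * Complex.sin z *
    ∏' n : ℕ, ((1 - Complex.exp (2 * Complex.I * Real.pi * (n + 1) * τ)) *
      (1 - 2 * Complex.exp (2 * Complex.I * Real.pi * (n + 1) * τ) * Complex.cos (2 * z) +
        Complex.exp (4 * Complex.I * Real.pi * (n + 1) * τ)))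

/-- Rational (I), trigonometric (II), hyperbolic (III) and elliptic (IV). -/
inductive Case : Type
  | rational : Case
  | trigonometric (r : ℝ) (hr : 0 < r) : Case
  | hyperbolic (a : ℝ) (ha : 0 < a) : Case
  | elliptic (r a : ℝ) (hr : 0 < r) (ha : 0 < a) : Case

namespace Case

/-- The function `s`. -/
def s : Case → ℂ → ℂ
  | rational, x => x
  | trigonometric r _, x => 1 / (r : ℂ) * Complex.sin (r * x)
  | hyperbolic a _, x => (a : ℂ) / Real.pi * Complex.sinh (Real.pi * x / a)
  | elliptic r a _ _, x =>
      1 / (r : ℂ) * Complex.exp (r * a / 4) * theta1 (r * x) (Complex.I * r * a / Real.pi)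

/-- The number `ρ`: there are `ρ + 1` half periods `ω_ν / 2` and `2ρ + 2` couplings `g_ν`. -/
def rho : Case → ℕ
  | rational => 0
  | trigonometric _ _ => 1
  | hyperbolic _ _ => 1
  | elliptic _ _ _ _ => 3

/-- The periods `ω_0, …, ω_ρ`. -/
def omega : (c : Case) → Fin (c.rho + 1) → ℂ
  | rational => ![0]
  | trigonometric r _ => ![0, Real.pi / r]
  | hyperbolic a _ => ![0, Complex.I * a]
  | elliptic r a _ _ =>
      ![0, Real.pi / r, Complex.I * a, -(Real.pi / r) - Complex.I * a]

/-- The products `r ξ_ν`, where `ξ = (0, 0, -1, 1)`; they are nonzero only in the elliptic case. -/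
def rxi : (c : Case) → Fin (c.rho + 1) → ℂ
  | rational => ![0]
  | trigonometric _ _ => ![0, 0]
  | hyperbolic _ _ => ![0, 0]
  | elliptic r _ _ _ => ![0, 0, -r, r]

/-- The additive group `Ω` generated by the periods. -/
def periods (c : Case) : AddSubgroup ℂ := AddSubgroup.closure (Set.range c.omega)

def IsElliptic : Case → Prop
  | elliptic _ _ _ _ => True
  | _ => False

theorem s_neg (c : Case) (x : ℂ) : c.s (-x) = -c.s x := by
  cases c <;> simp [s, theta1, mul_neg, neg_div, Complex.sin_neg, Complex.sinh_neg]

end Case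

/-- A sign `ε = ±` as a complex number. -/
def sgn (ε : ℤˣ) : ℂ := ((ε : ℤ) : ℂ)

/-! ### Gamma functions and square roots -/

/-- `z` is neither a singularity nor a zero of `G`. -/
def Reg (G : ℂ → ℂ) (z : ℂ) : Prop := AnalyticAt ℂ G z ∧ G z ≠ 0

/-- `G = G(·; α)` is a Gamma function for `s`, with constant `κ`: a meromorphic function, not
identically zero, with `G(z + iα/2) / G(z - iα/2) = κ s(z)` as meromorphic functions, that is,
wherever both values of `G` are regular and nonzero. -/
structure IsGammaFunction (s : ℂ → ℂ) (α κ : ℂ) (G : ℂ → ℂ) : Prop where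
  meromorphic : ∀ z, MeromorphicAt G z
  nonzero : ∀ᶠ z in Filter.codiscrete ℂ, G z ≠ 0
  const_ne_zero : κ ≠ 0
  functional_eq : ∀ z, Reg G (z + Complex.I * α / 2) → Reg G (z - Complex.I * α / 2) →
    G (z + Complex.I * α / 2) / G (z - Complex.I * α / 2) = κ * s z

/-- `q`, `σ`, `k` are branches of the square roots `G^{1/2}`, `s^{1/2}`, `κ^{1/2}` that are
compatible with the functional equation:
`G^{1/2}(z + iα/2) / G^{1/2}(z - iα/2) = κ^{1/2} s^{1/2}(z)`.
No continuity of the branches is required. -/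
structure IsRootBranch (s : ℂ → ℂ) (α κ : ℂ) (G q σ : ℂ → ℂ) (k : ℂ) : Prop where
  sq_gamma : ∀ z, q z ^ 2 = G z
  sq_s : ∀ z, σ z ^ 2 = s z
  sq_const : k ^ 2 = κ
  functional_eq : ∀ z, Reg G (z + Complex.I * α / 2) → Reg G (z - Complex.I * α / 2) →
    q (z + Complex.I * α / 2) / q (z - Complex.I * α / 2) = k * σ z

/-- Every branch `q` of `G^{1/2}` and every `κ^{1/2}` belong to a compatible choice of branches. -/
theorem IsGammaFunction.exists_rootBranch {s : ℂ → ℂ} {α κ : ℂ} {G : ℂ → ℂ}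
    (hG : IsGammaFunction s α κ G) {q : ℂ → ℂ} (hq : ∀ z, q z ^ 2 = G z) {k : ℂ}
    (hk : k ^ 2 = κ) : ∃ σ : ℂ → ℂ, IsRootBranch s α κ G q σ k := by
  classical
  have hk0 : k ≠ 0 := by
    rintro rfl
    exact hG.const_ne_zero (by rw [← hk]; simp)
  refine ⟨fun z => if Reg G (z + Complex.I * α / 2) ∧ Reg G (z - Complex.I * α / 2) then
      q (z + Complex.I * α / 2) / q (z - Complex.I * α / 2) / k
      else s z ^ ((1 : ℂ) / 2), hq, fun z => ?_, hk, fun z h1 h2 => ?_⟩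
  · by_cases h : Reg G (z + Complex.I * α / 2) ∧ Reg G (z - Complex.I * α / 2)
    · simp only [h, and_self, if_true]
      rw [div_pow, div_pow, hq, hq, hk, hG.functional_eq z h.1 h.2]
      field_simp [hG.const_ne_zero]
    · simp only [h, if_false]
      rw [← Complex.cpow_nat_mul]
      simp
  · simp only [h1, h2, and_self, if_true]
    field_simp

/-! ### The Koornwinder–van Diejen operators -/

variable (c : Case) (β lam : ℝ)

/-- The coefficient `V_j^ε(x; g, λ, β)`. -/
def coeffV {N : ℕ} (g : Fin (2 * c.rho + 2) → ℝ) (ε : ℤˣ) (j : Fin N) (x : Fin N → ℂ) : ℂ :=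
  (∏ ν, c.s (sgn ε * x j - Complex.I * g ν * β)) /
      (c.s (sgn ε * (2 * x j)) * c.s (sgn ε * (2 * x j) - Complex.I * β)) *
    ∏ δ : ℤˣ, ∏ k ∈ Finset.univ.erase j,
      c.s (x j + sgn δ * x k - sgn ε * (Complex.I * lam * β)) / c.s (x j + sgn δ * x k)

/-- The square root `V_j^ε(x; g, λ, β)^{1/2}`, taken factor by factor with the branch `σ` of
`s^{1/2}`; here `V_j^-` is written as `V_j^+` with `x_j` replaced by `-x_j`
(`s` is odd; see `sq_rootV`). -/
def rootV (σ : ℂ → ℂ) {N : ℕ} (g : Fin (2 * c.rho + 2) → ℝ) (ε : ℤˣ) (j : Fin N)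
    (x : Fin N → ℂ) : ℂ :=
  (∏ ν, σ (sgn ε * x j - Complex.I * g ν * β)) /
      (σ (sgn ε * (2 * x j)) * σ (sgn ε * (2 * x j) - Complex.I * β)) *
    ∏ δ : ℤˣ, ∏ k ∈ Finset.univ.erase j,
      σ (sgn ε * x j + sgn δ * x k - Complex.I * lam * β) / σ (sgn ε * x j + sgn δ * x k)

theorem prod_signs {M : Type*} [CommMonoid M] (f : ℤˣ → M) : ∏ δ : ℤˣ, f δ = f 1 * f (-1) := by
  rw [show (Finset.univ : Finset ℤˣ) = {1, -1} from rfl]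
  exact Finset.prod_pair (by decide)

theorem sq_rootV (σ : ℂ → ℂ) (hσ : ∀ z, σ z ^ 2 = c.s z) {N : ℕ}
    (g : Fin (2 * c.rho + 2) → ℝ) (ε : ℤˣ) (j : Fin N) (x : Fin N → ℂ) :
    rootV c β lam σ g ε j x ^ 2 = coeffV c β lam g ε j x := by
  unfold rootV coeffV
  simp only [mul_pow, div_pow, ← Finset.prod_pow, hσ]
  congr 1
  rcases Int.units_eq_one_or ε with rfl | rfl
  · simp [sgn]
  · simp only [prod_signs]
    rw [mul_comm]
    congr 1
    · refine Finset.prod_congr rfl fun k _ => ?_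
      rw [← neg_div_neg_eq, ← c.s_neg, ← c.s_neg]
      congr 2 <;> simp [sgn] <;> ring
    · refine Finset.prod_congr rfl fun k _ => ?_
      rw [← neg_div_neg_eq, ← c.s_neg, ← c.s_neg]
      congr 2 <;> simp [sgn] <;> ring

/-- The potential `V^0(x; g, λ, β)`. -/
def coeffV0 {N : ℕ} (g : Fin (2 * c.rho + 2) → ℝ) (x : Fin N → ℂ) : ℂ :=
  -((∏ ν : Fin c.rho, c.s (c.omega ν.succ / 2)) ^ 2 / 4) *
    ∑ ν : Fin (c.rho + 1),
      Complex.exp (-c.rxi ν *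
          (2 * lam * N + ∑ μ, (g μ : ℂ) - (c.rho + 1) * (lam + 1) / 2) * β) /
        (∏ μ ∈ Finset.univ.erase ν, c.s ((c.omega ν - c.omega μ) / 2)) *
      ((∏ μ, c.s (c.omega ν / 2 + Complex.I * β / 2 - Complex.I * g μ * β)) /
        (∏ μ, c.s ((c.omega ν - c.omega μ + Complex.I * (1 - lam) * β) / 2))) *
      ∏ δ : ℤˣ, ∏ j,
        c.s (sgn δ * x j + c.omega ν / 2 + Complex.I * β / 2 - Complex.I * lam * β) /
          c.s (sgn δ * x j + c.omega ν / 2 + Complex.I * β / 2)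

/-- The point obtained from `x` by shifting `x_j` to `x_j - ε i β`. -/
def shift {N : ℕ} (ε : ℤˣ) (j : Fin N) (x : Fin N → ℂ) : Fin N → ℂ :=
  Function.update x j (x j - sgn ε * Complex.I * β)

/-- The operator
`H_N(x; g, λ, β) = s(iλβ) ∑_ε ∑_j (V_j^ε)^{1/2} exp(-ε i β ∂/∂x_j) (V_j^{-ε})^{1/2} + V^0`
applied to a function `f`, where `exp(-ε i β ∂/∂x_j)` is the shift `x_j ↦ x_j - ε i β`. -/
def opH (σ : ℂ → ℂ) {N : ℕ} (g : Fin (2 * c.rho + 2) → ℝ) (f : (Fin N → ℂ) → ℂ)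
    (x : Fin N → ℂ) : ℂ :=
  c.s (Complex.I * lam * β) *
      ∑ ε : ℤˣ, ∑ j, rootV c β lam σ g ε j x *
        (rootV c β lam σ g (-ε) j (shift β ε j x) * f (shift β ε j x)) +
    coeffV0 c β lam g x * f x

/-! ### The kernel function -/

/-- With `G` the Gamma function this is the weight `Ψ_N(x; g, λ, β)^2`; with `G` replaced by a
branch of `G^{1/2}` it is the groundstate `Ψ_N(x; g, λ, β)` itself (see `sq_Psi`). -/
def weight (G : ℂ → ℂ) {N : ℕ} (g : Fin (2 * c.rho + 2) → ℝ) (x : Fin N → ℂ) : ℂ :=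
  (∏ j, (G (2 * x j + Complex.I * β / 2) * G (-2 * x j + Complex.I * β / 2)) /
      ∏ ν, (G (x j + Complex.I * β / 2 - Complex.I * g ν * β) *
        G (-x j + Complex.I * β / 2 - Complex.I * g ν * β))) *
    ∏ j, ∏ k ∈ Finset.Ioi j, ∏ ε : ℤˣ, ∏ ε' : ℤˣ,
      G (sgn ε * x j + sgn ε' * x k + Complex.I * β / 2) /
        G (sgn ε * x j + sgn ε' * x k - Complex.I * lam * β + Complex.I * β / 2)

/-- The function `Ψ_N(x; g, λ, β)`, for the branch `q` of `G^{1/2}`. -/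
def Psi (q : ℂ → ℂ) {N : ℕ} (g : Fin (2 * c.rho + 2) → ℝ) (x : Fin N → ℂ) : ℂ :=
  weight c β lam q g x

theorem sq_Psi (G q : ℂ → ℂ) (hq : ∀ z, q z ^ 2 = G z) {N : ℕ}
    (g : Fin (2 * c.rho + 2) → ℝ) (x : Fin N → ℂ) :
    Psi c β lam q g x ^ 2 = weight c β lam G g x := by
  simp only [Psi, weight, mul_pow, div_pow, ← Finset.prod_pow, hq]

/-- The dual couplings `g̃_ν = (λ + 1)/2 - g_ν`. -/
def dual (g : Fin (2 * c.rho + 2) → ℝ) : Fin (2 * c.rho + 2) → ℝ :=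
  fun ν => (lam + 1) / 2 - g ν

/-- The kernel function `F_{N,M}(x, y; g, λ, β)`, for the branch `q` of `G^{1/2}`. -/
def kernelF (G q : ℂ → ℂ) {N M : ℕ} (g : Fin (2 * c.rho + 2) → ℝ)
    (x : Fin N → ℂ) (y : Fin M → ℂ) : ℂ :=
  Psi c β lam q g x * Psi c β lam q (dual c lam g) y *
    ∏ j, ∏ k, ∏ ε : ℤˣ, ∏ ε' : ℤˣ,
      G (sgn ε * x j + sgn ε' * y k - Complex.I * lam * β / 2)

/-- The constant `C_{N,M}`. -/
def constC (N M : ℕ) (g : Fin (2 * c.rho + 2) → ℝ) : ℂ :=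
  (∏ ν : Fin c.rho, c.s (c.omega ν.succ / 2)) ^ 2 / 4 *
    c.s (Complex.I * β *
        (2 * lam * ((N : ℂ) - M) + ∑ ν, (g ν : ℂ) - (c.rho + 1) * (lam + 1) / 2) -
      ∑ ν, c.omega ν)

/-! ### Regular points -/

/-- The arguments of `G` in `Ψ_N(x; g, λ, β)`, shifted by `n i β`, are regular. -/
def PsiReg (G : ℂ → ℂ) {N : ℕ} (g : Fin (2 * c.rho + 2) → ℝ) (n : ℤ) (x : Fin N → ℂ) : Prop :=
  (∀ j, ∀ ε : ℤˣ, Reg G (sgn ε * (2 * x j) + Complex.I * β / 2 + n * Complex.I * β)) ∧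
  (∀ j, ∀ ε : ℤˣ, ∀ ν,
    Reg G (sgn ε * x j + Complex.I * β / 2 - Complex.I * g ν * β + n * Complex.I * β)) ∧
  (∀ j k, j < k → ∀ ε ε' : ℤˣ,
    Reg G (sgn ε * x j + sgn ε' * x k + Complex.I * β / 2 + n * Complex.I * β) ∧
    Reg G (sgn ε * x j + sgn ε' * x k - Complex.I * lam * β + Complex.I * β / 2 +
      n * Complex.I * β))

/-- The points `(x, y)` at which no argument of `G` in `F_{N,M}(x, y)`, shifted by `n i β` with
`|n| ≤ 2`, is a zero or a singularity of `G`. At these points all the terms of the kernel function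
identity are well defined. -/
def regularSet (G : ℂ → ℂ) (N M : ℕ) (g : Fin (2 * c.rho + 2) → ℝ) :
    Set ((Fin N → ℂ) × (Fin M → ℂ)) :=
  {p | ∀ n : ℤ, |n| ≤ 2 →
    PsiReg c β lam G g n p.1 ∧ PsiReg c β lam G (dual c lam g) n p.2 ∧
    ∀ j k, ∀ ε ε' : ℤˣ,
      Reg G (sgn ε * p.1 j + sgn ε' * p.2 k - Complex.I * lam * β / 2 + n * Complex.I * β)}

end KvD

end

noncomputable section

namespace KvD

open Filter Topology

/-! Conjugation by the kernel function removes all shifts and square roots. By the functional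
equation of `G`, moving a shift through `Ψ` produces exactly the factors that merge the two roots
around it into a full coefficient `V_j^ε`, while the double product changes by `kernelRatio`. Hence
`H_N F = reducedH * F` pointwise, for any compatible branches (`opH_kernelF`). Since `F` is
symmetric under exchanging `(x, g)` with `(y, g̃)` (`kernelF_comm`), the same holds for `H_M`, and
the claim becomes an identity between products of values of `s` (`reducedH_sub`).

That identity is a residue theorem in an auxiliary variable `z`. The numerator is `numer`. The
denominator vanishes at `± x_j`, at `ω_ν/2 + iβ/2`, and at the images under `z ↦ center - z` of the
corresponding points for `y`. The residues at `± x_j` give the terms with `V_j^±` (`residue_inl`),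
and those at the shifted half periods give the terms of `V^0` (`residue_inr`). The reflection turns
`(x, g)` into `(y, g̃)` and reverses the sign of the residues, so the remaining poles give `H_M`
(`residue_reflect`). There are equally many zeros and poles, and the residues add up to `s` of the
sum of the poles minus the sum of the zeros (`sum_residueTerm`); this is the constant `C_{N,M}` up
to normalisation. In the elliptic case the balancing condition makes that argument vanish and also
matches the exponentials in `V^0` (`exp_balance`).

The residue sum is obtained algebraically, by induction on the number of poles, from the three-term
relation. Without elliptic functions this relation follows from `s (x + y) * s (x - y) = s x ^ 2 - s
y ^ 2`. For the theta function it follows from Liouville's theorem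
(`exists_eq_const_mul_of_quasiperiodic`). The duplication formula `s_two_mul` converts products over
half periods into the factors `s (2 z)` of the operators. Accidental coincidences of poles are
removed at the end by continuity. -/

/-! ### Partial fractions from the three-term relation -/

/-- The Weierstrass three-term relation. -/
def ThreeTerm (s : ℂ → ℂ) : Prop :=
  ∀ x y z w, s (x + y) * s (x - y) * (s (z + w) * s (z - w)) +
    s (x + z) * s (x - z) * (s (w + y) * s (w - y)) +
    s (x + w) * s (x - w) * (s (y + z) * s (y - z)) = 0

/-- The degenerate addition formula of the rational, trigonometric and hyperbolic cases. -/
def TwoTerm (s : ℂ → ℂ) : Prop :=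
  ∀ x y, s (x + y) * s (x - y) = s x ^ 2 - s y ^ 2

theorem TwoTerm.threeTerm {s : ℂ → ℂ} (h : TwoTerm s) : ThreeTerm s := by
  intro x y z w
  simp only [h _ _]
  ring

/-- Centred at `(b₁ + b₂) / 2`, each product on the left is a difference of squares with the same
second square. This supplies the partial fractions with two poles when zeros and poles have
different sums. -/
theorem TwoTerm.sub_eq {s : ℂ → ℂ} (h : TwoTerm s) (p p' b₁ b₂ : ℂ) :
    s (p' - b₁) * s (p' - b₂) - s (p - b₁) * s (p - b₂) =
      s (p' - p) * s (p' + p - b₁ - b₂) := by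
  have h1 := h (p' - (b₁ + b₂) / 2) ((b₂ - b₁) / 2)
  have h2 := h (p - (b₁ + b₂) / 2) ((b₂ - b₁) / 2)
  have h3 := h (p' - (b₁ + b₂) / 2) (p - (b₁ + b₂) / 2)
  ring_nf at h1 h2 h3 ⊢
  linear_combination h1 - h2 - h3

/-- Viewed in `z`, this trades the pair of zeros `b₁, b₂` for pairs with the same sum, one member of
which is `p` or `p'`. When `p` and `p'` are poles, each new term loses a pole. -/
theorem ThreeTerm.split {s : ℂ → ℂ} (h : ThreeTerm s) (odd : ∀ x, s (-x) = -s x)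
    (z p p' b₁ b₂ : ℂ) :
    s (p' - p) * s (p' + p - b₁ - b₂) * (s (z - b₁) * s (z - b₂)) =
      s (p' - b₁) * s (p' - b₂) * (s (z - p) * s (z - (b₁ + b₂ - p))) -
      s (p - b₁) * s (p - b₂) * (s (z - p') * s (z - (b₁ + b₂ - p'))) := by
  -- All four points are measured from the midpoint of `b₁` and `b₂`, so that sums and differences
  -- become the wanted arguments.
  have h1 := h (z - (b₁ + b₂) / 2) ((b₂ - b₁) / 2) (p' - (b₁ + b₂) / 2) (p - (b₁ + b₂) / 2)
  rw [show z - (b₁ + b₂) / 2 + (b₂ - b₁) / 2 = z - b₁ by ring,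
    show z - (b₁ + b₂) / 2 - (b₂ - b₁) / 2 = z - b₂ by ring,
    show p' - (b₁ + b₂) / 2 + (p - (b₁ + b₂) / 2) = p' + p - b₁ - b₂ by ring,
    show p' - (b₁ + b₂) / 2 - (p - (b₁ + b₂) / 2) = p' - p by ring,
    show z - (b₁ + b₂) / 2 + (p' - (b₁ + b₂) / 2) = z - (b₁ + b₂ - p') by ring,
    show z - (b₁ + b₂) / 2 - (p' - (b₁ + b₂) / 2) = z - p' by ring,
    show p - (b₁ + b₂) / 2 + (b₂ - b₁) / 2 = p - b₁ by ring,
    show p - (b₁ + b₂) / 2 - (b₂ - b₁) / 2 = p - b₂ by ring,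
    show z - (b₁ + b₂) / 2 + (p - (b₁ + b₂) / 2) = z - (b₁ + b₂ - p) by ring,
    show z - (b₁ + b₂) / 2 - (p - (b₁ + b₂) / 2) = z - p by ring,
    show (b₂ - b₁) / 2 + (p' - (b₁ + b₂) / 2) = p' - b₁ by ring,
    show (b₂ - b₁) / 2 - (p' - (b₁ + b₂) / 2) = -(p' - b₂) by ring, odd] at h1
  linear_combination h1

/-- The residue of `∏ s (z - b) / ∏ s (z - a)` at `z = a j`. -/
def residueTerm {ι : Type*} [DecidableEq ι] (s : ℂ → ℂ) (a : ι → ℂ) (S : Finset ι)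
    (B : Multiset ℂ) (j : ι) : ℂ :=
  (B.map fun b => s (a j - b)).prod / ∏ k ∈ S.erase j, s (a j - a k)

section

variable {ι : Type*} [DecidableEq ι] {s : ℂ → ℂ} {a : ι → ℂ}

/-- A zero placed on the pole `a p` kills the residue there and cancels one factor of every other
denominator. -/
theorem sum_residueTerm_cons (h0 : s 0 = 0) {S : Finset ι} {B : Multiset ℂ} {p : ι} (hp : p ∈ S)
    (hS : ∀ j ∈ S, ∀ k ∈ S, j ≠ k → s (a j - a k) ≠ 0) :
    ∑ j ∈ S, residueTerm s a S (a p ::ₘ B) j = ∑ j ∈ S.erase p, residueTerm s a (S.erase p) B j := by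
  rw [← Finset.add_sum_erase S _ hp]
  have : residueTerm s a S (a p ::ₘ B) p = 0 := by simp [residueTerm, h0]
  rw [this, zero_add]
  refine Finset.sum_congr rfl fun j hj => ?_
  obtain ⟨hjp, hjS⟩ := Finset.mem_erase.1 hj
  have hp' : p ∈ S.erase j := Finset.mem_erase.2 ⟨hjp.symm, hp⟩
  unfold residueTerm
  rw [← Finset.mul_prod_erase (S.erase j) _ hp', Finset.erase_right_comm, Multiset.map_cons,
    Multiset.prod_cons, mul_div_mul_left _ _ (hS j hjS p hp hjp)]

theorem residueTerm_split (h : ThreeTerm s) (odd : ∀ x, s (-x) = -s x) (S : Finset ι)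
    (B : Multiset ℂ) (p p' : ι) (b₁ b₂ : ℂ) (j : ι) :
    s (a p' - a p) * s (a p' + a p - b₁ - b₂) * residueTerm s a S (b₁ ::ₘ b₂ ::ₘ B) j =
      s (a p' - b₁) * s (a p' - b₂) * residueTerm s a S (a p ::ₘ (b₁ + b₂ - a p) ::ₘ B) j -
      s (a p - b₁) * s (a p - b₂) * residueTerm s a S (a p' ::ₘ (b₁ + b₂ - a p') ::ₘ B) j := by
  have := h.split odd (a j) (a p) (a p') b₁ b₂
  simp only [residueTerm, Multiset.map_cons, Multiset.prod_cons, div_eq_mul_inv]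
  linear_combination (B.map fun b => s (a j - b)).prod *
    (∏ k ∈ S.erase j, s (a j - a k))⁻¹ * this

/-- Partial fractions: the sum of the residues of `∏ s (z - b) / ∏ s (z - a)`. -/
theorem sum_residueTerm (h : ThreeTerm s) (odd : ∀ x, s (-x) = -s x) (hs : Continuous s)
    (hne : ∀ z, ∀ᶠ t in 𝓝[≠] (0 : ℂ), s (z + t) ≠ 0) {D : ℂ} (hD : D = 0 ∨ TwoTerm s) (n : ℕ) :
    ∀ (S : Finset ι) (B : Multiset ℂ), S.card = n + 2 → B.card = n + 2 →
      ∑ j ∈ S, a j - B.sum = D → (∀ j ∈ S, ∀ k ∈ S, j ≠ k → s (a j - a k) ≠ 0) →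
      ∑ j ∈ S, residueTerm s a S B j = s D := by
  have h0 : s 0 = 0 := by
    have := odd 0
    rw [neg_zero] at this
    exact CharZero.eq_neg_self_iff.1 this
  induction n with
  | zero =>
    intro S B hSc hBc hsum hS
    obtain ⟨p, p', hpp, rfl⟩ := Finset.card_eq_two.1 hSc
    obtain ⟨b₁, b₂, rfl⟩ := Multiset.card_eq_two.1 hBc
    have hn : s (a p' - a p) ≠ 0 := hS _ (by simp) _ (by simp) hpp.symm
    have e1 : ({p, p'} : Finset ι).erase p = {p'} := by
      ext i; simp only [Finset.mem_erase, Finset.mem_insert, Finset.mem_singleton]; grind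
    have e2 : ({p, p'} : Finset ι).erase p' = {p} := by
      ext i; simp only [Finset.mem_erase, Finset.mem_insert, Finset.mem_singleton]; grind
    rw [Finset.sum_pair hpp] at hsum ⊢
    simp only [Multiset.insert_eq_cons, Multiset.sum_cons, Multiset.sum_singleton] at hsum
    simp only [residueTerm, e1, e2, Finset.prod_singleton, Multiset.insert_eq_cons,
      Multiset.map_cons, Multiset.map_singleton, Multiset.prod_cons, Multiset.prod_singleton]
    rw [← neg_sub (a p') (a p), odd]
    -- If `D = 0`, the two zeros and the two poles have equal sums, so the products on the left
    -- agree by oddness. Otherwise the degenerate addition formula applies.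
    have key : s (a p' - b₁) * s (a p' - b₂) - s (a p - b₁) * s (a p - b₂) =
        s (a p' - a p) * s D := by
      rcases hD with rfl | h2
      · rw [h0, show a p' - b₁ = -(a p - b₂) by linear_combination hsum,
          show a p' - b₂ = -(a p - b₁) by linear_combination hsum, odd, odd]
        ring
      · rw [h2.sub_eq, ← hsum]
        congr 2
        ring
    field_simp
    linear_combination key
  | succ n ih =>
    intro S B hSc hBc hsum hS
    obtain ⟨b₁, hb₁⟩ := Multiset.card_pos_iff_exists_mem.1 (by omega : 0 < B.card)
    obtain ⟨B, rfl⟩ := Multiset.exists_cons_of_mem hb₁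
    rw [Multiset.card_cons] at hBc
    obtain ⟨b₂, hb₂⟩ := Multiset.card_pos_iff_exists_mem.1 (by omega : 0 < B.card)
    obtain ⟨B, rfl⟩ := Multiset.exists_cons_of_mem hb₂
    rw [Multiset.card_cons] at hBc
    obtain ⟨b₃, hb₃⟩ := Multiset.card_pos_iff_exists_mem.1 (by omega : 0 < B.card)
    obtain ⟨B, rfl⟩ := Multiset.exists_cons_of_mem hb₃
    rw [Multiset.card_cons] at hBc
    obtain ⟨p, hp, p', hp', hpp⟩ := Finset.one_lt_card.1 (by omega : 1 < S.card)
    -- After splitting the pair `c₁, b₂`, both terms have one pole less and the same `D`, so the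
    -- induction hypothesis evaluates them. The prefactor remains, since it may vanish.
    have step : ∀ (c₁ : ℂ) (C : Multiset ℂ), C.card = n + 1 →
        ∑ j ∈ S, a j - (c₁ ::ₘ b₂ ::ₘ C).sum = D →
        s (a p' - a p) * s (a p' + a p - c₁ - b₂) *
          (∑ j ∈ S, residueTerm s a S (c₁ ::ₘ b₂ ::ₘ C) j - s D) = 0 := by
      intro c₁ C hC hs'
      have i1 : ∀ i ∈ S, ∑ j ∈ S, residueTerm s a S (a i ::ₘ (c₁ + b₂ - a i) ::ₘ C) j = s D := by
        intro i hi
        rw [sum_residueTerm_cons h0 hi hS]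
        refine ih _ _ (by rw [Finset.card_erase_of_mem hi]; omega)
          (by rw [Multiset.card_cons]; omega) ?_
          fun j hj k hk => hS j (Finset.mem_of_mem_erase hj) k (Finset.mem_of_mem_erase hk)
        rw [← hs', ← Finset.add_sum_erase S a hi]
        simp only [Multiset.sum_cons]
        ring
      have key : s (a p' - c₁) * s (a p' - b₂) * s D - s (a p - c₁) * s (a p - b₂) * s D =
          s (a p' - a p) * s (a p' + a p - c₁ - b₂) * s D := by
        rcases hD with rfl | h2
        · simp [h0]
        · rw [← h2.sub_eq]
          ring
      rw [mul_sub, Finset.mul_sum, Finset.sum_congr rfl fun j _ =>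
        residueTerm_split h odd S C p p' c₁ b₂ j, Finset.sum_sub_distrib, ← Finset.mul_sum,
        ← Finset.mul_sum, i1 p hp, i1 p' hp']
      linear_combination key
    -- Moving `b₁` by `t` and `b₃` by `-t` preserves the sum of the zeros and makes the prefactor
    -- nonzero for small `t ≠ 0`. Continuity then gives `t = 0`.
    let f : ℂ → ℂ := fun t =>
      ∑ j ∈ S, residueTerm s a S ((b₁ + t) ::ₘ b₂ ::ₘ (b₃ - t) ::ₘ B) j
    have hf : Continuous f := by
      refine continuous_finsetSum _ fun j _ => ?_
      simp only [residueTerm, Multiset.map_cons, Multiset.prod_cons]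
      fun_prop
    have hev : ∀ᶠ t in 𝓝[≠] (0 : ℂ), f t = s D := by
      filter_upwards [hne (-(a p' + a p - b₁ - b₂))] with t ht
      have h1 := step (b₁ + t) ((b₃ - t) ::ₘ B) (by rw [Multiset.card_cons]; omega) (by
        rw [← hsum]
        simp only [Multiset.sum_cons]
        ring)
      rw [show a p' + a p - (b₁ + t) - b₂ = -(-(a p' + a p - b₁ - b₂) + t) by ring, odd] at h1
      exact sub_eq_zero.1 ((mul_eq_zero.1 h1).resolve_left
        (mul_ne_zero (hS p' hp' p hp hpp.symm) (neg_ne_zero.2 ht)))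
    have l1 : Tendsto f (𝓝[≠] 0) (𝓝 (f 0)) := hf.continuousAt.tendsto.mono_left nhdsWithin_le_nhds
    have l2 : Tendsto f (𝓝[≠] 0) (𝓝 (s D)) := tendsto_const_nhds.congr' (hev.mono fun t ht => ht.symm)
    have := tendsto_nhds_unique l1 l2
    simpa [f] using this

end

/-! ### The theta function -/

/-- The product `∏ (1 - Q ^ (n + 1) u)`. -/
def qProd (Q u : ℂ) : ℂ := ∏' n : ℕ, (1 - Q ^ (n + 1) * u)

section

variable {Q : ℂ} (hQ : ‖Q‖ < 1)
include hQ

theorem summable_pow_mul (u : ℂ) : Summable fun n : ℕ => ‖-(Q ^ (n + 1) * u)‖ := by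
  simpa using ((summable_nat_add_iff 1).mpr
    (summable_geometric_of_lt_one (norm_nonneg _) hQ)).mul_right ‖u‖

theorem multipliable_qProd (u : ℂ) : Multipliable fun n : ℕ => 1 - Q ^ (n + 1) * u := by
  simpa [sub_eq_add_neg] using multipliable_one_add_of_summable (summable_pow_mul hQ u)

theorem qProd_ne_zero {u : ℂ} (hu : ∀ n : ℕ, 1 - Q ^ (n + 1) * u ≠ 0) : qProd Q u ≠ 0 := by
  have := tprod_one_add_ne_zero_of_summable (f := fun n : ℕ => -(Q ^ (n + 1) * u))
    (by simpa [sub_eq_add_neg] using hu) (summable_pow_mul hQ u)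
  simpa [qProd, sub_eq_add_neg] using this

theorem qProd_eq_mul (u : ℂ) : qProd Q u = (1 - Q * u) * qProd Q (Q * u) := by
  unfold qProd
  rw [tprod_eq_zero_mul']
  · simp [pow_succ, mul_assoc]
  · simpa [pow_succ, mul_assoc] using multipliable_qProd hQ (Q * u)

/-- On a compact set the factors differ from `1` by at most a geometric sequence, so the product
converges locally uniformly and its limit is entire. -/
theorem differentiable_qProd : Differentiable ℂ (qProd Q) := by
  have h : MultipliableLocallyUniformlyOn (fun (n : ℕ) u => 1 - Q ^ (n + 1) * u)
      (Set.univ : Set ℂ) := by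
    use qProd Q
    simp_rw [sub_eq_add_neg]
    apply hasProdLocallyUniformlyOn_of_forall_compact isOpen_univ
    intro K _ hcK
    obtain ⟨R, hR⟩ := hcK.isBounded.exists_norm_le
    have := (((summable_nat_add_iff 1).mpr (summable_geometric_of_lt_one (norm_nonneg _)
      hQ)).mul_right R).hasProdUniformlyOn_nat_one_add hcK
      (f := fun (n : ℕ) u => -(Q ^ (n + 1) * u)) (.of_forall fun n x hx => by
        rw [norm_neg, norm_mul, norm_pow]
        exact mul_le_mul_of_nonneg_left (hR x hx) (by positivity)) (fun _ => by fun_prop)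
    have e : qProd Q = fun u => ∏' n : ℕ, (1 + -(Q ^ (n + 1) * u)) := by
      funext u
      simp only [qProd, sub_eq_add_neg]
    rw [e]
    exact this
  have h2 := h.hasProdLocallyUniformlyOn.differentiableOn
    (.of_forall fun _ => by
      simpa [Finset.prod_fn] using DifferentiableOn.finsetProd (fun _ _ => by fun_prop)) isOpen_univ
  exact differentiableOn_univ.1 h2

theorem tprod_triple (u v : ℂ) : ∏' n : ℕ, ((1 - Q ^ (n + 1)) *
    ((1 - Q ^ (n + 1) * u) * (1 - Q ^ (n + 1) * v))) = qProd Q 1 * (qProd Q u * qProd Q v) := by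
  have h1 := multipliable_qProd hQ 1
  simp only [mul_one] at h1
  rw [Multipliable.tprod_mul h1 ((multipliable_qProd hQ u).mul (multipliable_qProd hQ v)),
    Multipliable.tprod_mul (multipliable_qProd hQ u) (multipliable_qProd hQ v)]
  simp [qProd]

end

/-- Each quadratic factor splits as `(1 - t e^{2iz}) (1 - t e^{-2iz})` with `t = q^{2n}`. The
quasi-periodicity and the zeros can be read off this form. -/
theorem theta1_eq_qProd {τ : ℂ} (hτ : ‖Complex.exp (2 * Complex.I * Real.pi * τ)‖ < 1) (z : ℂ) :
    theta1 z τ = 2 * Complex.exp (Complex.I * Real.pi * τ / 4) * Complex.sin z *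
      (qProd (Complex.exp (2 * Complex.I * Real.pi * τ)) 1 *
        (qProd (Complex.exp (2 * Complex.I * Real.pi * τ)) (Complex.exp (2 * Complex.I * z)) *
        qProd (Complex.exp (2 * Complex.I * Real.pi * τ)) (Complex.exp (-(2 * Complex.I * z))))) := by
  rw [theta1, ← tprod_triple hτ]
  congr 1
  refine tprod_congr fun n => ?_
  have e1 : Complex.exp (2 * Complex.I * Real.pi * (n + 1) * τ) =
      Complex.exp (2 * Complex.I * Real.pi * τ) ^ (n + 1) := by
    rw [← Complex.exp_nat_mul]
    congr 1
    push_cast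
    ring
  have e2 : Complex.exp (4 * Complex.I * Real.pi * (n + 1) * τ) =
      (Complex.exp (2 * Complex.I * Real.pi * τ) ^ (n + 1)) ^ 2 := by
    rw [← Complex.exp_nat_mul, ← Complex.exp_nat_mul]
    congr 1
    push_cast
    ring
  have e3 : 2 * Complex.cos (2 * z) =
      Complex.exp (2 * Complex.I * z) + Complex.exp (-(2 * Complex.I * z)) := by
    rw [Complex.two_cos]
    congr 2 <;> ring
  have e4 : Complex.exp (2 * Complex.I * z) * Complex.exp (-(2 * Complex.I * z)) = 1 := by
    rw [← Complex.exp_add]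
    simp
  rw [e1, e2]
  generalize Complex.exp (2 * Complex.I * Real.pi * τ) ^ (n + 1) = t
  congr 1
  linear_combination -t * e3 - t ^ 2 * e4

/-! ### Quasi-periods and zeros of the elliptic function `s`. -/

section Elliptic

variable (r a : ℝ) (hr : 0 < r) (ha : 0 < a)

/-- The nome of the elliptic case. -/
def nome : ℂ := Complex.exp (-2 * r * a)

include hr ha in
theorem norm_nome_lt_one : ‖nome r a‖ < 1 := by
  rw [nome, Complex.norm_exp]
  simp only [Complex.mul_re, Complex.neg_re, Complex.ofReal_re, Complex.ofReal_im]
  simp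
  positivity

/-- For `τ = i r a / π`, the factor `e^{ra/4}` in `s` cancels `q^{1/4}`, and `q²` is the real number
`e^{-2ra}`. -/
theorem elliptic_s_eq (x : ℂ) : (Case.elliptic r a hr ha).s x =
    2 / r * qProd (nome r a) 1 * (Complex.sin (r * x) *
      (qProd (nome r a) (Complex.exp (2 * Complex.I * (r * x))) *
        qProd (nome r a) (Complex.exp (-(2 * Complex.I * (r * x)))))) := by
  have hpi : (Real.pi : ℂ) ≠ 0 := by exact_mod_cast Real.pi_ne_zero
  have e : Complex.exp (2 * Complex.I * Real.pi * (Complex.I * r * a / Real.pi)) = nome r a := by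
    rw [nome]
    congr 1
    field_simp
    rw [Complex.I_sq]
    ring
  have e2 : Complex.exp (r * a / 4) *
      Complex.exp (Complex.I * Real.pi * (Complex.I * r * a / Real.pi) / 4) = 1 := by
    rw [← Complex.exp_add, Complex.exp_eq_one_iff]
    refine ⟨0, ?_⟩
    field_simp
    rw [Complex.I_sq]
    simp
  have := theta1_eq_qProd (τ := Complex.I * r * a / Real.pi)
    (by rw [e]; exact norm_nome_lt_one r a hr ha) (r * x)
  rw [Case.s, this, e]
  linear_combination (1 / (r : ℂ)) * 2 * Complex.sin (r * x) * (qProd (nome r a) 1 *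
    (qProd (nome r a) (Complex.exp (2 * Complex.I * (r * x))) *
      qProd (nome r a) (Complex.exp (-(2 * Complex.I * (r * x)))))) * e2

theorem elliptic_differentiable_s : Differentiable ℂ (Case.elliptic r a hr ha).s := by
  have h := differentiable_qProd (norm_nome_lt_one r a hr ha)
  rw [funext (elliptic_s_eq r a hr ha)]
  fun_prop

theorem elliptic_s_add_first (z : ℂ) :
    (Case.elliptic r a hr ha).s (z + Real.pi / r) = -(Case.elliptic r a hr ha).s z := by
  have hr' : (r : ℂ) ≠ 0 := by exact_mod_cast hr.ne'
  have e : (r : ℂ) * (z + Real.pi / r) = r * z + Real.pi := by field_simp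
  have e1 : Complex.exp (2 * Complex.I * (r * z + Real.pi)) = Complex.exp (2 * Complex.I * (r * z)) := by
    rw [mul_add, show 2 * Complex.I * (Real.pi : ℂ) = 2 * Real.pi * Complex.I by ring,
      Complex.exp_add, Complex.exp_two_pi_mul_I, mul_one]
  rw [elliptic_s_eq, elliptic_s_eq, e, Complex.exp_neg, e1, ← Complex.exp_neg,
    Complex.sin_add_pi]
  ring

theorem elliptic_s_add_second (z : ℂ) :
    (Case.elliptic r a hr ha).s (z + Complex.I * a) =
      -Complex.exp (-2 * Complex.I * r * (z + Complex.I * a / 2)) *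
        (Case.elliptic r a hr ha).s z := by
  have hQ := norm_nome_lt_one r a hr ha
  have hI := Complex.I_sq
  set v := Complex.exp (Complex.I * (r * z)) with hv
  set p := Complex.exp (-(r * a : ℂ)) with hp
  have hv0 : v ≠ 0 := Complex.exp_ne_zero _
  have hp0 : p ≠ 0 := Complex.exp_ne_zero _
  have en : nome r a = p ^ 2 := by
    rw [nome, hp, ← Complex.exp_nat_mul]
    congr 1
    push_cast
    ring
  have eu : Complex.exp (2 * Complex.I * (r * z)) = v ^ 2 := by
    rw [hv, ← Complex.exp_nat_mul]
    congr 1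
    push_cast
    ring
  have eu' : Complex.exp (2 * Complex.I * (r * (z + Complex.I * a))) = p ^ 2 * v ^ 2 := by
    rw [hv, hp, ← Complex.exp_nat_mul, ← Complex.exp_nat_mul, ← Complex.exp_add]
    congr 1
    push_cast
    linear_combination (2 * r * a : ℂ) * hI
  have es : Complex.sin (r * z) = (v⁻¹ - v) * Complex.I / 2 := by
    rw [Complex.sin, hv, ← Complex.exp_neg]
    congr 4 <;> ring
  have es' : Complex.sin (r * (z + Complex.I * a)) = ((p * v)⁻¹ - p * v) * Complex.I / 2 := by
    rw [Complex.sin, hv, hp, ← Complex.exp_add, ← Complex.exp_neg]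
    congr 4
    · linear_combination (-(r * a) : ℂ) * hI
    · linear_combination (r * a : ℂ) * hI
  have em : Complex.exp (-2 * Complex.I * r * (z + Complex.I * a / 2)) = (p * v ^ 2)⁻¹ := by
    rw [hv, hp, ← Complex.exp_nat_mul, ← Complex.exp_add, ← Complex.exp_neg]
    congr 1
    push_cast
    linear_combination (-(r * a) : ℂ) * hI
  -- The translation multiplies `e^{2irz}` by the nome `p ^ 2`: one of the two products loses its
  -- first factor and the other gains one.
  have q1 := qProd_eq_mul hQ (v ^ 2)
  have q2 := qProd_eq_mul hQ ((p ^ 2 * v ^ 2)⁻¹)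
  rw [en] at q1 q2
  rw [show p ^ 2 * (p ^ 2 * v ^ 2)⁻¹ = (v ^ 2)⁻¹ by field_simp] at q2
  rw [elliptic_s_eq, elliptic_s_eq, Complex.exp_neg, Complex.exp_neg, eu, eu', es, es', em, en, q1, q2]
  field_simp
  ring

theorem elliptic_exists_of_s_eq_zero (z : ℂ) (hz : (Case.elliptic r a hr ha).s z = 0) :
    ∃ m n : ℤ, z = m * (Real.pi / r) + n * (Complex.I * a) := by
  have hQ := norm_nome_lt_one r a hr ha
  have hr' : (r : ℂ) ≠ 0 := by exact_mod_cast hr.ne'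
  have hQ0 : ‖nome r a‖ ≠ 0 := by
    rw [norm_ne_zero_iff]
    exact Complex.exp_ne_zero _
  have q1 : qProd (nome r a) 1 ≠ 0 := by
    refine qProd_ne_zero hQ fun n h => ?_
    rw [mul_one, sub_eq_zero] at h
    have := congrArg norm h
    rw [norm_one, norm_pow] at this
    exact absurd this (pow_lt_one₀ (norm_nonneg _) hQ (by omega)).ne'
  -- A vanishing factor of either infinite product determines the exponent up to `2πi`. The two
  -- products supply the lattice rows below and above the real axis.
  have key : ∀ (n : ℕ) (w : ℂ), 1 - nome r a ^ (n + 1) * Complex.exp w = 0 →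
      ∃ m : ℤ, w = m * (2 * Real.pi * Complex.I) + (n + 1) * (2 * r * a) := by
    intro n w h
    rw [nome, ← Complex.exp_nat_mul, ← Complex.exp_add, sub_eq_zero] at h
    obtain ⟨m, hm⟩ := Complex.exp_eq_one_iff.1 h.symm
    refine ⟨m, ?_⟩
    push_cast at hm
    linear_combination hm
  rw [elliptic_s_eq] at hz
  have h2 : (2 / r : ℂ) ≠ 0 := div_ne_zero two_ne_zero hr'
  rcases mul_eq_zero.1 ((mul_eq_zero.1 hz).resolve_left (mul_ne_zero h2 q1)) with h | h
  · obtain ⟨k, hk⟩ := Complex.sin_eq_zero_iff.1 h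
    refine ⟨k, 0, ?_⟩
    field_simp
    push_cast
    linear_combination hk
  · have hI := Complex.I_sq
    rcases mul_eq_zero.1 h with h | h
    · have : ∃ n : ℕ, 1 - nome r a ^ (n + 1) * Complex.exp (2 * Complex.I * (r * z)) = 0 := by
        by_contra! h'
        exact qProd_ne_zero hQ h' h
      obtain ⟨n, hn⟩ := this
      obtain ⟨m, hm⟩ := key n _ hn
      refine ⟨m, -(n + 1), ?_⟩
      field_simp
      push_cast
      linear_combination (-Complex.I / 2) * hm + (r * z - m * Real.pi) * hI
    · have : ∃ n : ℕ, 1 - nome r a ^ (n + 1) * Complex.exp (-(2 * Complex.I * (r * z))) = 0 := by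
        by_contra! h'
        exact qProd_ne_zero hQ h' h
      obtain ⟨n, hn⟩ := this
      obtain ⟨m, hm⟩ := key n _ hn
      refine ⟨-m, n + 1, ?_⟩
      field_simp
      push_cast
      linear_combination (Complex.I / 2) * hm + (r * z + m * Real.pi) * hI

/-- The sine vanishes at `0`, so only its derivative contributes, multiplied by nonzero infinite
products. -/
theorem elliptic_deriv_s_zero : deriv (Case.elliptic r a hr ha).s 0 ≠ 0 := by
  have hQ := norm_nome_lt_one r a hr ha
  have hr' : (r : ℂ) ≠ 0 := by exact_mod_cast hr.ne'
  have q1 : qProd (nome r a) 1 ≠ 0 := by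
    refine qProd_ne_zero hQ fun n h => ?_
    rw [mul_one, sub_eq_zero] at h
    have := congrArg norm h
    rw [norm_one, norm_pow] at this
    exact absurd this (pow_lt_one₀ (norm_nonneg _) hQ (by omega)).ne'
  have hd := differentiable_qProd hQ
  have h1 : HasDerivAt (fun x : ℂ => Complex.sin (r * x)) (r : ℂ) 0 := by
    have := (Complex.hasDerivAt_sin ((r : ℂ) * 0)).comp 0 ((hasDerivAt_id (0 : ℂ)).const_mul (r : ℂ))
    simpa [Function.comp_def] using this
  have h2 : DifferentiableAt ℂ (fun x : ℂ => qProd (nome r a) (Complex.exp (2 * Complex.I * (r * x))) *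
        qProd (nome r a) (Complex.exp (-(2 * Complex.I * (r * x))))) 0 := by fun_prop
  have h3 := (h1.mul h2.hasDerivAt).const_mul (2 / (r : ℂ) * qProd (nome r a) 1)
  rw [funext (elliptic_s_eq r a hr ha)]
  have h4 := h3.deriv
  simp only [mul_zero, Complex.sin_zero, zero_mul, add_zero, neg_zero, Complex.exp_zero] at h4
  erw [h4]
  have h2' : (2 / r : ℂ) ≠ 0 := div_ne_zero two_ne_zero hr'
  exact mul_ne_zero (mul_ne_zero h2' q1) (mul_ne_zero hr' (mul_ne_zero q1 q1))

end Elliptic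

/-! ### The three-term relation for the theta function -/

/-- Two entire functions with the same multipliers on a rectangular lattice are proportional if
the zeros of the second are simple and zeros of the first. -/
theorem exists_eq_const_mul_of_quasiperiodic {h d μ ν : ℂ → ℂ} {p a : ℝ} (hp : 0 < p) (ha : 0 < a)
    (hh : Differentiable ℂ h) (hd : Differentiable ℂ d)
    (hμ : ∀ z, μ z ≠ 0) (hν : ∀ z, ν z ≠ 0)
    (h1 : ∀ z, h (z + p) = μ z * h z) (d1 : ∀ z, d (z + p) = μ z * d z)
    (h2 : ∀ z, h (z + Complex.I * a) = ν z * h z) (d2 : ∀ z, d (z + Complex.I * a) = ν z * d z)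
    (simple : ∀ z, d z = 0 → deriv d z ≠ 0) (zero : ∀ z, d z = 0 → h z = 0) :
    ∃ C, ∀ z, h z = C * d z := by
  classical
  -- At a zero of `d` the quotient `h / d` is given its limit, the quotient of derivatives. As the
  -- zeros are simple and shared by `h`, this makes it entire.
  let F : ℂ → ℂ := fun z => if d z = 0 then deriv h z / deriv d z else h z / d z
  have hFne : ∀ z, d z ≠ 0 → F z = h z / d z := fun z hz => if_neg hz
  have hF : Differentiable ℂ F := by
    intro z₀
    by_cases hz : d z₀ = 0
    · have hds : ∀ f : ℂ → ℂ, Differentiable ℂ f → DifferentiableAt ℂ (dslope f z₀) z₀ :=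
        fun f hf => ((Complex.differentiableOn_dslope (s := Set.univ) univ_mem).2
          hf.differentiableOn).differentiableAt univ_mem
      have hn : dslope d z₀ z₀ ≠ 0 := by
        rw [dslope_same]
        exact simple _ hz
      have key : ∀ f : ℂ → ℂ, f z₀ = 0 → ∀ z, f z = (z - z₀) * dslope f z₀ z := fun f hf z => by
        have := sub_smul_dslope f z₀ z
        rw [hf, sub_zero, smul_eq_mul] at this
        exact this.symm
      refine ((hds h hh).div (hds d hd) hn).congr_of_eventuallyEq ?_
      filter_upwards [(hds d hd).continuousAt.eventually_ne hn] with z hz'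
      by_cases e : z = z₀
      · subst e
        simp [F, hz, dslope_same]
      · have hdz : d z ≠ 0 := by
          rw [key d hz]
          exact mul_ne_zero (sub_ne_zero.2 e) hz'
        rw [hFne z hdz, key d hz, key h (zero _ hz), mul_div_mul_left _ _ (sub_ne_zero.2 e)]
        rfl
    · refine ((hh z₀).div (hd z₀) hz).congr_of_eventuallyEq ?_
      filter_upwards [(hd z₀).continuousAt.eventually_ne hz] with z hz'
      exact hFne z hz'
  have dense : Dense {z | d z ≠ 0} := by
    intro z₀
    by_cases hz : d z₀ = 0
    · rw [mem_closure_iff_frequently]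
      have := (hd z₀).hasDerivAt.eventually_ne (simple _ hz) (c := 0)
      exact (this.frequently).filter_mono nhdsWithin_le_nhds
    · exact subset_closure hz
  -- The common multiplier cancels off the zeros of `d`. Those zeros have dense complement, so
  -- periodicity extends by continuity.
  have per : ∀ (c : ℂ) (m : ℂ → ℂ), (∀ z, m z ≠ 0) → (∀ z, h (z + c) = m z * h z) →
      (∀ z, d (z + c) = m z * d z) → Function.Periodic F c := by
    intro c m hm e1 e2
    have hc : Continuous fun z => F (z + c) := hF.continuous.comp (by fun_prop)
    refine fun z => congrFun (Continuous.ext_on dense hc hF.continuous fun z hz => ?_) z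
    have hz' : d (z + c) ≠ 0 := by
      rw [e2]
      exact mul_ne_zero (hm z) hz
    rw [hFne _ hz', hFne _ hz, e1, e2, mul_div_mul_left _ _ (hm z)]
  have per1 := per p μ hμ h1 d1
  have per2 := per (Complex.I * a) ν hν h2 d2
  have bdd : Bornology.IsBounded (Set.range F) := by
    have hK : IsCompact (Set.Icc 0 p ×ℂ Set.Icc 0 a) := isCompact_Icc.reProdIm isCompact_Icc
    refine (hK.image hF.continuous).isBounded.subset ?_
    rintro _ ⟨z, rfl⟩
    -- Translation into the closed period rectangle makes `F` bounded, as Liouville's theorem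
    -- requires.
    refine ⟨z - (⌊z.im / a⌋ : ℤ) * (Complex.I * a) - (⌊z.re / p⌋ : ℤ) * p, ?_, ?_⟩
    · have e1 := Int.floor_le (z.re / p)
      have e2 := Int.lt_floor_add_one (z.re / p)
      have e3 := Int.floor_le (z.im / a)
      have e4 := Int.lt_floor_add_one (z.im / a)
      rw [le_div_iff₀ hp] at e1
      rw [div_lt_iff₀ hp] at e2
      rw [le_div_iff₀ ha] at e3
      rw [div_lt_iff₀ ha] at e4
      rw [Complex.mem_reProdIm]
      constructor
      · simp only [Complex.sub_re, Complex.mul_re, Complex.intCast_re, Complex.intCast_im,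
          Complex.I_re, Complex.I_im, Complex.ofReal_re, Complex.ofReal_im, Set.mem_Icc]
        constructor <;> linarith
      · simp only [Complex.sub_im, Complex.mul_im, Complex.mul_re, Complex.intCast_re,
          Complex.intCast_im, Complex.I_re, Complex.I_im, Complex.ofReal_re, Complex.ofReal_im,
          Set.mem_Icc]
        constructor <;> linarith
    · rw [(per1.int_mul _).sub_eq, (per2.int_mul _).sub_eq]
  refine ⟨F 0, fun z => ?_⟩
  by_cases hz : d z = 0
  · rw [hz, zero z hz, mul_zero]
  · rw [hF.apply_eq_apply_of_bounded bdd 0 z, hFne z hz]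
    field_simp

/-- At a zero of `f`, the derivative of `μ * f` is just `μ * f'`. Thus simple zeros travel along
quasi-periods, and the zero at the origin determines the order of all others. -/
theorem periodic_simple_zero {f μ : ℂ → ℂ} {c : ℂ} (hf : Differentiable ℂ f)
    (hμ : Differentiable ℂ μ) (hμ0 : ∀ z, μ z ≠ 0) (h : ∀ z, f (z + c) = μ z * f z) :
    Function.Periodic (fun z => f z = 0 ∧ deriv f z ≠ 0) c := by
  intro z
  have e : f (z + c) = 0 ↔ f z = 0 := by simp [h z, hμ0 z]
  simp only [eq_iff_iff, e]
  refine and_congr_right fun hz => ?_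
  have h1 := deriv_comp_add_const f c z
  rw [funext h, deriv_fun_mul (hμ z) (hf z), hz, mul_zero, zero_add] at h1
  rw [← h1]
  simp [hμ0 z]

section Elliptic

variable (r a : ℝ) (hr : 0 < r) (ha : 0 < a)

local notation "θ" => Case.s (Case.elliptic r a hr ha)

theorem elliptic_s_periodic_simple_zero (m n : ℤ) (z : ℂ) :
    (θ (z + m * (Real.pi / r) + n * (Complex.I * a)) = 0 ∧
      deriv θ (z + m * (Real.pi / r) + n * (Complex.I * a)) ≠ 0) ↔ (θ z = 0 ∧ deriv θ z ≠ 0) := by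
  have h1 := periodic_simple_zero (elliptic_differentiable_s r a hr ha)
    (differentiable_const (-1 : ℂ)) (fun _ => by norm_num)
    (c := Real.pi / r) (fun z => by rw [elliptic_s_add_first]; ring)
  have h2 := periodic_simple_zero (elliptic_differentiable_s r a hr ha)
    (μ := fun z => -Complex.exp (-2 * Complex.I * r * (z + Complex.I * a / 2))) (by fun_prop)
    (fun _ => neg_ne_zero.2 (Complex.exp_ne_zero _)) (elliptic_s_add_second r a hr ha)
  have e1 := (h2.int_mul n) (z + m * (Real.pi / r))
  have e2 := (h1.int_mul m) z
  exact (iff_of_eq e1).trans (iff_of_eq e2)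

theorem elliptic_s_at_zero : θ 0 = 0 := by
  have := (Case.elliptic r a hr ha).s_neg 0
  rw [neg_zero] at this
  exact CharZero.eq_neg_self_iff.1 this

theorem elliptic_s_eq_zero_iff (z : ℂ) :
    θ z = 0 ↔ ∃ m n : ℤ, z = m * (Real.pi / r) + n * (Complex.I * a) := by
  refine ⟨elliptic_exists_of_s_eq_zero r a hr ha z, ?_⟩
  rintro ⟨m, n, rfl⟩
  have := (elliptic_s_periodic_simple_zero r a hr ha m n 0).2
    ⟨elliptic_s_at_zero r a hr ha, elliptic_deriv_s_zero r a hr ha⟩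
  rw [zero_add] at this
  exact this.1

theorem elliptic_deriv_s_ne_zero {z : ℂ} (hz : θ z = 0) : deriv θ z ≠ 0 := by
  obtain ⟨m, n, rfl⟩ := elliptic_exists_of_s_eq_zero r a hr ha z hz
  have := (elliptic_s_periodic_simple_zero r a hr ha m n 0).2
    ⟨elliptic_s_at_zero r a hr ha, elliptic_deriv_s_zero r a hr ha⟩
  rw [zero_add] at this
  exact this.2

theorem elliptic_s_eventually_ne (z : ℂ) : ∀ᶠ t in 𝓝[≠] z, θ t ≠ 0 := by
  by_cases hz : θ z = 0
  · exact ((elliptic_differentiable_s r a hr ha) z).hasDerivAt.eventually_ne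
      (elliptic_deriv_s_ne_zero r a hr ha hz)
  · exact (((elliptic_differentiable_s r a hr ha) z).continuousAt.eventually_ne hz).filter_mono
      nhdsWithin_le_nhds

theorem elliptic_pair_add_first (x y : ℂ) :
    θ (x + Real.pi / r + y) * θ (x + Real.pi / r - y) = 1 * (θ (x + y) * θ (x - y)) := by
  rw [show x + Real.pi / r + y = x + y + Real.pi / r by ring,
    show x + Real.pi / r - y = x - y + Real.pi / r by ring,
    elliptic_s_add_first, elliptic_s_add_first]
  ring

theorem elliptic_pair_add_second (x y : ℂ) :
    θ (x + Complex.I * a + y) * θ (x + Complex.I * a - y) =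
      Complex.exp (-4 * Complex.I * r * (x + Complex.I * a / 2)) * (θ (x + y) * θ (x - y)) := by
  rw [show x + Complex.I * a + y = x + y + Complex.I * a by ring,
    show x + Complex.I * a - y = x - y + Complex.I * a by ring,
    elliptic_s_add_second, elliptic_s_add_second,
    show -4 * Complex.I * r * (x + Complex.I * a / 2) =
      -2 * Complex.I * r * (x + y + Complex.I * a / 2) +
      -2 * Complex.I * r * (x - y + Complex.I * a / 2) by ring, Complex.exp_add]
  ring

/-- As functions of `x`, the three terms have the same multipliers. The last two together vanish at
the zeros `± y` of the first modulo periods, so their sum is a constant multiple of `θ(x + y) θ(x -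
y)`. The hypotheses make these zeros simple and allow the constant to be read off at `x = z`. -/
theorem elliptic_threeTerm_of_ne {x y z w : ℂ} (hy : θ (2 * y) ≠ 0) (h1 : θ (z + y) ≠ 0)
    (h2 : θ (z - y) ≠ 0) :
    θ (x + y) * θ (x - y) * (θ (z + w) * θ (z - w)) +
    θ (x + z) * θ (x - z) * (θ (w + y) * θ (w - y)) +
    θ (x + w) * θ (x - w) * (θ (y + z) * θ (y - z)) = 0 := by
  have hs := elliptic_differentiable_s r a hr ha
  have odd := (Case.elliptic r a hr ha).s_neg
  have h0 := elliptic_s_at_zero r a hr ha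
  let d : ℂ → ℂ := fun x => θ (x + y) * θ (x - y)
  let h : ℂ → ℂ := fun x => θ (w + y) * θ (w - y) * (θ (x + z) * θ (x - z)) +
    θ (y + z) * θ (y - z) * (θ (x + w) * θ (x - w))
  have hd : Differentiable ℂ d := by fun_prop
  have hh : Differentiable ℂ h := by fun_prop
  have hper1 : ∀ x, h (x + (Real.pi / r : ℝ)) = 1 * h x := by
    intro x
    simp only [h]
    push_cast
    rw [elliptic_pair_add_first, elliptic_pair_add_first]
    ring
  have hper2 : ∀ x, h (x + Complex.I * a) =
      Complex.exp (-4 * Complex.I * r * (x + Complex.I * a / 2)) * h x := by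
    intro x
    simp only [h]
    rw [elliptic_pair_add_second, elliptic_pair_add_second]
    ring
  have hzero : ∀ x (m n : ℤ), h x = 0 → h (x + m * (Real.pi / r) + n * (Complex.I * a)) = 0 := by
    intro x m n hx
    have p1 : Function.Periodic (fun x => h x = 0) (Real.pi / r) := fun x => by
      have := hper1 x
      push_cast at this
      simp [this]
    have p2 : Function.Periodic (fun x => h x = 0) (Complex.I * a) := fun x => by
      simp [hper2 x]
    have e1 := p2.int_mul n (x + m * (Real.pi / r))
    have e2 := p1.int_mul m x
    exact ((iff_of_eq e1).trans (iff_of_eq e2)).2 hx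
  have hy' : θ (-(2 * y)) ≠ 0 := by
    rw [odd]
    exact neg_ne_zero.2 hy
  -- The zeros of `θ` form a group, so `θ(x + y)` and `θ(x - y)` cannot vanish together when `θ(2y)
  -- ≠ 0`.
  have transl : ∀ u v : ℂ, θ u = 0 → θ v ≠ 0 → θ (u + v) ≠ 0 := by
    intro u v hu hv huv
    obtain ⟨m, n, e⟩ := elliptic_exists_of_s_eq_zero r a hr ha u hu
    obtain ⟨m', n', e'⟩ := elliptic_exists_of_s_eq_zero r a hr ha _ huv
    refine hv ((elliptic_s_eq_zero_iff r a hr ha v).2 ⟨m' - m, n' - n, ?_⟩)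
    push_cast
    linear_combination e' - e
  obtain ⟨C, hC⟩ := exists_eq_const_mul_of_quasiperiodic (h := h) (d := d) (μ := fun _ => 1)
    (ν := fun x => Complex.exp (-4 * Complex.I * r * (x + Complex.I * a / 2)))
    (div_pos Real.pi_pos hr) ha hh hd (fun _ => one_ne_zero) (fun _ => Complex.exp_ne_zero _)
    hper1 (fun x => by
      simp only [d]
      push_cast
      exact elliptic_pair_add_first r a hr ha x y) hper2
    (fun x => elliptic_pair_add_second r a hr ha x y)
    (fun x hx => by
      have hD : deriv d x = deriv θ (x + y) * θ (x - y) + θ (x + y) * deriv θ (x - y) := by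
        have e1 := ((hs (x + y)).hasDerivAt).comp_add_const x y
        have e2 := ((hs (x - y)).hasDerivAt).comp_sub_const x y
        exact (e1.mul e2).deriv
      rw [hD]
      rcases mul_eq_zero.1 hx with e | e
      · rw [e, zero_mul, add_zero]
        refine mul_ne_zero (elliptic_deriv_s_ne_zero r a hr ha e) ?_
        rw [show x - y = x + y + -(2 * y) by ring]
        exact transl _ _ e hy'
      · rw [e, mul_zero, zero_add]
        refine mul_ne_zero ?_ (elliptic_deriv_s_ne_zero r a hr ha e)
        rw [show x + y = x - y + 2 * y by ring]
        exact transl _ _ e hy)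
    (fun x hx => by
      rcases mul_eq_zero.1 hx with e | e
      · obtain ⟨m, n, e'⟩ := elliptic_exists_of_s_eq_zero r a hr ha _ e
        rw [show x = -y + m * (Real.pi / r) + n * (Complex.I * a) by linear_combination e']
        apply hzero
        simp only [h]
        rw [show w - y = -(y - w) by ring, show -y + z = -(y - z) by ring,
          show -y - z = -(y + z) by ring, show -y + w = -(y - w) by ring,
          show -y - w = -(w + y) by ring, odd, odd, odd, odd]
        ring
      · obtain ⟨m, n, e'⟩ := elliptic_exists_of_s_eq_zero r a hr ha _ e
        rw [show x = y + m * (Real.pi / r) + n * (Complex.I * a) by linear_combination e']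
        apply hzero
        simp only [h]
        rw [show w - y = -(y - w) by ring, odd, add_comm w y]
        ring)
  -- At `x = z` one of the two terms of `h` vanishes, which leaves a formula for `C`.
  have hz := hC z
  simp only [h, d, sub_self, h0, mul_zero, zero_add] at hz
  rw [add_comm y z, ← neg_sub z y, odd] at hz
  have hCval : C = -(θ (z + w) * θ (z - w)) := by
    have : θ (z + y) * θ (z - y) * (C + θ (z + w) * θ (z - w)) = 0 := by linear_combination -hz
    linear_combination (mul_eq_zero.1 this).resolve_left (mul_ne_zero h1 h2)
  have hx := hC x
  simp only [h, d, hCval] at hx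
  linear_combination hx

/-- The excluded values of `y` are isolated, and both sides are continuous in `y`. -/
theorem elliptic_threeTerm : ThreeTerm θ := by
  intro x y z w
  have hs := (elliptic_differentiable_s r a hr ha).continuous
  let f : ℂ → ℂ := fun y => θ (x + y) * θ (x - y) * (θ (z + w) * θ (z - w)) +
    θ (x + z) * θ (x - z) * (θ (w + y) * θ (w - y)) +
    θ (x + w) * θ (x - w) * (θ (y + z) * θ (y - z))
  have hf : Continuous f := by fun_prop
  have shift_ne : ∀ (φ : ℂ → ℂ), Continuous φ → Function.Injective φ →
      ∀ᶠ t in 𝓝[≠] y, θ (φ t) ≠ 0 := by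
    intro φ hφ hi
    refine (tendsto_nhdsWithin_iff.2 ⟨hφ.continuousAt.tendsto.mono_left nhdsWithin_le_nhds, ?_⟩
      : Tendsto φ (𝓝[≠] y) (𝓝[≠] (φ y))).eventually (elliptic_s_eventually_ne r a hr ha (φ y))
    filter_upwards [self_mem_nhdsWithin] with t ht
    exact fun e => ht (hi e)
  have ev : ∀ᶠ t in 𝓝[≠] y, f t = 0 := by
    filter_upwards [shift_ne (fun t => 2 * t) (by fun_prop) (mul_right_injective₀ two_ne_zero),
      shift_ne (fun t => z + t) (by fun_prop) (add_right_injective z),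
      shift_ne (fun t => z - t) (by fun_prop) (sub_right_injective)] with t h1 h2 h3
    exact elliptic_threeTerm_of_ne r a hr ha h1 h2 h3
  have l1 : Tendsto f (𝓝[≠] y) (𝓝 (f y)) := hf.continuousAt.tendsto.mono_left nhdsWithin_le_nhds
  have l2 : Tendsto f (𝓝[≠] y) (𝓝 0) := tendsto_const_nhds.congr' (ev.mono fun t ht => ht.symm)
  exact tendsto_nhds_unique l1 l2

/-- This is the three-term relation at points separated by quarter periods: one product contains
`θ(2u)`, and the others contain `θ` at `u` shifted by half periods. Quasi-periodicity makes the
latter two products equal, hence the factor `2`. -/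
theorem elliptic_duplication (u : ℂ) :
    θ (2 * u) * (θ (-(Real.pi / r / 2)) * θ (-(Complex.I * a / 2)) *
        θ ((Real.pi / r + Complex.I * a) / 2)) =
      2 * (θ u * θ (u - Real.pi / r / 2) * θ (u - Complex.I * a / 2) *
        θ (u + (Real.pi / r + Complex.I * a) / 2)) := by
  have hr' : (r : ℂ) ≠ 0 := by exact_mod_cast hr.ne'
  have odd := (Case.elliptic r a hr ha).s_neg
  have h := elliptic_threeTerm r a hr ha (u + Real.pi / r / 4) (u - Real.pi / r / 4)
    (-(Real.pi / r / 4)) (Real.pi / r / 4 + Complex.I * a / 2)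
  have e1 := elliptic_s_add_first r a hr ha (u - Real.pi / r / 2)
  have e2 := elliptic_s_add_second r a hr ha (u - Complex.I * a / 2)
  have e3 := elliptic_s_add_first r a hr ha (u - (Real.pi / r + Complex.I * a) / 2)
  have e4 := elliptic_s_add_second r a hr ha
    (u - (Real.pi / r + Complex.I * a) / 2 + Real.pi / r)
  have e5 : Complex.exp (-2 * Complex.I * r * (u - (Real.pi / r + Complex.I * a) / 2 + Real.pi / r +
      Complex.I * a / 2)) = -Complex.exp (-2 * Complex.I * r * u) := by
    rw [show -2 * Complex.I * r * (u - (Real.pi / r + Complex.I * a) / 2 + Real.pi / r +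
      Complex.I * a / 2) = -2 * Complex.I * r * u - Real.pi * Complex.I by field_simp; ring,
      Complex.exp_sub, Complex.exp_pi_mul_I]
    ring
  rw [show u - (Real.pi / r + Complex.I * a) / 2 + Real.pi / r + Complex.I * a =
    u + (Real.pi / r + Complex.I * a) / 2 by ring, e3, e5] at e4
  rw [show u - Real.pi / r / 2 + Real.pi / r = u + Real.pi / r / 2 by ring] at e1
  rw [show u - Complex.I * a / 2 + Complex.I * a = u + Complex.I * a / 2 by ring,
    show u - Complex.I * a / 2 + Complex.I * a / 2 = u by ring] at e2
  rw [show u + Real.pi / r / 4 + (u - Real.pi / r / 4) = 2 * u by ring,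
    show u + Real.pi / r / 4 - (u - Real.pi / r / 4) = Real.pi / r / 2 by ring,
    show -(Real.pi / r / 4 : ℂ) + (Real.pi / r / 4 + Complex.I * a / 2) = Complex.I * a / 2 by ring,
    show -(Real.pi / r / 4 : ℂ) - (Real.pi / r / 4 + Complex.I * a / 2) =
      -((Real.pi / r + Complex.I * a) / 2) by ring,
    show u + Real.pi / r / 4 + -(Real.pi / r / 4) = u by ring,
    show u + Real.pi / r / 4 - -(Real.pi / r / 4) = u + Real.pi / r / 2 by ring,
    show Real.pi / r / 4 + Complex.I * a / 2 + (u - Real.pi / r / 4) =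
      u + Complex.I * a / 2 by ring,
    show Real.pi / r / 4 + Complex.I * a / 2 - (u - Real.pi / r / 4) =
      -(u - (Real.pi / r + Complex.I * a) / 2) by ring,
    show u + Real.pi / r / 4 + (Real.pi / r / 4 + Complex.I * a / 2) =
      u + (Real.pi / r + Complex.I * a) / 2 by ring,
    show u + Real.pi / r / 4 - (Real.pi / r / 4 + Complex.I * a / 2) =
      u - Complex.I * a / 2 by ring,
    show u - Real.pi / r / 4 + -(Real.pi / r / 4) = u - Real.pi / r / 2 by ring,
    show u - Real.pi / r / 4 - -(Real.pi / r / 4) = u by ring, odd, odd, e1, e2] at h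
  rw [odd, odd]
  rw [e4] at h ⊢
  linear_combination -h

end Elliptic

/-! ### Common properties of the four functions `s` -/

namespace Case

variable (c : Case)

theorem s_zero : c.s 0 = 0 := by
  have := c.s_neg 0
  rw [neg_zero] at this
  exact CharZero.eq_neg_self_iff.1 this

theorem differentiable_s : Differentiable ℂ c.s := by
  cases c with
  | rational => exact differentiable_id
  | trigonometric r hr => unfold s; fun_prop
  | hyperbolic a ha => unfold s; fun_prop
  | elliptic r a hr ha => exact elliptic_differentiable_s r a hr ha

theorem continuous_s : Continuous c.s := c.differentiable_s.continuous

theorem s_twoTerm (h : ¬ c.IsElliptic) : TwoTerm c.s := by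
  intro x y
  cases c with
  | rational => simp only [s]; ring
  | trigonometric r hr =>
    simp only [s, mul_add, mul_sub, Complex.sin_add, Complex.sin_sub]
    linear_combination (1 / (r : ℂ)) ^ 2 * (Complex.sin (r * x) ^ 2 * Complex.cos_sq' (r * y) -
      Complex.sin (r * y) ^ 2 * Complex.cos_sq' (r * x))
  | hyperbolic a ha =>
    simp only [s, mul_add, mul_sub, add_div, sub_div, Complex.sinh_add, Complex.sinh_sub]
    linear_combination ((a : ℂ) / Real.pi) ^ 2 *
      (Complex.sinh (Real.pi * x / a) ^ 2 * Complex.cosh_sq (Real.pi * y / a) -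
      Complex.sinh (Real.pi * y / a) ^ 2 * Complex.cosh_sq (Real.pi * x / a))
  | elliptic r a hr ha => exact absurd trivial h

theorem s_threeTerm : ThreeTerm c.s := by
  by_cases h : c.IsElliptic
  · cases c with
    | elliptic r a hr ha => exact elliptic_threeTerm r a hr ha
    | _ => exact h.elim
  · exact (c.s_twoTerm h).threeTerm

theorem omega_mem_periods (ν : Fin (c.rho + 1)) : c.omega ν ∈ c.periods :=
  AddSubgroup.subset_closure ⟨ν, rfl⟩

theorem mem_periods_of_s_eq_zero {z : ℂ} (hz : c.s z = 0) : z ∈ c.periods := by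
  have hpi : (Real.pi : ℂ) ≠ 0 := by exact_mod_cast Real.pi_ne_zero
  cases c with
  | rational =>
    have : z = 0 := hz
    rw [this]
    exact zero_mem _
  | trigonometric r hr =>
    have hr' : (r : ℂ) ≠ 0 := by exact_mod_cast hr.ne'
    obtain ⟨k, hk⟩ := Complex.sin_eq_zero_iff.1
      ((mul_eq_zero.1 hz).resolve_left (one_div_ne_zero hr'))
    have h1 : (Real.pi / r : ℂ) ∈ (trigonometric r hr).periods :=
      (trigonometric r hr).omega_mem_periods (1 : Fin 2)
    have := zsmul_mem h1 k
    rwa [show k • (Real.pi / r : ℂ) = z by rw [zsmul_eq_mul]; field_simp; exact hk.symm] at this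
  | hyperbolic a ha =>
    have ha' : (a : ℂ) ≠ 0 := by exact_mod_cast ha.ne'
    have h0 := (mul_eq_zero.1 hz).resolve_left (div_ne_zero ha' hpi)
    have h0' : Complex.sin (Real.pi * z / a * Complex.I) = 0 := by
      rw [Complex.sin_mul_I, h0, zero_mul]
    obtain ⟨k, hk⟩ := Complex.sin_eq_zero_iff.1 h0'
    have h1 : (Complex.I * a : ℂ) ∈ (hyperbolic a ha).periods :=
      (hyperbolic a ha).omega_mem_periods (1 : Fin 2)
    have := zsmul_mem h1 (-k)
    rwa [show (-k) • (Complex.I * a : ℂ) = z by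
      rw [zsmul_eq_mul]
      push_cast
      field_simp at hk
      linear_combination Complex.I * hk - z * Complex.I_sq] at this
  | elliptic r a hr ha =>
    obtain ⟨m, n, rfl⟩ := elliptic_exists_of_s_eq_zero r a hr ha z hz
    have h1 : (Real.pi / r : ℂ) ∈ (elliptic r a hr ha).periods :=
      (elliptic r a hr ha).omega_mem_periods (1 : Fin 4)
    have h2 : (Complex.I * a : ℂ) ∈ (elliptic r a hr ha).periods :=
      (elliptic r a hr ha).omega_mem_periods (2 : Fin 4)
    have := add_mem (zsmul_mem h1 m) (zsmul_mem h2 n)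
    rwa [zsmul_eq_mul, zsmul_eq_mul] at this

theorem s_half_ne_zero {ν μ : Fin (c.rho + 1)} (h : ν ≠ μ) :
    c.s ((c.omega ν - c.omega μ) / 2) ≠ 0 := by
  have hpi : (Real.pi : ℂ) ≠ 0 := by exact_mod_cast Real.pi_ne_zero
  cases c with
  | rational =>
    change Fin 1 at ν μ
    exact absurd (Subsingleton.elim ν μ) h
  | trigonometric r hr =>
    have hr' : (r : ℂ) ≠ 0 := by exact_mod_cast hr.ne'
    have e : (trigonometric r hr).s (Real.pi / r / 2) ≠ 0 := by
      simp only [s]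
      rw [show (r : ℂ) * (Real.pi / r / 2) = Real.pi / 2 by field_simp, Complex.sin_pi_div_two]
      simpa using hr.ne'
    change Fin 2 at ν μ
    fin_cases ν <;> fin_cases μ <;> simp only [omega] <;> first | exact absurd rfl h | skip
    · simpa [neg_div, s_neg] using e
    · simpa using e
  | hyperbolic a ha =>
    have ha' : (a : ℂ) ≠ 0 := by exact_mod_cast ha.ne'
    have e : (hyperbolic a ha).s (Complex.I * a / 2) ≠ 0 := by
      simp only [s]
      rw [show (Real.pi : ℂ) * (Complex.I * a / 2) / a = Real.pi / 2 * Complex.I by field_simp,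
        Complex.sinh_mul_I, Complex.sin_pi_div_two]
      simpa using ha.ne'
    change Fin 2 at ν μ
    fin_cases ν <;> fin_cases μ <;> simp only [omega] <;> first | exact absurd rfl h | skip
    · simpa [neg_div, s_neg] using e
    · simpa using e
  | elliptic r a hr ha =>
    intro h0
    obtain ⟨m, n, e⟩ := elliptic_exists_of_s_eq_zero r a hr ha _ h0
    change Fin 4 at ν μ
    -- In the basis `π/r, ia` the four periods have integer coordinates that are pairwise distinct
    -- modulo `2`, so half a difference is never in the lattice.
    have hω : ∀ ν : Fin 4, (elliptic r a hr ha).omega ν =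
        ((![0, 1, 0, -1] : Fin 4 → ℤ) ν : ℂ) * (Real.pi / r) +
        ((![0, 0, 1, -1] : Fin 4 → ℤ) ν : ℂ) * (Complex.I * a) := by
      intro ν
      fin_cases ν <;> simp [omega]
      ring
    have hind : ∀ k l : ℤ, (k : ℂ) * (Real.pi / r) + l * (Complex.I * a) = 0 → k = 0 ∧ l = 0 := by
      intro k l hkl
      have h1 := congrArg Complex.re hkl
      have h2 := congrArg Complex.im hkl
      rw [← Complex.ofReal_div] at h1 h2
      simp only [Complex.add_re, Complex.mul_re, Complex.add_im, Complex.mul_im, Complex.intCast_re,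
        Complex.intCast_im, Complex.ofReal_re, Complex.ofReal_im, Complex.I_re, Complex.I_im,
        Complex.zero_re, Complex.zero_im] at h1 h2
      have hp := (div_pos Real.pi_pos hr).ne'
      have ha' := ha.ne'
      constructor
      · have : (k : ℝ) * (Real.pi / r) = 0 := by linarith
        exact_mod_cast (mul_eq_zero.1 this).resolve_right hp
      · have : (l : ℝ) * a = 0 := by linarith
        exact_mod_cast (mul_eq_zero.1 this).resolve_right ha'
    obtain ⟨h1, h2⟩ := hind
      ((![0, 1, 0, -1] : Fin 4 → ℤ) ν - (![0, 1, 0, -1] : Fin 4 → ℤ) μ - 2 * m)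
      ((![0, 0, 1, -1] : Fin 4 → ℤ) ν - (![0, 0, 1, -1] : Fin 4 → ℤ) μ - 2 * n) (by
        have e1 := hω ν
        have e2 := hω μ
        push_cast
        linear_combination 2 * e - e1 + e2)
    fin_cases ν <;> fin_cases μ <;> first
      | exact h rfl
      | (simp at h1 h2; omega)

/-- The zeros of the entire function `s` are isolated, since `s` is not identically zero. This
drives every limiting argument that avoids exceptional points. -/
theorem s_eventually_ne (z : ℂ) : ∀ᶠ t in 𝓝[≠] (0 : ℂ), c.s (z + t) ≠ 0 := by
  have hd : Differentiable ℂ fun t => c.s (z + t) := by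
    have := c.differentiable_s
    fun_prop
  have han : AnalyticOnNhd ℂ (fun t => c.s (z + t)) Set.univ :=
    fun t _ => hd.analyticAt t
  rcases (han 0 trivial).eventually_eq_zero_or_eventually_ne_zero with h | h
  · exfalso
    have h2 := han.eqOn_zero_of_preconnected_of_eventuallyEq_zero isPreconnected_univ
      (Set.mem_univ _) h
    have hall : ∀ w, c.s w = 0 := fun w => by
      have := h2 (Set.mem_univ (w - z))
      simpa using this
    cases c with
    | rational => exact one_ne_zero (hall 1)
    | trigonometric r hr =>
      exact (trigonometric r hr).s_half_ne_zero (ν := (0 : Fin 2)) (μ := (1 : Fin 2))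
        (show (0 : Fin 2) ≠ 1 from Fin.zero_ne_one) (hall _)
    | hyperbolic a ha =>
      exact (hyperbolic a ha).s_half_ne_zero (ν := (0 : Fin 2)) (μ := (1 : Fin 2))
        (show (0 : Fin 2) ≠ 1 from Fin.zero_ne_one) (hall _)
    | elliptic r a hr ha =>
      exact (elliptic r a hr ha).s_half_ne_zero (ν := (0 : Fin 4)) (μ := (1 : Fin 4))
        (show (0 : Fin 4) ≠ 1 from Fin.zero_ne_one) (hall _)
  · exact h

/-- The duplication formula. -/
theorem s_two_mul (z : ℂ) :
    c.s (2 * z) * ∏ ν : Fin c.rho, c.s (-(c.omega ν.succ / 2)) =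
      2 * ∏ ν, c.s (z - c.omega ν / 2) := by
  cases c with
  | rational =>
    change rational.s (2 * z) * ∏ ν : Fin 0, rational.s (-(rational.omega ν.succ / 2)) =
      2 * ∏ ν : Fin 1, rational.s (z - rational.omega ν / 2)
    simp [s, omega]
  | trigonometric r hr =>
    have hr' : (r : ℂ) ≠ 0 := by exact_mod_cast hr.ne'
    change (trigonometric r hr).s (2 * z) *
      ∏ ν : Fin 1, (trigonometric r hr).s (-((trigonometric r hr).omega ν.succ / 2)) =
      2 * ∏ ν : Fin 2, (trigonometric r hr).s (z - (trigonometric r hr).omega ν / 2)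
    rw [Fin.prod_univ_one, Fin.prod_univ_two]
    simp only [s, omega]
    simp
    rw [show (r : ℂ) * (Real.pi / r / 2) = Real.pi / 2 by field_simp, Complex.sin_pi_div_two,
      show (r : ℂ) * (z - Real.pi / r / 2) = r * z - Real.pi / 2 by field_simp,
      Complex.sin_sub_pi_div_two, show (r : ℂ) * (2 * z) = 2 * (r * z) by ring,
      Complex.sin_two_mul]
    ring
  | hyperbolic a ha =>
    have ha' : (a : ℂ) ≠ 0 := by exact_mod_cast ha.ne'
    have hpi : (Real.pi : ℂ) ≠ 0 := by exact_mod_cast Real.pi_ne_zero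
    change (hyperbolic a ha).s (2 * z) *
      ∏ ν : Fin 1, (hyperbolic a ha).s (-((hyperbolic a ha).omega ν.succ / 2)) =
      2 * ∏ ν : Fin 2, (hyperbolic a ha).s (z - (hyperbolic a ha).omega ν / 2)
    rw [Fin.prod_univ_one, Fin.prod_univ_two, s_neg]
    simp only [s, omega]
    simp
    rw [show (Real.pi : ℂ) * (Complex.I * a / 2) / a = Real.pi / 2 * Complex.I by field_simp,
      Complex.sinh_mul_I, Complex.sin_pi_div_two,
      show (Real.pi : ℂ) * (z - Complex.I * a / 2) / a =
        Real.pi * z / a - Real.pi / 2 * Complex.I by field_simp,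
      Complex.sinh_sub, Complex.cosh_mul_I, Complex.sinh_mul_I, Complex.sin_pi_div_two,
      Complex.cos_pi_div_two, show (Real.pi : ℂ) * (2 * z) / a = 2 * (Real.pi * z / a) by ring,
      Complex.sinh_two_mul]
    ring
  | elliptic r a hr ha =>
    change (elliptic r a hr ha).s (2 * z) *
      ∏ ν : Fin 3, (elliptic r a hr ha).s (-((elliptic r a hr ha).omega ν.succ / 2)) =
      2 * ∏ ν : Fin 4, (elliptic r a hr ha).s (z - (elliptic r a hr ha).omega ν / 2)
    have := elliptic_duplication r a hr ha z
    rw [Fin.prod_univ_three, Fin.prod_univ_four]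
    change (elliptic r a hr ha).s (2 * z) * ((elliptic r a hr ha).s (-(Real.pi / r / 2)) *
      (elliptic r a hr ha).s (-(Complex.I * a / 2)) *
      (elliptic r a hr ha).s (-((-(Real.pi / r) - Complex.I * a) / 2))) =
      2 * ((elliptic r a hr ha).s (z - 0 / 2) * (elliptic r a hr ha).s (z - Real.pi / r / 2) *
      (elliptic r a hr ha).s (z - Complex.I * a / 2) *
      (elliptic r a hr ha).s (z - (-(Real.pi / r) - Complex.I * a) / 2))
    rw [zero_div, sub_zero,
      show -((-(Real.pi / r) - Complex.I * a) / 2 : ℂ) = (Real.pi / r + Complex.I * a) / 2 by ring,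
      show z - (-(Real.pi / r) - Complex.I * a) / 2 = z + (Real.pi / r + Complex.I * a) / 2 by ring]
    exact this

/-- Reflection at a half period. -/
theorem exists_s_reflect (ν : Fin (c.rho + 1)) : ∃ e : ℂ, e ^ 2 = 1 ∧ ∀ w,
    c.s (c.omega ν / 2 + w) = e * Complex.exp (2 * Complex.I * c.rxi ν * w) *
      c.s (c.omega ν / 2 - w) := by
  cases c with
  | rational =>
    change Fin 1 at ν
    refine ⟨-1, by norm_num, fun w => ?_⟩
    fin_cases ν
    simp [omega, rxi, s]
  | trigonometric r hr =>
    have hr' : (r : ℂ) ≠ 0 := by exact_mod_cast hr.ne'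
    change Fin 2 at ν
    fin_cases ν
    · refine ⟨-1, by norm_num, fun w => ?_⟩
      simp [omega, rxi, s]
    · refine ⟨1, by norm_num, fun w => ?_⟩
      simp [omega, rxi, s]
      rw [show (r : ℂ) * (Real.pi / r / 2 + w) = r * w + Real.pi / 2 by field_simp; ring,
        show (r : ℂ) * (Real.pi / r / 2 - w) = Real.pi / 2 - r * w by field_simp,
        Complex.sin_add_pi_div_two, Complex.sin_pi_div_two_sub]
      simp
  | hyperbolic a ha =>
    have ha' : (a : ℂ) ≠ 0 := by exact_mod_cast ha.ne'
    change Fin 2 at ν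
    fin_cases ν
    · refine ⟨-1, by norm_num, fun w => ?_⟩
      simp [omega, rxi, s, neg_div]
    · refine ⟨1, by norm_num, fun w => ?_⟩
      simp [omega, rxi, s]
      rw [show (Real.pi : ℂ) * (Complex.I * a / 2 + w) / a =
          Real.pi / 2 * Complex.I + Real.pi * w / a by field_simp,
        show (Real.pi : ℂ) * (Complex.I * a / 2 - w) / a =
          Real.pi / 2 * Complex.I - Real.pi * w / a by field_simp,
        Complex.sinh_sub, Complex.sinh_add, Complex.cosh_mul_I, Complex.cos_pi_div_two]
      simp
  | elliptic r a hr ha =>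
    have hr' : (r : ℂ) ≠ 0 := by exact_mod_cast hr.ne'
    have odd := (elliptic r a hr ha).s_neg
    have o0 : (elliptic r a hr ha).omega (0 : Fin 4) = 0 := rfl
    have o1 : (elliptic r a hr ha).omega (1 : Fin 4) = Real.pi / r := rfl
    have o2 : (elliptic r a hr ha).omega (2 : Fin 4) = Complex.I * a := rfl
    have o3 : (elliptic r a hr ha).omega (3 : Fin 4) = -(Real.pi / r) - Complex.I * a := rfl
    have x0 : (elliptic r a hr ha).rxi (0 : Fin 4) = 0 := rfl
    have x1 : (elliptic r a hr ha).rxi (1 : Fin 4) = 0 := rfl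
    have x2 : (elliptic r a hr ha).rxi (2 : Fin 4) = -r := rfl
    have x3 : (elliptic r a hr ha).rxi (3 : Fin 4) = r := rfl
    change Fin 4 at ν
    fin_cases ν
    · refine ⟨-1, by norm_num, fun w => ?_⟩
      change (elliptic r a hr ha).s ((elliptic r a hr ha).omega (0 : Fin 4) / 2 + w) =
        -1 * Complex.exp (2 * Complex.I * (elliptic r a hr ha).rxi (0 : Fin 4) * w) *
        (elliptic r a hr ha).s ((elliptic r a hr ha).omega (0 : Fin 4) / 2 - w)
      rw [o0, x0]
      simp [odd]
    · refine ⟨1, by norm_num, fun w => ?_⟩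
      change (elliptic r a hr ha).s ((elliptic r a hr ha).omega (1 : Fin 4) / 2 + w) =
        1 * Complex.exp (2 * Complex.I * (elliptic r a hr ha).rxi (1 : Fin 4) * w) *
        (elliptic r a hr ha).s ((elliptic r a hr ha).omega (1 : Fin 4) / 2 - w)
      have := elliptic_s_add_first r a hr ha (w - Real.pi / r / 2)
      rw [o1, x1, show Real.pi / r / 2 + w = w - Real.pi / r / 2 + Real.pi / r by ring, this,
        ← odd]
      simp
    · refine ⟨1, by norm_num, fun w => ?_⟩
      change (elliptic r a hr ha).s ((elliptic r a hr ha).omega (2 : Fin 4) / 2 + w) =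
        1 * Complex.exp (2 * Complex.I * (elliptic r a hr ha).rxi (2 : Fin 4) * w) *
        (elliptic r a hr ha).s ((elliptic r a hr ha).omega (2 : Fin 4) / 2 - w)
      have := elliptic_s_add_second r a hr ha (w - Complex.I * a / 2)
      rw [o2, x2, show Complex.I * a / 2 + w = w - Complex.I * a / 2 + Complex.I * a by ring, this,
        show Complex.I * a / 2 - w = -(w - Complex.I * a / 2) by ring, odd,
        show w - Complex.I * a / 2 + Complex.I * a / 2 = w by ring,
        show -2 * Complex.I * r * w = 2 * Complex.I * (-r) * w by ring]
      ring
    · refine ⟨1, by norm_num, fun w => ?_⟩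
      change (elliptic r a hr ha).s ((elliptic r a hr ha).omega (3 : Fin 4) / 2 + w) =
        1 * Complex.exp (2 * Complex.I * (elliptic r a hr ha).rxi (3 : Fin 4) * w) *
        (elliptic r a hr ha).s ((elliptic r a hr ha).omega (3 : Fin 4) / 2 - w)
      have e1 := elliptic_s_add_first r a hr ha (w - (Real.pi / r + Complex.I * a) / 2)
      have e2 := elliptic_s_add_second r a hr ha
        (w - (Real.pi / r + Complex.I * a) / 2 + Real.pi / r)
      have e5 : Complex.exp (-2 * Complex.I * r * (w - (Real.pi / r + Complex.I * a) / 2 +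
          Real.pi / r + Complex.I * a / 2)) = -Complex.exp (-(2 * Complex.I * r * w)) := by
        rw [show -2 * Complex.I * r * (w - (Real.pi / r + Complex.I * a) / 2 + Real.pi / r +
          Complex.I * a / 2) = -(2 * Complex.I * r * w) - Real.pi * Complex.I by field_simp; ring,
          Complex.exp_sub, Complex.exp_pi_mul_I]
        ring
      rw [e1, e5] at e2
      rw [o3, x3, show (-(Real.pi / r) - Complex.I * a) / 2 + w =
        w - (Real.pi / r + Complex.I * a) / 2 by ring,
        show (-(Real.pi / r) - Complex.I * a) / 2 - w =
        -(w - (Real.pi / r + Complex.I * a) / 2 + Real.pi / r + Complex.I * a) by ring, odd, e2]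
      have e6 : Complex.exp (2 * Complex.I * r * w) * Complex.exp (-(2 * Complex.I * r * w)) = 1 := by
        rw [← Complex.exp_add]
        simp
      linear_combination (-(elliptic r a hr ha).s (w - (Real.pi / r + Complex.I * a) / 2)) * e6

theorem rxi_eq_zero (h : ¬ c.IsElliptic) (ν : Fin (c.rho + 1)) : c.rxi ν = 0 := by
  cases c with
  | rational => change Fin 1 at ν; fin_cases ν; rfl
  | trigonometric r hr => change Fin 2 at ν; fin_cases ν <;> rfl
  | hyperbolic a ha => change Fin 2 at ν; fin_cases ν <;> rfl
  | elliptic r a hr ha => exact absurd trivial h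

theorem s_add_sum_omega (h : ¬ c.IsElliptic) (z : ℂ) :
    c.s (z + ∑ ν, c.omega ν) = (-1) ^ c.rho * c.s z := by
  cases c with
  | rational =>
    change z + ∑ ν : Fin 1, (![0] : Fin 1 → ℂ) ν = (-1) ^ 0 * z
    simp
  | trigonometric r hr =>
    have hr' : (r : ℂ) ≠ 0 := by exact_mod_cast hr.ne'
    change 1 / (r : ℂ) * Complex.sin (r * (z + ∑ ν : Fin 2, (![0, Real.pi / r] : Fin 2 → ℂ) ν)) =
      (-1) ^ 1 * (1 / (r : ℂ) * Complex.sin (r * z))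
    rw [Fin.sum_univ_two]
    simp only [Matrix.cons_val_zero, Matrix.cons_val_one, zero_add]
    rw [show (r : ℂ) * (z + Real.pi / r) = r * z + Real.pi by field_simp, Complex.sin_add_pi]
    ring
  | hyperbolic a ha =>
    have ha' : (a : ℂ) ≠ 0 := by exact_mod_cast ha.ne'
    change (a : ℂ) / Real.pi * Complex.sinh
        (Real.pi * (z + ∑ ν : Fin 2, (![0, Complex.I * a] : Fin 2 → ℂ) ν) / a) =
      (-1) ^ 1 * ((a : ℂ) / Real.pi * Complex.sinh (Real.pi * z / a))
    rw [Fin.sum_univ_two]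
    simp only [Matrix.cons_val_zero, Matrix.cons_val_one, zero_add]
    rw [show (Real.pi : ℂ) * (z + Complex.I * a) / a = Real.pi * z / a + Real.pi * Complex.I by
      field_simp, Complex.sinh_add, Complex.sinh_mul_I, Complex.cosh_mul_I, Complex.sin_pi,
      Complex.cos_pi]
    ring
  | elliptic r a hr ha => exact absurd trivial h

theorem rho_eq_three (h : c.IsElliptic) : c.rho = 3 := by
  cases c with
  | elliptic r a hr ha => rfl
  | _ => exact h.elim

theorem sum_omega_eq_zero (h : c.IsElliptic) : ∑ ν, c.omega ν = 0 := by
  cases c with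
  | elliptic r a hr ha =>
    change ∑ ν : Fin 4, (![0, Real.pi / r, Complex.I * a, -(Real.pi / r) - Complex.I * a] :
      Fin 4 → ℂ) ν = 0
    rw [Fin.sum_univ_four]
    simp
  | _ => exact h.elim

end Case

/-! ### The residues of the kernel function identity -/

theorem sgn_mul_self (ε : ℤˣ) : sgn ε * sgn ε = 1 := by
  rcases Int.units_eq_one_or ε with rfl | rfl <;> simp [sgn]

theorem sgn_ne_zero (ε : ℤˣ) : sgn ε ≠ 0 := fun h => by
  have := sgn_mul_self ε
  rw [h, zero_mul] at this
  exact zero_ne_one this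

theorem sgn_neg (ε : ℤˣ) : sgn (-ε) = -sgn ε := by
  simp [sgn]

/-! ### Products over signed indices and over half periods. -/

theorem univ_erase_inl {ι κ : Type*} [Fintype ι] [Fintype κ] [DecidableEq ι] [DecidableEq κ]
    (i : ι) : (Finset.univ : Finset (ι ⊕ κ)).erase (Sum.inl i) =
      (Finset.univ.erase i).disjSum Finset.univ := by
  ext (j | j) <;> simp

theorem univ_erase_inr {ι κ : Type*} [Fintype ι] [Fintype κ] [DecidableEq ι] [DecidableEq κ]
    (i : κ) : (Finset.univ : Finset (ι ⊕ κ)).erase (Sum.inr i) =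
      Finset.univ.disjSum (Finset.univ.erase i) := by
  ext (j | j) <;> simp

/-- Deleting `(j, ε)` leaves its partner `(j, -ε)` and all complete pairs. The partner yields the
factor in `2 x_j`, which has no counterpart in the products over `k ≠ j`. -/
theorem prod_erase_signed {ι M : Type*} [Fintype ι] [DecidableEq ι] [CommMonoid M]
    (f : ι × ℤˣ → M) (j : ι) (ε : ℤˣ) :
    ∏ p ∈ Finset.univ.erase (j, ε), f p =
      f (j, -ε) * ∏ k ∈ Finset.univ.erase j, ∏ δ : ℤˣ, f (k, δ) := by
  have hne : -ε ≠ ε := by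
    rcases Int.units_eq_one_or ε with rfl | rfl <;> decide
  have h : (Finset.univ.erase (j, ε) : Finset (ι × ℤˣ)) =
      insert (j, -ε) ((Finset.univ.erase j) ×ˢ Finset.univ) := by
    ext ⟨k, δ⟩
    simp only [Finset.mem_erase, Finset.mem_univ, and_true, Finset.mem_insert, Finset.mem_product,
      Prod.mk.injEq, ne_eq]
    by_cases hk : k = j
    · subst hk
      simp only [true_and, not_true_eq_false, or_false]
      constructor
      · exact fun h => Int.units_ne_iff_eq_neg.1 h
      · rintro rfl
        exact hne
    · simp [hk]
  rw [h, Finset.prod_insert (by simp), Finset.prod_product]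

theorem prod_signed {ι M : Type*} [Fintype ι] [DecidableEq ι] [CommMonoid M]
    (f : ι × ℤˣ → M) (j : ι) (ε : ℤˣ) :
    ∏ p, f p = f (j, ε) * (f (j, -ε) * ∏ k ∈ Finset.univ.erase j, ∏ δ : ℤˣ, f (k, δ)) := by
  rw [← prod_erase_signed, Finset.mul_prod_erase _ _ (Finset.mem_univ _)]

namespace Case

variable (c : Case)

/-- The product of the values of `s` at the negated half periods. -/
def halfProd : ℂ := ∏ ν : Fin c.rho, c.s (-(c.omega ν.succ / 2))

theorem halfProd_ne_zero : c.halfProd ≠ 0 := by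
  refine Finset.prod_ne_zero_iff.2 fun ν _ => ?_
  have h := c.s_half_ne_zero (ν := 0) (μ := ν.succ) (Fin.succ_ne_zero ν).symm
  have h0 : c.omega 0 = 0 := by cases c <;> rfl
  rwa [h0, zero_sub, neg_div] at h

theorem halfProd_sq : (∏ ν : Fin c.rho, c.s (c.omega ν.succ / 2)) ^ 2 = c.halfProd ^ 2 := by
  unfold halfProd
  rw [← Finset.prod_pow, ← Finset.prod_pow]
  exact Finset.prod_congr rfl fun ν _ => by rw [s_neg]; ring

theorem prod_s_sub_half (w : ℂ) :
    ∏ ν, c.s (w - c.omega ν / 2) = c.s (2 * w) * c.halfProd / 2 := by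
  have := c.s_two_mul w
  rw [halfProd, this]
  ring

/-- Replacing `w` by `-w` flips `ρ + 1` factors and also `s (2 w)`; this is the source of every sign
`(-1) ^ ρ` below. -/
theorem prod_s_add_half (w : ℂ) :
    ∏ ν, c.s (w + c.omega ν / 2) = (-1) ^ c.rho * (c.s (2 * w) * c.halfProd / 2) := by
  have h : ∀ ν, c.s (w + c.omega ν / 2) = -1 * c.s (-w - c.omega ν / 2) := fun ν => by
    rw [← neg_neg (w + c.omega ν / 2), s_neg, neg_add, ← sub_eq_add_neg]
    ring
  simp only [h]
  rw [Finset.prod_mul_distrib, prod_s_sub_half, Finset.prod_const, Finset.card_univ,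
    Fintype.card_fin, mul_neg, s_neg, pow_succ]
  ring

theorem s_sub_half_ne_zero {w : ℂ} (h : c.s (2 * w) ≠ 0) (ν : Fin (c.rho + 1)) :
    c.s (w - c.omega ν / 2) ≠ 0 := by
  have h1 := c.prod_s_sub_half w
  have h2 : ∏ ν, c.s (w - c.omega ν / 2) ≠ 0 := by
    rw [h1]
    exact div_ne_zero (mul_ne_zero h c.halfProd_ne_zero) two_ne_zero
  exact Finset.prod_ne_zero_iff.1 h2 ν (Finset.mem_univ _)

theorem s_add_half_ne_zero {w : ℂ} (h : c.s (2 * w) ≠ 0) (ν : Fin (c.rho + 1)) :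
    c.s (w + c.omega ν / 2) ≠ 0 := by
  have := c.s_sub_half_ne_zero (w := -w) (by rwa [mul_neg, s_neg, neg_ne_zero]) ν
  rwa [show -w - c.omega ν / 2 = -(w + c.omega ν / 2) by ring, s_neg, neg_ne_zero] at this

end Case

/-! ### The partial fraction problem and its reflection symmetry. -/

variable (c : Case) (β lam : ℝ)

/-- The poles attached to the variables `x`. -/
def pole {N : ℕ} (x : Fin N → ℂ) : (Fin N × ℤˣ) ⊕ Fin (c.rho + 1) → ℂ :=
  Sum.elim (fun p => sgn p.2 * x p.1) (fun ν => c.omega ν / 2 + Complex.I * β / 2)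

/-- The center of the reflection that exchanges `x` and `y`. -/
def center : ℂ := (Complex.I * β + Complex.I * lam * β) / 2

/-- The numerator of the function whose residues are summed. -/
def numer {N M : ℕ} (g : Fin (2 * c.rho + 2) → ℝ) (x : Fin N → ℂ) (y : Fin M → ℂ) (z : ℂ) : ℂ :=
  (∏ μ, c.s (z - Complex.I * g μ * β)) *
    ((∏ p : Fin N × ℤˣ, c.s (z - (sgn p.2 * x p.1 + Complex.I * lam * β))) *
      ∏ p : Fin M × ℤˣ, c.s (z - (center β lam - (sgn p.2 * y p.1 + Complex.I * lam * β))))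

/-- The residues at the poles attached to `x`. -/
def residue {N M : ℕ} (g : Fin (2 * c.rho + 2) → ℝ) (x : Fin N → ℂ) (y : Fin M → ℂ)
    (i : (Fin N × ℤˣ) ⊕ Fin (c.rho + 1)) : ℂ :=
  numer c β lam g x y (pole c β x i) /
    ((∏ i' ∈ Finset.univ.erase i, c.s (pole c β x i - pole c β x i')) *
      ∏ i', c.s (pole c β x i - (center β lam - pole c β y i')))

theorem dual_dual (g : Fin (2 * c.rho + 2) → ℝ) : dual c lam (dual c lam g) = g := by
  funext ν
  simp [dual]

theorem numer_reflect {N M : ℕ} (g : Fin (2 * c.rho + 2) → ℝ) (x : Fin N → ℂ) (y : Fin M → ℂ)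
    (z : ℂ) :
    numer c β lam g x y (center β lam - z) = numer c β lam (dual c lam g) y x z := by
  have h1 : ∀ μ, c.s (center β lam - z - Complex.I * g μ * β) =
      -- The reflection acts on the couplings by `g ↦ (λ + 1)/2 - g`, because `center` is `iβ(λ +
      -- 1)/2`.
      -1 * c.s (z - Complex.I * dual c lam g μ * β) := fun μ => by
    rw [show center β lam - z - Complex.I * g μ * β = -(z - Complex.I * dual c lam g μ * β) by
      simp only [center, dual]; push_cast; ring, c.s_neg]
    ring
  have h2 : ∀ p : Fin N × ℤˣ, c.s (center β lam - z - (sgn p.2 * x p.1 + Complex.I * lam * β)) =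
      -1 * c.s (z - (center β lam - (sgn p.2 * x p.1 + Complex.I * lam * β))) := fun p => by
    rw [← neg_sub, c.s_neg]
    ring_nf
  have h3 : ∀ p : Fin M × ℤˣ,
      c.s (center β lam - z - (center β lam - (sgn p.2 * y p.1 + Complex.I * lam * β))) =
      -1 * c.s (z - (sgn p.2 * y p.1 + Complex.I * lam * β)) := fun p => by
    rw [← neg_sub, c.s_neg]
    ring_nf
  unfold numer
  simp only [h1, h2, h3]
  simp only [Finset.prod_mul_distrib, Finset.prod_const, Finset.card_univ, Fintype.card_fin,
    Fintype.card_prod, Fintype.card_units_int]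
  have e1 : (-1 : ℂ) ^ (2 * c.rho + 2) = 1 := Even.neg_one_pow ⟨c.rho + 1, by ring⟩
  have e2 : ∀ n : ℕ, (-1 : ℂ) ^ (n * 2) = 1 := fun n => Even.neg_one_pow ⟨n, by ring⟩
  simp only [e1, e2]
  ring

theorem residue_reflect {N M : ℕ} (g : Fin (2 * c.rho + 2) → ℝ) (x : Fin N → ℂ) (y : Fin M → ℂ)
    (i : (Fin M × ℤˣ) ⊕ Fin (c.rho + 1)) :
    numer c β lam g x y (center β lam - pole c β y i) /
      ((∏ i', c.s (center β lam - pole c β y i - pole c β x i')) *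
        ∏ i' ∈ Finset.univ.erase i, c.s (center β lam - pole c β y i -
          (center β lam - pole c β y i'))) = -residue c β lam (dual c lam g) y x i := by
  have h1 : ∀ i', c.s (center β lam - pole c β y i - pole c β x i') =
      -1 * c.s (pole c β y i - (center β lam - pole c β x i')) := fun i' => by
    rw [← neg_sub, c.s_neg]
    ring_nf
  have h2 : ∀ i', c.s (center β lam - pole c β y i - (center β lam - pole c β y i')) =
      -1 * c.s (pole c β y i - pole c β y i') := fun i' => by
    rw [← neg_sub, c.s_neg]
    ring_nf
  rw [numer_reflect, residue]
  simp only [h1, h2]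
  simp only [Finset.prod_mul_distrib, Finset.prod_const, Finset.card_univ, Fintype.card_fin,
    Fintype.card_prod, Fintype.card_units_int, Fintype.card_sum,
    Finset.card_erase_of_mem (Finset.mem_univ _)]
  -- The numerator has an even number of factors, but one denominator factor is omitted, so an odd
  -- number of signs remains.
  have h3 : (-1 : ℂ) ^ (N * 2 + (c.rho + 1)) * (-1) ^ (M * 2 + (c.rho + 1) - 1) = -1 := by
    rw [← pow_add]
    exact Odd.neg_one_pow ⟨N + M + c.rho, by omega⟩
  generalize (∏ i' ∈ Finset.univ.erase i, c.s (pole c β y i - pole c β y i')) = P1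
  generalize (∏ i', c.s (pole c β y i - (center β lam - pole c β x i'))) = P2
  rw [show ∀ u v : ℂ, u * P2 * (v * P1) = (u * v) * (P1 * P2) by intros; ring, h3]
  ring

/-- The arguments of `s` in the denominators of `V_j^±` are not zeros. -/
structure NonSingular {N : ℕ} (x : Fin N → ℂ) : Prop where
  pair : ∀ j k, j ≠ k → ∀ ε ε' : ℤˣ, c.s (sgn ε * x j + sgn ε' * x k) ≠ 0
  double : ∀ j, ∀ ε : ℤˣ, c.s (sgn ε * (2 * x j)) ≠ 0
  double_sub : ∀ j, ∀ ε : ℤˣ, c.s (sgn ε * (2 * x j) - Complex.I * β) ≠ 0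

/-- The arguments of `s` in the denominators of the shifted kernel are not zeros. -/
def CrossNonSingular {N M : ℕ} (x : Fin N → ℂ) (y : Fin M → ℂ) : Prop :=
  ∀ j k, ∀ ε ε' : ℤˣ, c.s (sgn ε * x j + sgn ε' * y k - center β lam) ≠ 0

theorem CrossNonSingular.symm {N M : ℕ} {x : Fin N → ℂ} {y : Fin M → ℂ}
    (h : CrossNonSingular c β lam x y) : CrossNonSingular c β lam y x := fun j k ε ε' => by
  rw [add_comm]
  exact h k j ε' ε

/-- The poles at `± x_j` are distinct from the poles at `iλβ/2 - ω_ν/2`. -/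
def GenericPoles {N : ℕ} (x : Fin N → ℂ) : Prop :=
  ∀ j, ∀ ε : ℤˣ, c.s (sgn ε * (2 * x j) - Complex.I * lam * β) ≠ 0

theorem pole_sub_ne_zero {N : ℕ} {x : Fin N → ℂ} (hx : NonSingular c β x)
    {i i' : (Fin N × ℤˣ) ⊕ Fin (c.rho + 1)} (h : i ≠ i') :
    c.s (pole c β x i - pole c β x i') ≠ 0 := by
  have aux : ∀ (p : Fin N × ℤˣ) (ν : Fin (c.rho + 1)),
      c.s (sgn p.2 * x p.1 - (c.omega ν / 2 + Complex.I * β / 2)) ≠ 0 := fun p ν => by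
    have := c.s_sub_half_ne_zero (w := sgn p.2 * x p.1 - Complex.I * β / 2) (by
      rw [show 2 * (sgn p.2 * x p.1 - Complex.I * β / 2) =
        sgn p.2 * (2 * x p.1) - Complex.I * β by ring]
      exact hx.double_sub _ _) ν
    rwa [show sgn p.2 * x p.1 - (c.omega ν / 2 + Complex.I * β / 2) =
      sgn p.2 * x p.1 - Complex.I * β / 2 - c.omega ν / 2 by ring]
  rcases i with ⟨j, ε⟩ | ν <;> rcases i' with ⟨k, ε'⟩ | μ <;> simp only [pole, Sum.elim_inl,
    Sum.elim_inr]
  · by_cases hjk : j = k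
    · subst hjk
      have hε : ε' = -ε := by
        refine Int.units_ne_iff_eq_neg.1 fun e => h ?_
        rw [e]
      rw [hε, sgn_neg, show sgn ε * x j - -sgn ε * x j = sgn ε * (2 * x j) by ring]
      exact hx.double _ _
    · have := hx.pair j k hjk ε (-ε')
      rwa [sgn_neg, neg_mul, ← sub_eq_add_neg] at this
  · exact aux (j, ε) μ
  · rw [← neg_sub, c.s_neg, neg_ne_zero]
    exact aux (k, ε') ν
  · rw [show c.omega ν / 2 + Complex.I * β / 2 - (c.omega μ / 2 + Complex.I * β / 2) =
      (c.omega ν - c.omega μ) / 2 by ring]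
    exact c.s_half_ne_zero fun e => h (by rw [e])

/-- Doubling such a zero and subtracting periods would put `i(1 - λ)β` into the period group. This
keeps the poles at half periods apart from their reflections. -/
theorem s_half_add_half_ne_zero (hlam : Complex.I * (1 - lam) * β ∉ c.periods)
    (ν μ : Fin (c.rho + 1)) (ε : ℤˣ) :
    c.s (c.omega ν / 2 + sgn ε * (c.omega μ / 2) +
      (Complex.I * β - Complex.I * lam * β) / 2) ≠ 0 := by
  intro h
  have h1 := c.mem_periods_of_s_eq_zero h
  have h2 := add_mem h1 h1
  have h3 : sgn ε * c.omega μ ∈ c.periods := by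
    rcases Int.units_eq_one_or ε with rfl | rfl
    · simpa [sgn] using c.omega_mem_periods μ
    · simpa [sgn] using c.omega_mem_periods μ
  have h4 := sub_mem (sub_mem h2 (c.omega_mem_periods ν)) h3
  refine hlam ?_
  convert h4 using 1
  ring

theorem pole_sub_center_ne_zero (hlam : Complex.I * (1 - lam) * β ∉ c.periods) {N M : ℕ}
    {x : Fin N → ℂ} {y : Fin M → ℂ} (hx : GenericPoles c β lam x) (hy : GenericPoles c β lam y)
    (hxy : CrossNonSingular c β lam x y) (i : (Fin N × ℤˣ) ⊕ Fin (c.rho + 1))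
    (i' : (Fin M × ℤˣ) ⊕ Fin (c.rho + 1)) :
    c.s (pole c β x i - (center β lam - pole c β y i')) ≠ 0 := by
  have aux : ∀ (z : ℂ) (ν : Fin (c.rho + 1)), c.s (2 * z - Complex.I * lam * β) ≠ 0 →
      c.s (z + (c.omega ν / 2 + Complex.I * β / 2) - center β lam) ≠ 0 := fun z ν hz => by
    have := c.s_add_half_ne_zero (w := z - Complex.I * lam * β / 2) (by
      rwa [show 2 * (z - Complex.I * lam * β / 2) = 2 * z - Complex.I * lam * β by ring]) ν
    rwa [center, show z + (c.omega ν / 2 + Complex.I * β / 2) -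
      (Complex.I * β + Complex.I * lam * β) / 2 = z - Complex.I * lam * β / 2 + c.omega ν / 2 by
        ring]
  rw [show pole c β x i - (center β lam - pole c β y i') =
    pole c β x i + pole c β y i' - center β lam by ring]
  rcases i with ⟨j, ε⟩ | ν <;> rcases i' with ⟨k, ε'⟩ | μ <;> simp only [pole, Sum.elim_inl,
    Sum.elim_inr]
  · exact hxy j k ε ε'
  · refine aux _ _ ?_
    rw [mul_left_comm]
    exact hx j ε
  · rw [add_comm (c.omega ν / 2 + _)]
    refine aux _ _ ?_
    rw [mul_left_comm]
    exact hy k ε'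
  · have := s_half_add_half_ne_zero c β lam hlam ν μ 1
    convert this using 2
    simp only [center, sgn]
    push_cast
    ring

/-- The sum of all residues. -/
theorem sum_residue_sub {N M : ℕ} (g : Fin (2 * c.rho + 2) → ℝ) {x : Fin N → ℂ} {y : Fin M → ℂ}
    (hbalance : c.IsElliptic → 2 * lam * ((N : ℝ) - M - 1) + ∑ ν, g ν - 2 = 0)
    (hlam : Complex.I * (1 - lam) * β ∉ c.periods)
    (hx : NonSingular c β x) (hy : NonSingular c β y) (hxy : CrossNonSingular c β lam x y)
    (gx : GenericPoles c β lam x) (gy : GenericPoles c β lam y) :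
    ∑ i, residue c β lam g x y i - ∑ i, residue c β lam (dual c lam g) y x i =
      c.s (-(Complex.I * β * (2 * lam * ((N : ℂ) - M) + ∑ ν, (g ν : ℂ) -
        (c.rho + 1) * (lam + 1) / 2))) := by
  classical
  set D : ℂ := -(Complex.I * β * (2 * lam * ((N : ℂ) - M) + ∑ ν, (g ν : ℂ) -
        (c.rho + 1) * (lam + 1) / 2)) with hDdef
  have hD : D = 0 ∨ TwoTerm c.s := by
    by_cases h : c.IsElliptic
    · left
      have h1 : 2 * (lam : ℂ) * ((N : ℂ) - M - 1) + ∑ ν, (g ν : ℂ) - 2 = 0 := by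
        exact_mod_cast hbalance h
      have h3 : (c.rho : ℂ) = 3 := by exact_mod_cast c.rho_eq_three h
      rw [hDdef]
      linear_combination (-(Complex.I * β)) * h1 + Complex.I * β * (lam + 1) / 2 * h3
    · exact Or.inr (c.s_twoTerm h)
  -- Here `a` lists the poles and `b` the zeros; each list has `2N + 2M + 2ρ + 2` entries. The
  -- signed variables and the half periods cancel from the difference of the sums, which is `D`.
  let a : ((Fin N × ℤˣ) ⊕ Fin (c.rho + 1)) ⊕ ((Fin M × ℤˣ) ⊕ Fin (c.rho + 1)) → ℂ :=
    Sum.elim (pole c β x) fun i => center β lam - pole c β y i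
  let b : Fin (2 * c.rho + 2) ⊕ (Fin N × ℤˣ) ⊕ (Fin M × ℤˣ) → ℂ :=
    Sum.elim (fun μ => Complex.I * g μ * β) (Sum.elim
      (fun p => sgn p.2 * x p.1 + Complex.I * lam * β)
      fun p => center β lam - (sgn p.2 * y p.1 + Complex.I * lam * β))
  have sum_signed : ∀ {n : ℕ} (z : Fin n → ℂ), ∑ p : Fin n × ℤˣ, sgn p.2 * z p.1 = 0 := by
    intro n z
    rw [Fintype.sum_prod_type]
    refine Finset.sum_eq_zero fun j _ => ?_
    rw [show (Finset.univ : Finset ℤˣ) = {1, -1} from rfl, Finset.sum_pair (by decide)]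
    simp [sgn]
  have main := sum_residueTerm (a := a) c.s_threeTerm c.s_neg c.continuous_s c.s_eventually_ne hD
    (2 * N + 2 * M + 2 * c.rho) Finset.univ (Finset.univ.val.map b)
    (by simp; ring) (by simp; ring)
    (by
      have h1 : (Finset.univ.val.map b).sum = ∑ z, b z := rfl
      rw [h1]
      simp only [a, b, Fintype.sum_sum_type, Sum.elim_inl, Sum.elim_inr, pole,
        Finset.sum_add_distrib, Finset.sum_sub_distrib, sum_signed, Finset.sum_const,
        Finset.card_univ, Fintype.card_prod, Fintype.card_fin, Fintype.card_units_int,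
        Fintype.card_sum, nsmul_eq_mul, ← Finset.mul_sum, ← Finset.sum_mul]
      rw [hDdef, center]
      push_cast
      ring)
    (by
      rintro (i | i) - (i' | i') - hne
      · exact pole_sub_ne_zero c β hx fun e => hne (by rw [e])
      · exact pole_sub_center_ne_zero c β lam hlam gx gy hxy i i'
      · simp only [a, Sum.elim_inl, Sum.elim_inr]
        have := pole_sub_center_ne_zero c β lam hlam gy gx hxy.symm i i'
        rwa [show center β lam - pole c β y i - pole c β x i' =
          -(pole c β y i - (center β lam - pole c β x i')) by ring, c.s_neg, neg_ne_zero]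
      · simp only [a, Sum.elim_inr]
        rw [sub_sub_sub_cancel_left]
        exact pole_sub_ne_zero c β hy fun e => hne (by rw [e]))
  rw [← main, Fintype.sum_sum_type (residueTerm c.s a Finset.univ (Finset.univ.val.map b)),
    sub_eq_add_neg, ← Finset.sum_neg_distrib]
  have hnum : ∀ z, ((Finset.univ.val.map b).map fun w => c.s (z - w)).prod =
      numer c β lam g x y z := by
    intro z
    rw [Multiset.map_map]
    have : (Multiset.map ((fun w => c.s (z - w)) ∘ b) Finset.univ.val).prod =
      ∏ w, c.s (z - b w) := rfl
    rw [this]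
    simp only [Fintype.prod_sum_type, b, Sum.elim_inl, Sum.elim_inr, numer]
  congr 1
  · refine Finset.sum_congr rfl fun i _ => ?_
    rw [residueTerm, hnum, univ_erase_inl, Finset.prod_disjSum]
    rfl
  · refine Finset.sum_congr rfl fun i _ => ?_
    rw [residueTerm, hnum, univ_erase_inr, Finset.prod_disjSum, ← residue_reflect]
    rfl

/-! ### Identification of the residues with the coefficients of the operators. -/

/-- The quotient by which the double product in the kernel function changes under a shift. -/
def kernelRatio {N M : ℕ} (x : Fin N → ℂ) (y : Fin M → ℂ) (ε : ℤˣ) (j : Fin N) : ℂ :=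
  ∏ k, ∏ ε' : ℤˣ, c.s (sgn ε * x j + sgn ε' * y k -
    (Complex.I * β - Complex.I * lam * β) / 2) / c.s (sgn ε * x j + sgn ε' * y k - center β lam)

theorem coeffV_eq {N : ℕ} (g : Fin (2 * c.rho + 2) → ℝ) (ε : ℤˣ) (j : Fin N) (x : Fin N → ℂ) :
    coeffV c β lam g ε j x = (∏ ν, c.s (sgn ε * x j - Complex.I * g ν * β)) /
      (c.s (sgn ε * (2 * x j)) * c.s (sgn ε * (2 * x j) - Complex.I * β)) *
      ((∏ k ∈ Finset.univ.erase j, ∏ δ : ℤˣ,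
        c.s (sgn ε * x j - (sgn δ * x k + Complex.I * lam * β))) /
      ∏ k ∈ Finset.univ.erase j, ∏ δ : ℤˣ, c.s (sgn ε * x j - sgn δ * x k)) := by
  unfold coeffV
  congr 1
  rw [Finset.prod_comm, ← Finset.prod_div_distrib]
  refine Finset.prod_congr rfl fun k _ => ?_
  simp only [prod_signs]
  rcases Int.units_eq_one_or ε with rfl | rfl
  · simp only [sgn]
    push_cast
    rw [div_mul_div_comm]
    congr 1 <;> rw [mul_comm] <;> congr 2 <;> ring
  · rw [div_mul_div_comm]
    have h1 : c.s (x j + sgn 1 * x k - sgn (-1) * (Complex.I * lam * β)) =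
        -c.s (sgn (-1) * x j - (sgn 1 * x k + Complex.I * lam * β)) := by
      rw [← c.s_neg]
      congr 1
      simp [sgn]
      ring
    have h2 : c.s (x j + sgn (-1) * x k - sgn (-1) * (Complex.I * lam * β)) =
        -c.s (sgn (-1) * x j - (sgn (-1) * x k + Complex.I * lam * β)) := by
      rw [← c.s_neg]
      congr 1
      simp [sgn]
      ring
    have h3 : c.s (x j + sgn 1 * x k) = -c.s (sgn (-1) * x j - sgn 1 * x k) := by
      rw [← c.s_neg]
      congr 1
      simp [sgn]
      ring
    have h4 : c.s (x j + sgn (-1) * x k) = -c.s (sgn (-1) * x j - sgn (-1) * x k) := by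
      rw [← c.s_neg]
      congr 1
      simp [sgn]
      ring
    rw [h1, h2, h3, h4]
    ring

/-- Duplication turns the two products over half periods into `s(2εx_j - iβ)`, which belongs to
`V_j^ε`, and `s(2εx_j - iλβ)`. The latter cancels against the numerator factor of the opposite
variable `-εx_j`; the factor of `εx_j` itself is `s(-iλβ)`. -/
theorem residue_inl {N M : ℕ} (g : Fin (2 * c.rho + 2) → ℝ) {x : Fin N → ℂ} {y : Fin M → ℂ}
    (hx : NonSingular c β x) (hxy : CrossNonSingular c β lam x y) (gx : GenericPoles c β lam x)
    (j : Fin N) (ε : ℤˣ) :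
    (∏ ν : Fin c.rho, c.s (c.omega ν.succ / 2)) ^ 2 / 4 *
      ((-1) ^ c.rho * residue c β lam g x y (Sum.inl (j, ε))) =
      -(c.s (Complex.I * lam * β) *
        (coeffV c β lam g ε j x * kernelRatio c β lam x y ε j)) := by
  have hk : kernelRatio c β lam x y ε j =
      (∏ p : Fin M × ℤˣ, c.s (sgn ε * x j -
        (center β lam - (sgn p.2 * y p.1 + Complex.I * lam * β)))) /
      ∏ p : Fin M × ℤˣ, c.s (sgn ε * x j - (center β lam - sgn p.2 * y p.1)) := by
    rw [← Finset.prod_div_distrib, Fintype.prod_prod_type]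
    refine Finset.prod_congr rfl fun k _ => Finset.prod_congr rfl fun ε' _ => ?_
    simp only [center]
    congr 2 <;> ring
  have d1 : ∏ ν, c.s (sgn ε * x j - (c.omega ν / 2 + Complex.I * β / 2)) =
      c.s (sgn ε * (2 * x j) - Complex.I * β) * c.halfProd / 2 := by
    rw [show sgn ε * (2 * x j) - Complex.I * β = 2 * (sgn ε * x j - Complex.I * β / 2) by ring,
      ← c.prod_s_sub_half]
    refine Finset.prod_congr rfl fun ν _ => ?_
    congr 1
    ring
  have d2 : ∏ ν, c.s (sgn ε * x j - (center β lam - (c.omega ν / 2 + Complex.I * β / 2))) =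
      (-1) ^ c.rho * (c.s (sgn ε * (2 * x j) - Complex.I * lam * β) * c.halfProd / 2) := by
    rw [show sgn ε * (2 * x j) - Complex.I * lam * β =
      2 * (sgn ε * x j - Complex.I * lam * β / 2) by ring, ← c.prod_s_add_half]
    refine Finset.prod_congr rfl fun ν _ => ?_
    simp only [center]
    congr 1
    ring
  have n1 : ∏ p : Fin M × ℤˣ, c.s (sgn ε * x j - (center β lam - sgn p.2 * y p.1)) ≠ 0 := by
    refine Finset.prod_ne_zero_iff.2 fun p _ => ?_
    have := hxy j p.1 ε p.2
    rwa [show sgn ε * x j - (center β lam - sgn p.2 * y p.1) =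
      sgn ε * x j + sgn p.2 * y p.1 - center β lam by ring]
  have n2 : ∏ k ∈ Finset.univ.erase j, ∏ δ : ℤˣ, c.s (sgn ε * x j - sgn δ * x k) ≠ 0 := by
    refine Finset.prod_ne_zero_iff.2 fun k hk => Finset.prod_ne_zero_iff.2 fun δ _ => ?_
    have := hx.pair j k (Finset.ne_of_mem_erase hk).symm ε (-δ)
    rwa [sgn_neg, neg_mul, ← sub_eq_add_neg] at this
  have n3 := hx.double j ε
  have n4 := hx.double_sub j ε
  have n5 := gx j ε
  have n6 := c.halfProd_ne_zero
  have e0 : (-1 : ℂ) ^ c.rho ≠ 0 := pow_ne_zero _ (by norm_num)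
  rw [c.halfProd_sq, hk, coeffV_eq, residue, numer, univ_erase_inl, Finset.prod_disjSum,
    prod_erase_signed, Fintype.prod_sum_type]
  simp only [pole, Sum.elim_inl, Sum.elim_inr]
  rw [prod_signed (fun p : Fin N × ℤˣ => c.s (sgn ε * x j - (sgn p.2 * x p.1 +
    Complex.I * lam * β))) j ε]
  simp only [sgn_neg]
  rw [d1, d2, show sgn ε * x j - (sgn ε * x j + Complex.I * lam * β) =
    -(Complex.I * lam * β) by ring, c.s_neg, show sgn ε * x j - (-sgn ε * x j +
    Complex.I * lam * β) = sgn ε * (2 * x j) - Complex.I * lam * β by ring,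
    show sgn ε * x j - -sgn ε * x j = sgn ε * (2 * x j) by ring]
  have alg : ∀ A S P Y S2 S2b S2l Q Y' h e : ℂ, S2 ≠ 0 → S2b ≠ 0 → S2l ≠ 0 → Q ≠ 0 → Y' ≠ 0 →
      h ≠ 0 → e ≠ 0 → h ^ 2 / 4 * (e * (A * (-S * (S2l * P) * Y) /
        (S2 * Q * (S2b * h / 2) * (Y' * (e * (S2l * h / 2)))))) =
        -(S * (A / (S2 * S2b) * (P / Q) * (Y / Y'))) := by
    intros
    field_simp
    ring
  exact alg _ _ _ _ _ _ _ _ _ _ _ n3 n4 n5 n2 n1 n6 e0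

/-- The residue carries an exponential in `M`, whereas `V^0` carries one in `N` and `|g|`. The
balancing condition identifies the exponents; outside the elliptic case both vanish. -/
theorem exp_balance {N M : ℕ} (g : Fin (2 * c.rho + 2) → ℝ)
    (hbalance : c.IsElliptic → 2 * lam * ((N : ℝ) - M - 1) + ∑ ν, g ν - 2 = 0)
    (ν : Fin (c.rho + 1)) :
    Complex.exp (2 * Complex.I * c.rxi ν * (Complex.I * lam * β)) ^ M =
      Complex.exp (-c.rxi ν *
          (2 * lam * N + ∑ μ, (g μ : ℂ) - (c.rho + 1) * (lam + 1) / 2) * β) := by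
  rw [← Complex.exp_nat_mul]
  congr 1
  by_cases h : c.IsElliptic
  · have h1 : 2 * (lam : ℂ) * ((N : ℂ) - M - 1) + ∑ ν, (g ν : ℂ) - 2 = 0 := by
      exact_mod_cast hbalance h
    have h3 : (c.rho : ℂ) = 3 := by exact_mod_cast c.rho_eq_three h
    linear_combination c.rxi ν * β * h1 - c.rxi ν * (lam + 1) * β / 2 * h3 +
      2 * M * c.rxi ν * lam * β * Complex.I_sq
  · rw [c.rxi_eq_zero h]
    ring

/-- At a shifted half period, reflection maps the numerator factors of `y` to the denominator
factors, up to one exponential per `y_k`. Hence the dependence on `y` disappears and a term of `V^0`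
remains. -/
theorem residue_inr {N M : ℕ} (g : Fin (2 * c.rho + 2) → ℝ) {x : Fin N → ℂ} {y : Fin M → ℂ}
    (hbalance : c.IsElliptic → 2 * lam * ((N : ℝ) - M - 1) + ∑ ν, g ν - 2 = 0)
    (gy : GenericPoles c β lam y) (ν : Fin (c.rho + 1)) :
    (-1) ^ c.rho * residue c β lam g x y (Sum.inr ν) =
      Complex.exp (-c.rxi ν *
          (2 * lam * N + ∑ μ, (g μ : ℂ) - (c.rho + 1) * (lam + 1) / 2) * β) /
        (∏ μ ∈ Finset.univ.erase ν, c.s ((c.omega ν - c.omega μ) / 2)) *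
      ((∏ μ, c.s (c.omega ν / 2 + Complex.I * β / 2 - Complex.I * g μ * β)) /
        (∏ μ, c.s ((c.omega ν - c.omega μ + Complex.I * (1 - lam) * β) / 2))) *
      ∏ δ : ℤˣ, ∏ j,
        c.s (sgn δ * x j + c.omega ν / 2 + Complex.I * β / 2 - Complex.I * lam * β) /
          c.s (sgn δ * x j + c.omega ν / 2 + Complex.I * β / 2) := by
  obtain ⟨e, he, hrefl⟩ := c.exists_s_reflect ν
  have hx : (∏ δ : ℤˣ, ∏ j,
        c.s (sgn δ * x j + c.omega ν / 2 + Complex.I * β / 2 - Complex.I * lam * β) /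
          c.s (sgn δ * x j + c.omega ν / 2 + Complex.I * β / 2)) =
      (∏ p : Fin N × ℤˣ, c.s (c.omega ν / 2 + Complex.I * β / 2 -
        (sgn p.2 * x p.1 + Complex.I * lam * β))) /
      ∏ p : Fin N × ℤˣ, c.s (c.omega ν / 2 + Complex.I * β / 2 - sgn p.2 * x p.1) := by
    rw [← Finset.prod_div_distrib, Fintype.prod_prod_type, Finset.prod_comm]
    refine Finset.prod_congr rfl fun j _ => ?_
    simp only [prod_signs]
    rw [mul_comm]
    simp only [sgn]
    push_cast
    congr 3 <;> ring
  have ny : ∀ k, ∀ ε' : ℤˣ, c.s (c.omega ν / 2 + Complex.I * β / 2 -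
      (center β lam - sgn ε' * y k)) ≠ 0 := by
    intro k ε'
    have := c.s_add_half_ne_zero (w := sgn ε' * y k - Complex.I * lam * β / 2) (by
      rw [show 2 * (sgn ε' * y k - Complex.I * lam * β / 2) =
        sgn ε' * (2 * y k) - Complex.I * lam * β by ring]
      exact gy k ε') ν
    rwa [center, show c.omega ν / 2 + Complex.I * β / 2 -
      ((Complex.I * β + Complex.I * lam * β) / 2 - sgn ε' * y k) =
      sgn ε' * y k - Complex.I * lam * β / 2 + c.omega ν / 2 by ring]
  have nY : ∏ p : Fin M × ℤˣ, c.s (c.omega ν / 2 + Complex.I * β / 2 -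
      (center β lam - sgn p.2 * y p.1)) ≠ 0 := Finset.prod_ne_zero_iff.2 fun p _ => ny _ _
  have hy : (∏ p : Fin M × ℤˣ, c.s (c.omega ν / 2 + Complex.I * β / 2 -
      (center β lam - (sgn p.2 * y p.1 + Complex.I * lam * β)))) =
      Complex.exp (2 * Complex.I * c.rxi ν * (Complex.I * lam * β)) ^ M *
      ∏ p : Fin M × ℤˣ, c.s (c.omega ν / 2 + Complex.I * β / 2 -
      (center β lam - sgn p.2 * y p.1)) := by
    have hM : ∀ E : ℂ, E ^ M = ∏ _k : Fin M, E := fun E => by simp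
    rw [Fintype.prod_prod_type, Fintype.prod_prod_type, hM, ← Finset.prod_mul_distrib]
    refine Finset.prod_congr rfl fun k _ => ?_
    simp only [prod_signs]
    have h1 := hrefl (y k + Complex.I * lam * β / 2)
    have h2 := hrefl (-y k + Complex.I * lam * β / 2)
    have h3 : Complex.exp (2 * Complex.I * c.rxi ν * (Complex.I * lam * β)) =
        Complex.exp (2 * Complex.I * c.rxi ν * (y k + Complex.I * lam * β / 2)) *
        Complex.exp (2 * Complex.I * c.rxi ν * (-y k + Complex.I * lam * β / 2)) := by
      rw [← Complex.exp_add]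
      congr 1
      ring
    simp only [center, sgn]
    push_cast
    rw [show c.omega ν / 2 + Complex.I * β / 2 - ((Complex.I * β + Complex.I * lam * β) / 2 -
        (1 * y k + Complex.I * lam * β)) =
        c.omega ν / 2 + (y k + Complex.I * lam * β / 2) by ring,
      show c.omega ν / 2 + Complex.I * β / 2 - ((Complex.I * β + Complex.I * lam * β) / 2 -
        (-1 * y k + Complex.I * lam * β)) =
        c.omega ν / 2 + (-y k + Complex.I * lam * β / 2) by ring,
      show c.omega ν / 2 + Complex.I * β / 2 - ((Complex.I * β + Complex.I * lam * β) / 2 -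
        1 * y k) = c.omega ν / 2 - (-y k + Complex.I * lam * β / 2) by ring,
      show c.omega ν / 2 + Complex.I * β / 2 - ((Complex.I * β + Complex.I * lam * β) / 2 -
        -1 * y k) = c.omega ν / 2 - (y k + Complex.I * lam * β / 2) by ring, h1, h2, h3]
    -- The unknown sign `e` occurs once for `y_k` and once for `-y_k`, so only `e ^ 2 = 1` matters.
    linear_combination (Complex.exp (2 * Complex.I * c.rxi ν * (y k + Complex.I * lam * β / 2)) *
        Complex.exp (2 * Complex.I * c.rxi ν * (-y k + Complex.I * lam * β / 2)) *
        c.s (c.omega ν / 2 - (y k + Complex.I * lam * β / 2)) *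
        c.s (c.omega ν / 2 - (-y k + Complex.I * lam * β / 2))) * he
  have d1 : ∏ μ, c.s (c.omega ν / 2 + Complex.I * β / 2 -
      (center β lam - (c.omega μ / 2 + Complex.I * β / 2))) =
      (-1) ^ c.rho * ∏ μ, c.s ((c.omega ν - c.omega μ + Complex.I * (1 - lam) * β) / 2) := by
    have h1 := c.prod_s_add_half (c.omega ν / 2 + Complex.I * (1 - lam) * β / 2)
    rw [← c.prod_s_sub_half] at h1
    convert h1 using 1
    · refine Finset.prod_congr rfl fun μ _ => ?_
      simp only [center]
      congr 1
      ring
    · congr 1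
      refine Finset.prod_congr rfl fun μ _ => ?_
      congr 1
      ring
  have d2 : ∏ μ ∈ Finset.univ.erase ν, c.s (c.omega ν / 2 + Complex.I * β / 2 -
      (c.omega μ / 2 + Complex.I * β / 2)) =
      ∏ μ ∈ Finset.univ.erase ν, c.s ((c.omega ν - c.omega μ) / 2) := by
    refine Finset.prod_congr rfl fun μ _ => ?_
    congr 1
    ring
  have e0 : (-1 : ℂ) ^ c.rho ≠ 0 := pow_ne_zero _ (by norm_num)
  rw [← exp_balance c β lam g hbalance, hx, residue, numer, univ_erase_inr, Finset.prod_disjSum,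
    Fintype.prod_sum_type]
  simp only [pole, Sum.elim_inl, Sum.elim_inr]
  rw [hy, d1, d2]
  have alg : ∀ A X E Y X' D F e : ℂ, Y ≠ 0 → e ≠ 0 →
      e * (A * (X * (E * Y)) / (X' * D * (Y * (e * F)))) = E / D * (A / F) * (X / X') := by
    intro A X E Y X' D F e hY he
    simp only [div_eq_mul_inv, mul_inv]
    linear_combination (A * X * E * X'⁻¹ * D⁻¹ * F⁻¹) * (Y * Y⁻¹ * mul_inv_cancel₀ he +
      mul_inv_cancel₀ hY)
  exact alg _ _ _ _ _ _ _ _ nY e0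

/-- The operator `H_N`, conjugated with the kernel function, applied to the constant `1`. -/
def reducedH {N M : ℕ} (g : Fin (2 * c.rho + 2) → ℝ) (x : Fin N → ℂ) (y : Fin M → ℂ) : ℂ :=
  c.s (Complex.I * lam * β) *
      ∑ ε : ℤˣ, ∑ j, coeffV c β lam g ε j x * kernelRatio c β lam x y ε j +
    coeffV0 c β lam g x

theorem sum_residue_eq {N M : ℕ} (g : Fin (2 * c.rho + 2) → ℝ) {x : Fin N → ℂ} {y : Fin M → ℂ}
    (hbalance : c.IsElliptic → 2 * lam * ((N : ℝ) - M - 1) + ∑ ν, g ν - 2 = 0)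
    (hx : NonSingular c β x) (hxy : CrossNonSingular c β lam x y)
    (gx : GenericPoles c β lam x) (gy : GenericPoles c β lam y) :
    (∏ ν : Fin c.rho, c.s (c.omega ν.succ / 2)) ^ 2 / 4 *
      ((-1) ^ c.rho * ∑ i, residue c β lam g x y i) = -reducedH c β lam g x y := by
  rw [Fintype.sum_sum_type, mul_add, mul_add, Finset.mul_sum, Finset.mul_sum, Fintype.sum_prod_type]
  simp only [residue_inl c β lam g hx hxy gx]
  rw [Finset.mul_sum]
  simp only [residue_inr c β lam g hbalance gy]
  rw [reducedH, coeffV0, Finset.sum_comm]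
  simp only [Finset.sum_neg_distrib, ← Finset.mul_sum]
  ring

theorem dual_balance {N M : ℕ} (g : Fin (2 * c.rho + 2) → ℝ)
    (hbalance : c.IsElliptic → 2 * lam * ((N : ℝ) - M - 1) + ∑ ν, g ν - 2 = 0) :
    c.IsElliptic → 2 * lam * ((M : ℝ) - N - 1) + ∑ ν, dual c lam g ν - 2 = 0 := by
  intro h
  have h1 := hbalance h
  have h3 : (c.rho : ℝ) = 3 := by exact_mod_cast c.rho_eq_three h
  simp only [dual, Finset.sum_sub_distrib, Finset.sum_const, Finset.card_univ, Fintype.card_fin,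
    nsmul_eq_mul]
  push_cast
  linear_combination -h1 + (lam + 1) * h3

theorem reducedH_sub_of_generic {N M : ℕ} (g : Fin (2 * c.rho + 2) → ℝ) {x : Fin N → ℂ}
    {y : Fin M → ℂ}
    (hbalance : c.IsElliptic → 2 * lam * ((N : ℝ) - M - 1) + ∑ ν, g ν - 2 = 0)
    (hlam : Complex.I * (1 - lam) * β ∉ c.periods)
    (hx : NonSingular c β x) (hy : NonSingular c β y) (hxy : CrossNonSingular c β lam x y)
    (gx : GenericPoles c β lam x) (gy : GenericPoles c β lam y) :
    reducedH c β lam g x y - reducedH c β lam (dual c lam g) y x = constC c β lam N M g := by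
  have h := sum_residue_sub c β lam g hbalance hlam hx hy hxy gx gy
  have h1 := sum_residue_eq c β lam g hbalance hx hxy gx gy
  have h2 := sum_residue_eq c β lam (dual c lam g) (dual_balance c lam g hbalance) hy hxy.symm gy gx
  -- Translation by `|ω|` absorbs the sign `(-1) ^ ρ` in the degenerate cases. In the elliptic case
  -- both arguments are zero.
  have h3 : (-1) ^ c.rho * c.s (-(Complex.I * β * (2 * lam * ((N : ℂ) - M) + ∑ ν, (g ν : ℂ) -
        (c.rho + 1) * (lam + 1) / 2))) = -c.s (Complex.I * β *
        (2 * lam * ((N : ℂ) - M) + ∑ ν, (g ν : ℂ) - (c.rho + 1) * (lam + 1) / 2) -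
      ∑ ν, c.omega ν) := by
    by_cases he : c.IsElliptic
    · have e1 : 2 * (lam : ℂ) * ((N : ℂ) - M - 1) + ∑ ν, (g ν : ℂ) - 2 = 0 := by
        exact_mod_cast hbalance he
      have e3 : (c.rho : ℂ) = 3 := by exact_mod_cast c.rho_eq_three he
      have e4 : Complex.I * β * (2 * lam * ((N : ℂ) - M) + ∑ ν, (g ν : ℂ) -
        (c.rho + 1) * (lam + 1) / 2) = 0 := by
        linear_combination Complex.I * β * e1 - Complex.I * β * (lam + 1) / 2 * e3
      rw [c.sum_omega_eq_zero he, e4]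
      simp [c.s_zero]
    · rw [← c.s_add_sum_omega he, ← c.s_neg]
      congr 1
      ring
  rw [constC]
  linear_combination h1 - h2 - (∏ ν : Fin c.rho, c.s (c.omega ν.succ / 2)) ^ 2 / 4 *
    ((-1) ^ c.rho * h + h3)

/-! ### Removal of the genericity assumption on the poles. -/

theorem eventually_nonSingular {N : ℕ} {x : Fin N → ℂ} (hx : NonSingular c β x) :
    ∀ᶠ t in 𝓝 (0 : ℂ), NonSingular c β fun i => x i + t := by
  have hs := c.continuous_s
  have key : ∀ f : ℂ → ℂ, Continuous f → c.s (f 0) ≠ 0 → ∀ᶠ t in 𝓝 (0 : ℂ), c.s (f t) ≠ 0 :=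
    fun f hf h => (hs.comp hf).continuousAt.eventually_ne h
  have h1 : ∀ᶠ t in 𝓝 (0 : ℂ), ∀ j k, j ≠ k → ∀ ε ε' : ℤˣ,
      c.s (sgn ε * (x j + t) + sgn ε' * (x k + t)) ≠ 0 := by
    refine eventually_all.2 fun j => eventually_all.2 fun k => ?_
    by_cases hjk : j = k
    · exact .of_forall fun t h => absurd hjk h
    · have : ∀ᶠ t in 𝓝 (0 : ℂ), ∀ ε ε' : ℤˣ,
          c.s (sgn ε * (x j + t) + sgn ε' * (x k + t)) ≠ 0 :=
        eventually_all.2 fun ε => eventually_all.2 fun ε' =>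
          key (fun t => sgn ε * (x j + t) + sgn ε' * (x k + t)) (by fun_prop)
            (by simpa using hx.pair j k hjk ε ε')
      exact this.mono fun t h _ => h
  have h2 : ∀ᶠ t in 𝓝 (0 : ℂ), ∀ j, ∀ ε : ℤˣ, c.s (sgn ε * (2 * (x j + t))) ≠ 0 :=
    eventually_all.2 fun j => eventually_all.2 fun ε =>
      key (fun t => sgn ε * (2 * (x j + t))) (by fun_prop) (by simpa using hx.double j ε)
  have h3 : ∀ᶠ t in 𝓝 (0 : ℂ), ∀ j, ∀ ε : ℤˣ,
      c.s (sgn ε * (2 * (x j + t)) - Complex.I * β) ≠ 0 :=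
    eventually_all.2 fun j => eventually_all.2 fun ε =>
      key (fun t => sgn ε * (2 * (x j + t)) - Complex.I * β) (by fun_prop)
        (by simpa using hx.double_sub j ε)
  filter_upwards [h1, h2, h3] with t h1 h2 h3
  exact ⟨h1, h2, h3⟩

theorem eventually_crossNonSingular {N M : ℕ} {x : Fin N → ℂ} {y : Fin M → ℂ}
    (hxy : CrossNonSingular c β lam x y) :
    ∀ᶠ t in 𝓝 (0 : ℂ), CrossNonSingular c β lam (fun i => x i + t) fun i => y i + t := by
  have hs := c.continuous_s
  refine eventually_all.2 fun j => eventually_all.2 fun k => eventually_all.2 fun ε =>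
    eventually_all.2 fun ε' => ?_
  have hf : Continuous fun t : ℂ =>
    c.s (sgn ε * (x j + t) + sgn ε' * (y k + t) - center β lam) := by fun_prop
  exact hf.continuousAt.eventually_ne (by simpa using hxy j k ε ε')

/-- Translating all coordinates by a common `t` moves each argument by `± 2t`, so coincidences occur
only at isolated `t`. One complex parameter thus suffices for the limit. -/
theorem eventually_genericPoles {N : ℕ} (x : Fin N → ℂ) :
    ∀ᶠ t in 𝓝[≠] (0 : ℂ), GenericPoles c β lam fun i => x i + t := by
  refine eventually_all.2 fun j => eventually_all.2 fun ε => ?_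
  have hT : Tendsto (fun t : ℂ => sgn ε * (2 * t)) (𝓝[≠] 0) (𝓝[≠] 0) := by
    refine tendsto_nhdsWithin_iff.2 ⟨?_, ?_⟩
    · have : Continuous fun t : ℂ => sgn ε * (2 * t) := by fun_prop
      have h0 := this.tendsto 0
      simp only [mul_zero] at h0
      exact h0.mono_left nhdsWithin_le_nhds
    · filter_upwards [self_mem_nhdsWithin] with t ht
      exact mul_ne_zero (sgn_ne_zero ε) (mul_ne_zero two_ne_zero ht)
  filter_upwards [hT.eventually (c.s_eventually_ne (sgn ε * (2 * x j) - Complex.I * lam * β))]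
    with t ht
  convert ht using 2
  ring

theorem continuousAt_coeffV {N : ℕ} (g : Fin (2 * c.rho + 2) → ℝ) {x : Fin N → ℂ}
    (hx : NonSingular c β x) (ε : ℤˣ) (j : Fin N) :
    ContinuousAt (fun t : ℂ => coeffV c β lam g ε j fun i => x i + t) 0 := by
  have hs := c.continuous_s
  unfold coeffV
  refine ContinuousAt.mul (ContinuousAt.div (Continuous.continuousAt (by fun_prop))
    (Continuous.continuousAt (by fun_prop)) ?_) ?_
  · simpa using ⟨by simpa using hx.double j ε, by simpa using hx.double_sub j ε⟩
  · refine tendsto_finsetProd _ fun δ _ => tendsto_finsetProd _ fun k hk => ?_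
    refine ContinuousAt.div (Continuous.continuousAt (by fun_prop))
      (Continuous.continuousAt (by fun_prop)) ?_
    have := hx.pair j k (Finset.ne_of_mem_erase hk).symm 1 δ
    simpa [sgn] using this

theorem continuousAt_kernelRatio {N M : ℕ} {x : Fin N → ℂ} {y : Fin M → ℂ}
    (hxy : CrossNonSingular c β lam x y) (ε : ℤˣ) (j : Fin N) :
    ContinuousAt (fun t : ℂ => kernelRatio c β lam (fun i => x i + t) (fun i => y i + t) ε j) 0 := by
  have hs := c.continuous_s
  unfold kernelRatio
  refine tendsto_finsetProd _ fun k _ => tendsto_finsetProd _ fun ε' _ => ?_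
  refine ContinuousAt.div (Continuous.continuousAt (by fun_prop))
      (Continuous.continuousAt (by fun_prop)) ?_
  simpa using hxy j k ε ε'

theorem continuousAt_coeffV0 {N : ℕ} (g : Fin (2 * c.rho + 2) → ℝ) {x : Fin N → ℂ}
    (hx : NonSingular c β x) :
    ContinuousAt (fun t : ℂ => coeffV0 c β lam g fun i => x i + t) 0 := by
  have hs := c.continuous_s
  unfold coeffV0
  refine ContinuousAt.mul continuousAt_const (tendsto_finsetSum _ fun ν _ => ?_)
  refine ContinuousAt.mul continuousAt_const ?_
  refine tendsto_finsetProd _ fun δ _ => tendsto_finsetProd _ fun j _ => ?_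
  refine ContinuousAt.div (Continuous.continuousAt (by fun_prop))
      (Continuous.continuousAt (by fun_prop)) ?_
  -- By duplication, the denominators of `V^0` divide `s(2δx_j + iβ)` up to a constant, and this is
  -- minus the denominator factor of `V_j^{-δ}`.
  have h1 := hx.double_sub j (-δ)
  have := c.s_add_half_ne_zero (w := sgn δ * x j + Complex.I * β / 2) (by
    rw [show 2 * (sgn δ * x j + Complex.I * β / 2) =
      -(sgn (-δ) * (2 * x j) - Complex.I * β) by rw [sgn_neg]; ring, c.s_neg]
    exact neg_ne_zero.2 h1) ν
  simp only [add_zero]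
  convert this using 2
  ring

theorem continuousAt_reducedH {N M : ℕ} (g : Fin (2 * c.rho + 2) → ℝ) {x : Fin N → ℂ}
    {y : Fin M → ℂ} (hx : NonSingular c β x) (hxy : CrossNonSingular c β lam x y) :
    ContinuousAt (fun t : ℂ => reducedH c β lam g (fun i => x i + t) fun i => y i + t) 0 := by
  unfold reducedH
  refine ContinuousAt.add (continuousAt_const.mul (tendsto_finsetSum _ fun ε _ =>
    tendsto_finsetSum _ fun j _ => ?_)) (continuousAt_coeffV0 c β lam g hx)
  exact (continuousAt_coeffV c β lam g hx ε j).mul (continuousAt_kernelRatio c β lam hxy ε j)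

/-- The kernel function identity in terms of the coefficients. -/
theorem reducedH_sub {N M : ℕ} (g : Fin (2 * c.rho + 2) → ℝ) {x : Fin N → ℂ} {y : Fin M → ℂ}
    (hbalance : c.IsElliptic → 2 * lam * ((N : ℝ) - M - 1) + ∑ ν, g ν - 2 = 0)
    (hlam : Complex.I * (1 - lam) * β ∉ c.periods)
    (hx : NonSingular c β x) (hy : NonSingular c β y) (hxy : CrossNonSingular c β lam x y) :
    reducedH c β lam g x y - reducedH c β lam (dual c lam g) y x = constC c β lam N M g := by
  have hf := (continuousAt_reducedH c β lam g hx hxy).sub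
    (continuousAt_reducedH c β lam (dual c lam g) hy hxy.symm)
  have l1 := hf.tendsto.mono_left (nhdsWithin_le_nhds (s := {0}ᶜ))
  have ev : ∀ᶠ t in 𝓝[≠] (0 : ℂ), constC c β lam N M g =
      reducedH c β lam g (fun i => x i + t) (fun i => y i + t) -
      reducedH c β lam (dual c lam g) (fun i => y i + t) (fun i => x i + t) := by
    filter_upwards [(eventually_nonSingular c β hx).filter_mono nhdsWithin_le_nhds,
      (eventually_nonSingular c β hy).filter_mono nhdsWithin_le_nhds,
      (eventually_crossNonSingular c β lam hxy).filter_mono nhdsWithin_le_nhds,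
      eventually_genericPoles c β lam x, eventually_genericPoles c β lam y] with t h1 h2 h3 h4 h5
    exact (reducedH_sub_of_generic c β lam g hbalance hlam h1 h2 h3 h4 h5).symm
  have l2 := tendsto_const_nhds.congr' ev
  have := tendsto_nhds_unique l1 l2
  simpa using this

/-! ### Reduction of the operators to their coefficients -/

theorem sgn_mul (ε ε' : ℤˣ) : sgn (ε * ε') = sgn ε * sgn ε' := by
  simp [sgn]

/-- Extracting the pairs that contain `j` from a product over ordered pairs. -/
theorem prod_pairs_eq {N : ℕ} (f : Fin N → Fin N → ℂ) (hf : ∀ a b, f a b = f b a) (j : Fin N) :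
    ∏ a, ∏ b ∈ Finset.Ioi a, f a b = (∏ k ∈ Finset.univ.erase j, f j k) *
      ∏ a ∈ Finset.univ.erase j, ∏ b ∈ (Finset.Ioi a).erase j, f a b := by
  have h1 : ∀ a ∈ Finset.univ.erase j, ∏ b ∈ Finset.Ioi a, f a b =
      (if a < j then f j a else 1) * ∏ b ∈ (Finset.Ioi a).erase j, f a b := by
    intro a _
    by_cases h : a < j
    · rw [if_pos h, hf j a, Finset.mul_prod_erase _ _ (Finset.mem_Ioi.2 h)]
    · rw [if_neg h, one_mul, Finset.erase_eq_of_notMem (by simpa using h)]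
  -- The partners of `j` above it come from row `j`; those below it each come from their own row, by
  -- symmetry of `f`.
  have h2 : ∏ k ∈ Finset.univ.erase j, f j k = (∏ b ∈ Finset.Ioi j, f j b) *
      ∏ a ∈ Finset.univ.erase j, if a < j then f j a else 1 := by
    rw [← Finset.prod_filter, show (Finset.univ.erase j).filter (· < j) = Finset.Iio j by
      ext a; simp only [Finset.mem_filter, Finset.mem_erase, Finset.mem_univ, Finset.mem_Iio]
      exact ⟨fun h => h.2, fun h => ⟨⟨h.ne, trivial⟩, h⟩⟩,
      ← Finset.prod_union]
    · congr 1
      ext a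
      simp only [Finset.mem_erase, Finset.mem_univ, Finset.mem_union, Finset.mem_Ioi,
        Finset.mem_Iio, and_true]
      exact ⟨fun h => (lt_or_gt_of_ne h).symm, fun h => h.elim (fun h => h.ne') fun h => h.ne⟩
    · rw [Finset.disjoint_left]
      intro a h h'
      exact lt_asymm (Finset.mem_Ioi.1 h) (Finset.mem_Iio.1 h')
  rw [← Finset.mul_prod_erase _ _ (Finset.mem_univ j), Finset.prod_congr rfl h1,
    Finset.prod_mul_distrib, h2]
  ring

/-! ### Shifts of the Gamma function, its root, and the weight factors. -/

section Shift

variable {s : ℂ → ℂ} {b κ k : ℂ} {G q σ : ℂ → ℂ}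

variable (hG : IsGammaFunction s b κ G)
include hG

theorem IsGammaFunction.s_ne_zero {z : ℂ} (h1 : Reg G (z + Complex.I * b / 2))
    (h2 : Reg G (z - Complex.I * b / 2)) : s z ≠ 0 := fun h => by
  have := hG.functional_eq z h1 h2
  rw [h, mul_zero, div_eq_zero_iff] at this
  exact this.elim h1.2 h2.2

theorem IsGammaFunction.shift_eq {z z' u : ℂ} (hz : z = u + Complex.I * b / 2)
    (hz' : z' = u - Complex.I * b / 2) (h1 : Reg G z) (h2 : Reg G z') :
    G z = κ * s u * G z' := by
  subst hz hz'
  rw [← hG.functional_eq u h1 h2, div_mul_cancel₀ _ h2.2]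

variable (hroot : IsRootBranch s b κ G q σ k)
include hroot

omit hG in
theorem IsRootBranch.q_ne_zero {z : ℂ} (h : Reg G z) : q z ≠ 0 := fun h0 => h.2 (by
  rw [← hroot.sq_gamma, h0]
  ring)

theorem IsRootBranch.const_ne_zero : k ≠ 0 := fun h0 => hG.const_ne_zero (by
  rw [← hroot.sq_const, h0]
  ring)

theorem IsRootBranch.sigma_ne_zero {z z' u : ℂ} (hz : z = u + Complex.I * b / 2)
    (hz' : z' = u - Complex.I * b / 2) (h1 : Reg G z) (h2 : Reg G z') : σ u ≠ 0 := fun h0 => by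
  subst hz hz'
  refine hG.s_ne_zero h1 h2 ?_
  rw [← hroot.sq_s, h0]
  ring

omit hG in
theorem IsRootBranch.shift_eq {z z' u : ℂ} (hz : z = u + Complex.I * b / 2)
    (hz' : z' = u - Complex.I * b / 2) (h1 : Reg G z) (h2 : Reg G z') :
    q z = k * σ u * q z' := by
  subst hz hz'
  rw [← hroot.functional_eq u h1 h2, div_mul_cancel₀ _ (hroot.q_ne_zero h2)]

end Shift

/-- The factor of the weight that depends on one variable. -/
def singleWeight (q : ℂ → ℂ) (g : Fin (2 * c.rho + 2) → ℝ) (w : ℂ) : ℂ :=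
  (q (2 * w + Complex.I * β / 2) * q (-2 * w + Complex.I * β / 2)) /
      ∏ ν, (q (w + Complex.I * β / 2 - Complex.I * g ν * β) *
        q (-w + Complex.I * β / 2 - Complex.I * g ν * β))

/-- The factor of the weight that depends on two variables. -/
def pairWeight (q : ℂ → ℂ) (w v : ℂ) : ℂ :=
  ∏ ε : ℤˣ, ∏ ε' : ℤˣ, q (sgn ε * w + sgn ε' * v + Complex.I * β / 2) /
        q (sgn ε * w + sgn ε' * v - Complex.I * lam * β + Complex.I * β / 2)

theorem weight_eq (q : ℂ → ℂ) {N : ℕ} (g : Fin (2 * c.rho + 2) → ℝ) (x : Fin N → ℂ) :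
    weight c β lam q g x = (∏ j, singleWeight c β q g (x j)) *
      ∏ j, ∏ k ∈ Finset.Ioi j, pairWeight β lam q (x j) (x k) := rfl

theorem singleWeight_sgn (q : ℂ → ℂ) (g : Fin (2 * c.rho + 2) → ℝ) (ε : ℤˣ) (w : ℂ) :
    singleWeight c β q g (sgn ε * w) = singleWeight c β q g w := by
  rcases Int.units_eq_one_or ε with rfl | rfl
  · simp [sgn]
  · simp only [singleWeight, sgn]
    push_cast
    rw [mul_comm]
    congr 1
    · congr 2 <;> ring
    · refine Finset.prod_congr rfl fun ν _ => ?_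
      rw [mul_comm]
      congr 2 <;> ring

theorem pairWeight_comm (q : ℂ → ℂ) (w v : ℂ) :
    pairWeight β lam q w v = pairWeight β lam q v w := by
  unfold pairWeight
  rw [Finset.prod_comm]
  refine Finset.prod_congr rfl fun ε _ => Finset.prod_congr rfl fun ε' _ => ?_
  rw [add_comm (sgn ε' * w)]

theorem pairWeight_sgn (q : ℂ → ℂ) (ε : ℤˣ) (w v : ℂ) :
    pairWeight β lam q (sgn ε * w) v = pairWeight β lam q w v := by
  unfold pairWeight
  refine Fintype.prod_equiv (Equiv.mulRight ε) _ _ fun ε' => ?_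
  simp only [Equiv.coe_mulRight, sgn_mul, mul_assoc]

section

variable {c β} {κ k : ℂ} {G q σ : ℂ → ℂ} (hG : IsGammaFunction c.s β κ G)
  (hroot : IsRootBranch c.s β κ G q σ k)
include hG hroot

/-- The functional equation of the root is applied directly, so no choice of sign arises. The
arguments `± 2w` move by `2iβ` and need it twice, which is why shifts up to `|n| = 2` must be
regular. The powers of `k` from `w` and `-w` cancel. -/
theorem singleWeight_shift (g : Fin (2 * c.rho + 2) → ℝ) (w : ℂ)
    (h2 : ∀ n : ℤ, |n| ≤ 2 → ∀ ε : ℤˣ,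
      Reg G (sgn ε * (2 * w) + Complex.I * β / 2 + n * Complex.I * β))
    (h1 : ∀ n : ℤ, |n| ≤ 2 → ∀ ε : ℤˣ, ∀ ν,
      Reg G (sgn ε * w + Complex.I * β / 2 - Complex.I * g ν * β + n * Complex.I * β)) :
    ((∏ ν, σ (w - Complex.I * g ν * β)) / (σ (2 * w) * σ (2 * w - Complex.I * β))) *
      (((∏ ν, σ (-w + Complex.I * β - Complex.I * g ν * β)) /
        (σ (-(2 * w) + 2 * (Complex.I * β)) * σ (-(2 * w) + Complex.I * β))) *
      singleWeight c β q g (w - Complex.I * β)) =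
    ((∏ ν, σ (w - Complex.I * g ν * β)) / (σ (2 * w) * σ (2 * w - Complex.I * β))) ^ 2 *
      singleWeight c β q g w := by
  have hk := hroot.const_ne_zero hG
  have r2 : ∀ (n : ℤ) (ε : ℤˣ) (z : ℂ), |n| ≤ 2 →
      z = sgn ε * (2 * w) + Complex.I * β / 2 + n * Complex.I * β → Reg G z :=
    fun n ε z hn hz => hz ▸ h2 n hn ε
  have r1 : ∀ (n : ℤ) (ε : ℤˣ) (ν) (z : ℂ), |n| ≤ 2 →
      z = sgn ε * w + Complex.I * β / 2 - Complex.I * g ν * β + n * Complex.I * β → Reg G z :=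
    fun n ε ν z hn hz => hz ▸ h1 n hn ε ν
  have a1 : Reg G (2 * w + Complex.I * β / 2) := r2 0 1 _ (by norm_num) (by simp [sgn])
  have a2 : Reg G (2 * w - Complex.I * β / 2) :=
    r2 (-1) 1 _ (by norm_num) (by simp [sgn]; ring)
  have a3 : Reg G (2 * (w - Complex.I * β) + Complex.I * β / 2) :=
    r2 (-2) 1 _ (by norm_num) (by simp [sgn]; ring)
  have b1 : Reg G (-2 * w + Complex.I * β / 2) := r2 0 (-1) _ (by norm_num) (by simp [sgn])
  have b2 : Reg G (-2 * w + 3 * (Complex.I * β) / 2) :=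
    r2 1 (-1) _ (by norm_num) (by simp [sgn]; ring)
  have b3 : Reg G (-2 * (w - Complex.I * β) + Complex.I * β / 2) :=
    r2 2 (-1) _ (by norm_num) (by simp [sgn]; ring)
  have c1 : ∀ ν, Reg G (w + Complex.I * β / 2 - Complex.I * g ν * β) := fun ν =>
    r1 0 1 ν _ (by norm_num) (by simp [sgn])
  have c2 : ∀ ν, Reg G (w - Complex.I * β + Complex.I * β / 2 - Complex.I * g ν * β) := fun ν =>
    r1 (-1) 1 ν _ (by norm_num) (by simp [sgn]; ring)
  have d1 : ∀ ν, Reg G (-w + Complex.I * β / 2 - Complex.I * g ν * β) := fun ν =>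
    r1 0 (-1) ν _ (by norm_num) (by simp [sgn])
  have d2 : ∀ ν, Reg G (-(w - Complex.I * β) + Complex.I * β / 2 - Complex.I * g ν * β) := fun ν =>
    r1 1 (-1) ν _ (by norm_num) (by simp [sgn]; ring)
  have s1 := hroot.sigma_ne_zero hG (u := 2 * w) rfl rfl a1 a2
  have s2 := hroot.sigma_ne_zero hG (u := 2 * w - Complex.I * β) (by ring) (by ring) a2 a3
  have s3 := hroot.sigma_ne_zero hG (u := -(2 * w) + Complex.I * β) (by ring) (by ring) b2 b1
  have s4 := hroot.sigma_ne_zero hG (u := -(2 * w) + 2 * (Complex.I * β)) (by ring) (by ring) b3 b2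
  have e1 : q (2 * w + Complex.I * β / 2) = k * σ (2 * w) * (k * σ (2 * w - Complex.I * β) *
      q (2 * (w - Complex.I * β) + Complex.I * β / 2)) := by
    rw [hroot.shift_eq (u := 2 * w) rfl rfl a1 a2,
      hroot.shift_eq (u := 2 * w - Complex.I * β) (by ring) (by ring) a2 a3]
  have e2 : q (-2 * (w - Complex.I * β) + Complex.I * β / 2) =
      k * σ (-(2 * w) + 2 * (Complex.I * β)) * (k * σ (-(2 * w) + Complex.I * β) *
        q (-2 * w + Complex.I * β / 2)) := by
    rw [hroot.shift_eq (u := -(2 * w) + 2 * (Complex.I * β)) (by ring) (by ring) b3 b2,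
      hroot.shift_eq (u := -(2 * w) + Complex.I * β) (by ring) (by ring) b2 b1]
  have e3 : ∏ ν, q (w + Complex.I * β / 2 - Complex.I * g ν * β) =
      (∏ _ν : Fin (2 * c.rho + 2), k) * (∏ ν, σ (w - Complex.I * g ν * β)) *
        ∏ ν, q (w - Complex.I * β + Complex.I * β / 2 - Complex.I * g ν * β) := by
    simp only [← Finset.prod_mul_distrib]
    exact Finset.prod_congr rfl fun ν _ => hroot.shift_eq (by ring) (by ring) (c1 ν) (c2 ν)
  have e4 : ∏ ν, q (-(w - Complex.I * β) + Complex.I * β / 2 - Complex.I * g ν * β) =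
      (∏ _ν : Fin (2 * c.rho + 2), k) * (∏ ν, σ (-w + Complex.I * β - Complex.I * g ν * β)) *
        ∏ ν, q (-w + Complex.I * β / 2 - Complex.I * g ν * β) := by
    simp only [← Finset.prod_mul_distrib]
    exact Finset.prod_congr rfl fun ν _ => hroot.shift_eq (by ring) (by ring) (d2 ν) (d1 ν)
  have n1 : ∏ ν, q (w + Complex.I * β / 2 - Complex.I * g ν * β) ≠ 0 :=
    Finset.prod_ne_zero_iff.2 fun ν _ => hroot.q_ne_zero (c1 ν)
  have n2 : ∏ ν, q (w - Complex.I * β + Complex.I * β / 2 - Complex.I * g ν * β) ≠ 0 :=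
    Finset.prod_ne_zero_iff.2 fun ν _ => hroot.q_ne_zero (c2 ν)
  have n3 : ∏ ν, q (-w + Complex.I * β / 2 - Complex.I * g ν * β) ≠ 0 :=
    Finset.prod_ne_zero_iff.2 fun ν _ => hroot.q_ne_zero (d1 ν)
  have n4 : ∏ ν, q (-(w - Complex.I * β) + Complex.I * β / 2 - Complex.I * g ν * β) ≠ 0 :=
    Finset.prod_ne_zero_iff.2 fun ν _ => hroot.q_ne_zero (d2 ν)
  have alg : ∀ A B S₁ S₂ S₃ S₄ Q Q' P₁ P₂ P₃ P₄ K : ℂ, S₁ ≠ 0 → S₂ ≠ 0 → S₃ ≠ 0 → S₄ ≠ 0 →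
      P₁ ≠ 0 → P₂ ≠ 0 → P₃ ≠ 0 → P₄ ≠ 0 → P₁ = K * A * P₂ → P₄ = K * B * P₃ →
      A / (S₁ * S₂) * (B / (S₄ * S₃) * (Q * (k * S₄ * (k * S₃ * Q')) / (P₂ * P₄))) =
      (A / (S₁ * S₂)) ^ 2 * (k * S₁ * (k * S₂ * Q) * Q' / (P₁ * P₃)) := by
    intro A B S₁ S₂ S₃ S₄ Q Q' P₁ P₂ P₃ P₄ K h₁ h₂ h₃ h₄ m₁ m₂ m₃ m₄ E₁ E₂
    have hKA : K * A ≠ 0 := left_ne_zero_of_mul (E₁ ▸ m₁)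
    have hKB : K * B ≠ 0 := left_ne_zero_of_mul (E₂ ▸ m₄)
    have hK := left_ne_zero_of_mul hKA
    have hA := right_ne_zero_of_mul hKA
    have hB := right_ne_zero_of_mul hKB
    rw [E₁, E₂]
    field_simp
  unfold singleWeight
  rw [e1, e2, Finset.prod_mul_distrib, Finset.prod_mul_distrib]
  exact alg _ _ _ _ _ _ _ _ _ _ _ _ _ s1 s2 s3 s4 n1 n2 n3 n4 e3 e4

/-- For each sign of `v`, the two signs of `w` move in opposite directions under the shift.
Numerator and denominator produce equal powers of `k`, and the roots of `s` pair with those of the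
coefficients. -/
theorem pairWeight_shift (w v : ℂ)
    (h : ∀ n : ℤ, |n| ≤ 2 → ∀ ε ε' : ℤˣ,
      Reg G (sgn ε * w + sgn ε' * v + Complex.I * β / 2 + n * Complex.I * β) ∧
      Reg G (sgn ε * w + sgn ε' * v - Complex.I * lam * β + Complex.I * β / 2 +
        n * Complex.I * β)) :
    (∏ δ : ℤˣ, σ (w + sgn δ * v - Complex.I * lam * β) / σ (w + sgn δ * v)) *
      ((∏ δ : ℤˣ, σ (-w + Complex.I * β + sgn δ * v - Complex.I * lam * β) /
        σ (-w + Complex.I * β + sgn δ * v)) * pairWeight β lam q (w - Complex.I * β) v) =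
    (∏ δ : ℤˣ, σ (w + sgn δ * v - Complex.I * lam * β) / σ (w + sgn δ * v)) ^ 2 *
      pairWeight β lam q w v := by
  have hk := hroot.const_ne_zero hG
  unfold pairWeight
  rw [← Finset.prod_pow]
  simp only [prod_signs (fun ε : ℤˣ => ∏ ε' : ℤˣ, q (sgn ε * _ + sgn ε' * v + Complex.I * β / 2) /
        q (sgn ε * _ + sgn ε' * v - Complex.I * lam * β + Complex.I * β / 2)),
    ← Finset.prod_mul_distrib]
  refine Finset.prod_congr rfl fun δ _ => ?_
  have r : ∀ (n : ℤ) (ε : ℤˣ) (z : ℂ), |n| ≤ 2 →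
      z = sgn ε * w + sgn δ * v + Complex.I * β / 2 + n * Complex.I * β → Reg G z :=
    fun n ε z hn hz => hz ▸ (h n hn ε δ).1
  have r' : ∀ (n : ℤ) (ε : ℤˣ) (z : ℂ), |n| ≤ 2 →
      z = sgn ε * w + sgn δ * v - Complex.I * lam * β + Complex.I * β / 2 + n * Complex.I * β →
      Reg G z := fun n ε z hn hz => hz ▸ (h n hn ε δ).2
  simp only [sgn]
  push_cast
  have a1 : Reg G (1 * w + sgn δ * v + Complex.I * β / 2) :=
    r 0 1 _ (by norm_num) (by simp [sgn])
  have a2 : Reg G (1 * (w - Complex.I * β) + sgn δ * v + Complex.I * β / 2) :=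
    r (-1) 1 _ (by norm_num) (by simp [sgn]; ring)
  have b1 : Reg G (-1 * w + sgn δ * v + Complex.I * β / 2) :=
    r 0 (-1) _ (by norm_num) (by simp [sgn])
  have b2 : Reg G (-1 * (w - Complex.I * β) + sgn δ * v + Complex.I * β / 2) :=
    r 1 (-1) _ (by norm_num) (by simp [sgn]; ring)
  have a1' : Reg G (1 * w + sgn δ * v - Complex.I * lam * β + Complex.I * β / 2) :=
    r' 0 1 _ (by norm_num) (by simp [sgn])
  have a2' : Reg G (1 * (w - Complex.I * β) + sgn δ * v - Complex.I * lam * β +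
      Complex.I * β / 2) := r' (-1) 1 _ (by norm_num) (by simp [sgn]; ring)
  have b1' : Reg G (-1 * w + sgn δ * v - Complex.I * lam * β + Complex.I * β / 2) :=
    r' 0 (-1) _ (by norm_num) (by simp [sgn])
  have b2' : Reg G (-1 * (w - Complex.I * β) + sgn δ * v - Complex.I * lam * β +
      Complex.I * β / 2) := r' 1 (-1) _ (by norm_num) (by simp [sgn]; ring)
  simp only [sgn] at a1 a2 b1 b2 a1' a2' b1' b2'
  have s1 := hroot.sigma_ne_zero hG (u := w + (δ : ℤ) * v) (by ring) (by ring) a1 a2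
  have s2 := hroot.sigma_ne_zero hG (u := -w + Complex.I * β + (δ : ℤ) * v) (by ring) (by ring) b2 b1
  have s3 := hroot.sigma_ne_zero hG (u := w + (δ : ℤ) * v - Complex.I * lam * β)
    (by ring) (by ring) a1' a2'
  have s4 := hroot.sigma_ne_zero hG (u := -w + Complex.I * β + (δ : ℤ) * v - Complex.I * lam * β)
    (by ring) (by ring) b2' b1'
  rw [hroot.shift_eq (u := w + (δ : ℤ) * v) (by ring) (by ring) a1 a2,
    hroot.shift_eq (u := -w + Complex.I * β + (δ : ℤ) * v) (by ring) (by ring) b2 b1,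
    hroot.shift_eq (u := w + (δ : ℤ) * v - Complex.I * lam * β) (by ring) (by ring) a1' a2',
    hroot.shift_eq (u := -w + Complex.I * β + (δ : ℤ) * v - Complex.I * lam * β)
      (by ring) (by ring) b2' b1']
  have m1 := hroot.q_ne_zero a2
  have m2 := hroot.q_ne_zero a2'
  have m3 := hroot.q_ne_zero b1
  have m4 := hroot.q_ne_zero b1'
  generalize q (1 * (w - Complex.I * β) + (δ : ℤ) * v + Complex.I * β / 2) = Q1 at *
  generalize q (1 * (w - Complex.I * β) + (δ : ℤ) * v - Complex.I * lam * β + Complex.I * β / 2) = Q2 at *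
  generalize q (-1 * w + (δ : ℤ) * v + Complex.I * β / 2) = Q3 at *
  generalize q (-1 * w + (δ : ℤ) * v - Complex.I * lam * β + Complex.I * β / 2) = Q4 at *
  field_simp

end

/-! ### Conjugation of the operators by the kernel function. -/

section

variable {c : Case} {β : ℝ} (lam : ℝ) {κ k : ℂ} {G q σ : ℂ → ℂ}

/-- The weight is even in each variable, so `x_j` may be replaced by `ε x_j`. This reduces both
shift directions to subtracting `iβ` and isolates the factors that change. -/
theorem weight_split (q : ℂ → ℂ) {N : ℕ} (g : Fin (2 * c.rho + 2) → ℝ) (x : Fin N → ℂ)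
    (j : Fin N) (ε : ℤˣ) :
    weight c β lam q g x = (singleWeight c β q g (sgn ε * x j) *
      ∏ k ∈ Finset.univ.erase j, pairWeight β lam q (sgn ε * x j) (x k)) *
      ((∏ a ∈ Finset.univ.erase j, singleWeight c β q g (x a)) *
      ∏ a ∈ Finset.univ.erase j, ∏ b ∈ (Finset.Ioi a).erase j,
        pairWeight β lam q (x a) (x b)) := by
  rw [weight_eq, prod_pairs_eq _ (fun a b => pairWeight_comm β lam q (x a) (x b)) j,
    ← Finset.mul_prod_erase _ _ (Finset.mem_univ j), singleWeight_sgn]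
  simp only [pairWeight_sgn]
  ring

theorem shift_same {N : ℕ} (ε : ℤˣ) (j : Fin N) (x : Fin N → ℂ) :
    shift β ε j x j = x j - sgn ε * Complex.I * β := by
  simp [shift]

theorem shift_ne {N : ℕ} (ε : ℤˣ) {j k : Fin N} (h : k ≠ j) (x : Fin N → ℂ) :
    shift β ε j x k = x k := by
  simp [shift, h]

theorem sgn_mul_shift {N : ℕ} (ε : ℤˣ) (j : Fin N) (x : Fin N → ℂ) :
    sgn ε * shift β ε j x j = sgn ε * x j - Complex.I * β := by
  rw [shift_same]
  linear_combination (-Complex.I * β) * sgn_mul_self ε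

/-- The regularity of the arguments of `G` in the weight, in terms of `± x_j`. -/
theorem PsiReg.pair {N : ℕ} {g : Fin (2 * c.rho + 2) → ℝ} {n : ℤ} {x : Fin N → ℂ}
    (h : PsiReg c β lam G g n x) {j k : Fin N} (hjk : j ≠ k) (ε ε' : ℤˣ) :
    Reg G (sgn ε * x j + sgn ε' * x k + Complex.I * β / 2 + n * Complex.I * β) ∧
    Reg G (sgn ε * x j + sgn ε' * x k - Complex.I * lam * β + Complex.I * β / 2 +
      n * Complex.I * β) := by
  rcases lt_or_gt_of_ne hjk with hlt | hlt
  · exact h.2.2 j k hlt ε ε'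
  · rw [add_comm (sgn ε * x j)]
    exact h.2.2 k j hlt ε' ε

variable (hG : IsGammaFunction c.s β κ G)
include hG

/-- A zero of `s` between two regular arguments of `G` would force their ratio to vanish. Regular
points therefore avoid all denominators of the coefficients. -/
theorem nonSingular_of_psiReg {N : ℕ} {g : Fin (2 * c.rho + 2) → ℝ} {x : Fin N → ℂ}
    (h : ∀ n : ℤ, |n| ≤ 2 → PsiReg c β lam G g n x) : NonSingular c β x := by
  have h0 := h 0 (by norm_num)
  have h1 := h (-1) (by norm_num)
  have h2 := h (-2) (by norm_num)
  refine ⟨fun j k hjk ε ε' => ?_, fun j ε => ?_, fun j ε => ?_⟩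
  · refine hG.s_ne_zero ?_ ?_
    · have := (h0.pair lam hjk ε ε').1
      convert this using 1
      push_cast
      ring
    · have := (h1.pair lam hjk ε ε').1
      convert this using 1
      push_cast
      ring
  · refine hG.s_ne_zero ?_ ?_
    · convert h0.1 j ε using 1
      push_cast
      ring
    · convert h1.1 j ε using 1
      push_cast
      ring
  · refine hG.s_ne_zero ?_ ?_
    · convert h1.1 j ε using 1
      push_cast
      ring
    · convert h2.1 j ε using 1
      push_cast
      ring

theorem crossNonSingular_of_reg {N M : ℕ} {x : Fin N → ℂ} {y : Fin M → ℂ}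
    (h : ∀ n : ℤ, |n| ≤ 2 → ∀ j k, ∀ ε ε' : ℤˣ,
      Reg G (sgn ε * x j + sgn ε' * y k - Complex.I * lam * β / 2 + n * Complex.I * β)) :
    CrossNonSingular c β lam x y := by
  intro j k ε ε'
  refine hG.s_ne_zero ?_ ?_
  · convert h 0 (by norm_num) j k ε ε' using 1
    rw [center]
    push_cast
    ring
  · convert h (-1) (by norm_num) j k ε ε' using 1
    rw [center]
    push_cast
    ring

/-- The behaviour of the double product in the kernel function under a shift. -/
theorem cross_shift {N M : ℕ} {x : Fin N → ℂ} {y : Fin M → ℂ}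
    (h : ∀ n : ℤ, |n| ≤ 2 → ∀ j k, ∀ ε ε' : ℤˣ,
      Reg G (sgn ε * x j + sgn ε' * y k - Complex.I * lam * β / 2 + n * Complex.I * β))
    (ε : ℤˣ) (j : Fin N) :
    ∏ i, ∏ k, ∏ δ : ℤˣ, ∏ ε' : ℤˣ,
      G (sgn δ * shift β ε j x i + sgn ε' * y k - Complex.I * lam * β / 2) =
    kernelRatio c β lam x y ε j * ∏ i, ∏ k, ∏ δ : ℤˣ, ∏ ε' : ℤˣ,
      G (sgn δ * x i + sgn ε' * y k - Complex.I * lam * β / 2) := by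
  let f : ℂ → ℂ := fun v => ∏ k, ∏ δ : ℤˣ, ∏ ε' : ℤˣ,
    G (sgn δ * v + sgn ε' * y k - Complex.I * lam * β / 2)
  have hf : ∀ v, f (sgn ε * v) = f v := fun v => by
    refine Finset.prod_congr rfl fun k _ => Fintype.prod_equiv (Equiv.mulRight ε) _ _ fun ε' => ?_
    simp only [Equiv.coe_mulRight, sgn_mul, mul_assoc]
  change ∏ i, f (shift β ε j x i) = kernelRatio c β lam x y ε j * ∏ i, f (x i)
  rw [← Finset.mul_prod_erase _ _ (Finset.mem_univ j), ← Finset.mul_prod_erase _ (fun i => f (x i))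
    (Finset.mem_univ j), Finset.prod_congr rfl fun i hi => by
      rw [shift_ne ε (Finset.ne_of_mem_erase hi) x], ← hf, sgn_mul_shift, ← hf (x j), ← mul_assoc]
  congr 1
  set w := sgn ε * x j with hw
  simp only [f, kernelRatio, ← hw]
  rw [← Finset.prod_mul_distrib]
  refine Finset.prod_congr rfl fun k _ => ?_
  simp only [prod_signs (fun δ : ℤˣ => ∏ ε' : ℤˣ,
    G (sgn δ * _ + sgn ε' * y k - Complex.I * lam * β / 2))]
  -- The shift raises the arguments containing `-w`, producing factors of `s` at opposite points.
  -- Their signs cancel in pairs over `δ`.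
  have hflip : ∏ δ : ℤˣ, c.s (w + sgn δ * y k - (Complex.I * β - Complex.I * lam * β) / 2) =
      ∏ δ : ℤˣ, c.s (-w + sgn δ * y k + (Complex.I * β - Complex.I * lam * β) / 2) := by
    simp only [prod_signs, sgn]
    push_cast
    rw [show w + 1 * y k - (Complex.I * β - Complex.I * lam * β) / 2 =
      -(-w + -1 * y k + (Complex.I * β - Complex.I * lam * β) / 2) by ring,
      show w + -1 * y k - (Complex.I * β - Complex.I * lam * β) / 2 =
      -(-w + 1 * y k + (Complex.I * β - Complex.I * lam * β) / 2) by ring, c.s_neg, c.s_neg]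
    ring
  rw [Finset.prod_div_distrib, hflip, ← Finset.prod_div_distrib]
  simp only [← Finset.prod_mul_distrib]
  refine Finset.prod_congr rfl fun δ _ => ?_
  have r : ∀ (n : ℤ) (ε' : ℤˣ) (z : ℂ), |n| ≤ 2 →
      z = sgn ε' * w + sgn δ * y k - Complex.I * lam * β / 2 + n * Complex.I * β → Reg G z :=
    fun n ε' z hn hz => by
      have := h n hn j k (ε' * ε) δ
      rw [sgn_mul, mul_assoc, ← hw] at this
      exact hz ▸ this
  simp only [sgn]
  push_cast
  have a1 : Reg G (1 * w + sgn δ * y k - Complex.I * lam * β / 2) :=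
    r 0 1 _ (by norm_num) (by simp [sgn])
  have a2 : Reg G (1 * (w - Complex.I * β) + sgn δ * y k - Complex.I * lam * β / 2) :=
    r (-1) 1 _ (by norm_num) (by simp [sgn]; ring)
  have b1 : Reg G (-1 * w + sgn δ * y k - Complex.I * lam * β / 2) :=
    r 0 (-1) _ (by norm_num) (by simp [sgn])
  have b2 : Reg G (-1 * (w - Complex.I * β) + sgn δ * y k - Complex.I * lam * β / 2) :=
    r 1 (-1) _ (by norm_num) (by simp [sgn]; ring)
  simp only [sgn] at a1 a2 b1 b2
  have e1 := hG.shift_eq (u := w + (δ : ℤ) * y k - center β lam)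
    (by rw [center]; ring) (by rw [center]; ring) a1 a2
  have e2 := hG.shift_eq (u := -w + (δ : ℤ) * y k + (Complex.I * β - Complex.I * lam * β) / 2)
    (by ring) (by ring) b2 b1
  have hκ := hG.const_ne_zero
  have hs : c.s (w + (δ : ℤ) * y k - center β lam) ≠ 0 := fun h0 => by
    rw [h0, mul_zero, zero_mul] at e1
    exact a1.2 e1
  rw [e1, e2]
  field_simp

variable (hroot : IsRootBranch c.s β κ G q σ k)
include hroot

/-- The one-variable identity and the identities for the pairs containing `j` multiply together;
everything else in the weight is unchanged by the shift. -/
theorem rootV_mul_weight_shift {N : ℕ} {g : Fin (2 * c.rho + 2) → ℝ} {x : Fin N → ℂ}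
    (h : ∀ n : ℤ, |n| ≤ 2 → PsiReg c β lam G g n x) (ε : ℤˣ) (j : Fin N) :
    rootV c β lam σ g ε j x * (rootV c β lam σ g (-ε) j (shift β ε j x) *
      Psi c β lam q g (shift β ε j x)) = coeffV c β lam g ε j x * Psi c β lam q g x := by
  rw [← sq_rootV c β lam σ hroot.sq_s, Psi, Psi, weight_split lam q g x j ε,
    weight_split lam q g (shift β ε j x) j ε, sgn_mul_shift]
  have h1 : ∏ k ∈ Finset.univ.erase j, pairWeight β lam q (sgn ε * x j - Complex.I * β)
      (shift β ε j x k) = ∏ k ∈ Finset.univ.erase j,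
        pairWeight β lam q (sgn ε * x j - Complex.I * β) (x k) :=
    Finset.prod_congr rfl fun k hk => by rw [shift_ne ε (Finset.ne_of_mem_erase hk)]
  have h2 : ∏ a ∈ Finset.univ.erase j, singleWeight c β q g (shift β ε j x a) =
      ∏ a ∈ Finset.univ.erase j, singleWeight c β q g (x a) :=
    Finset.prod_congr rfl fun k hk => by rw [shift_ne ε (Finset.ne_of_mem_erase hk)]
  have h3 : ∏ a ∈ Finset.univ.erase j, ∏ b ∈ (Finset.Ioi a).erase j,
      pairWeight β lam q (shift β ε j x a) (shift β ε j x b) =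
      ∏ a ∈ Finset.univ.erase j, ∏ b ∈ (Finset.Ioi a).erase j,
        pairWeight β lam q (x a) (x b) :=
    Finset.prod_congr rfl fun a ha => Finset.prod_congr rfl fun b hb => by
      rw [shift_ne ε (Finset.ne_of_mem_erase ha), shift_ne ε (Finset.ne_of_mem_erase hb)]
  have single := singleWeight_shift hG hroot g (sgn ε * x j)
    (fun n hn ε' => by
      have := (h n hn).1 j (ε' * ε)
      rwa [sgn_mul, mul_assoc, mul_left_comm (sgn ε)] at this)
    (fun n hn ε' ν => by
      have := (h n hn).2.1 j (ε' * ε) ν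
      rwa [sgn_mul, mul_assoc] at this)
  have pair : ∀ k ∈ Finset.univ.erase j, _ := fun k hk =>
    pairWeight_shift lam hG hroot (sgn ε * x j) (x k) (fun n hn ε₁ ε₂ => by
      have := (h n hn).pair lam (Finset.ne_of_mem_erase hk).symm (ε₁ * ε) ε₂
      rwa [sgn_mul, mul_assoc] at this)
  have pairs := Finset.prod_congr (M := ℂ) rfl pair
  simp only [Finset.prod_mul_distrib, Finset.prod_pow] at pairs
  have v1 : rootV c β lam σ g ε j x = ((∏ ν, σ (sgn ε * x j - Complex.I * g ν * β)) /
      (σ (2 * (sgn ε * x j)) * σ (2 * (sgn ε * x j) - Complex.I * β))) *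
      ∏ k ∈ Finset.univ.erase j, ∏ δ : ℤˣ,
        σ (sgn ε * x j + sgn δ * x k - Complex.I * lam * β) / σ (sgn ε * x j + sgn δ * x k) := by
    rw [rootV, Finset.prod_comm, mul_left_comm (sgn ε)]
  have v2 : rootV c β lam σ g (-ε) j (shift β ε j x) =
      ((∏ ν, σ (-(sgn ε * x j) + Complex.I * β - Complex.I * g ν * β)) /
        (σ (-(2 * (sgn ε * x j)) + 2 * (Complex.I * β)) *
          σ (-(2 * (sgn ε * x j)) + Complex.I * β))) *
      ∏ k ∈ Finset.univ.erase j, ∏ δ : ℤˣ,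
        σ (-(sgn ε * x j) + Complex.I * β + sgn δ * x k - Complex.I * lam * β) /
          σ (-(sgn ε * x j) + Complex.I * β + sgn δ * x k) := by
    have e : sgn (-ε) * shift β ε j x j = -(sgn ε * x j) + Complex.I * β := by
      rw [sgn_neg, neg_mul, sgn_mul_shift]
      ring
    rw [rootV, Finset.prod_comm, mul_left_comm (sgn (-ε)), e,
      show 2 * (-(sgn ε * x j) + Complex.I * β) =
        -(2 * (sgn ε * x j)) + 2 * (Complex.I * β) by ring,
      show -(2 * (sgn ε * x j)) + 2 * (Complex.I * β) - Complex.I * β =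
        -(2 * (sgn ε * x j)) + Complex.I * β by ring]
    congr 1
    refine Finset.prod_congr rfl fun k hk => ?_
    rw [shift_ne ε (Finset.ne_of_mem_erase hk)]
  rw [h1, h2, h3, v1, v2]
  have alg : ∀ a b A B D p p' R : ℂ, a * (b * p) = a ^ 2 * p' → A * (B * D) = R →
      a * A * (b * B * (p * D)) = a ^ 2 * p' * R := by
    intro a b A B D p p' R h1 h2
    linear_combination (A * B * D) * h1 + a ^ 2 * p' * h2
  generalize (∏ a ∈ Finset.univ.erase j, singleWeight c β q g (x a)) *
    ∏ a ∈ Finset.univ.erase j, ∏ b ∈ (Finset.Ioi a).erase j, pairWeight β lam q (x a) (x b) = T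
  have := alg _ _ _ _ _ _ _ _ single pairs
  linear_combination T * this

theorem opH_kernelF {N M : ℕ} {g : Fin (2 * c.rho + 2) → ℝ} {x : Fin N → ℂ} {y : Fin M → ℂ}
    (h : (x, y) ∈ regularSet c β lam G N M g) :
    opH c β lam σ g (fun x' => kernelF c β lam G q g x' y) x =
      reducedH c β lam g x y * kernelF c β lam G q g x y := by
  rw [opH, reducedH, add_mul, mul_assoc (c.s (Complex.I * lam * β)), Finset.sum_mul]
  simp only [Finset.sum_mul]
  congr 2
  refine Finset.sum_congr rfl fun ε _ => Finset.sum_congr rfl fun j _ => ?_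
  have h1 := rootV_mul_weight_shift lam hG hroot (fun n hn => (h n hn).1) ε j
  have h2 := cross_shift lam hG (fun n hn => (h n hn).2.2) ε j
  simp only [kernelF]
  rw [h2]
  linear_combination (Psi c β lam q (dual c lam g) y * (kernelRatio c β lam x y ε j *
    ∏ i, ∏ k, ∏ δ : ℤˣ, ∏ ε' : ℤˣ,
      G (sgn δ * x i + sgn ε' * y k - Complex.I * lam * β / 2))) * h1

end

/-- Duality of couplings is an involution and the double product is symmetric in its arguments, so
one computation serves both operators. -/
theorem kernelF_comm (c : Case) (β lam : ℝ) (G q : ℂ → ℂ) {N M : ℕ}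
    (g : Fin (2 * c.rho + 2) → ℝ) (x : Fin N → ℂ) (y : Fin M → ℂ) :
    kernelF c β lam G q g x y = kernelF c β lam G q (dual c lam g) y x := by
  unfold kernelF
  rw [dual_dual, mul_comm (Psi c β lam q g x)]
  congr 1
  rw [Finset.prod_comm]
  refine Finset.prod_congr rfl fun k _ => Finset.prod_congr rfl fun j _ => ?_
  rw [Finset.prod_comm]
  refine Finset.prod_congr rfl fun ε _ => Finset.prod_congr rfl fun ε' _ => ?_
  rw [add_comm (sgn ε' * x j)]

theorem mem_regularSet_comm {c : Case} {β lam : ℝ} {G : ℂ → ℂ} {N M : ℕ}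
    {g : Fin (2 * c.rho + 2) → ℝ} {x : Fin N → ℂ} {y : Fin M → ℂ}
    (h : (x, y) ∈ regularSet c β lam G N M g) :
    (y, x) ∈ regularSet c β lam G M N (dual c lam g) := by
  intro n hn
  obtain ⟨h1, h2, h3⟩ := h n hn
  refine ⟨h2, by rwa [dual_dual], fun j k ε ε' => ?_⟩
  have := h3 k j ε' ε
  rwa [add_comm (sgn ε' * _)] at this

/-! ### The set of regular points -/

/-- Open and dense sets. -/
def OpenDense {X : Type*} [TopologicalSpace X] (S : Set X) : Prop := IsOpen S ∧ Dense S

namespace OpenDense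

variable {X : Type*} [TopologicalSpace X]

theorem and {P Q : X → Prop} (hP : OpenDense {x | P x}) (hQ : OpenDense {x | Q x}) :
    OpenDense {x | P x ∧ Q x} :=
  ⟨hP.1.inter hQ.1, hP.2.inter_of_isOpen_left hQ.2 hP.1⟩

theorem forall_finite [BaireSpace X] {ι : Type*} [Finite ι] {P : ι → X → Prop}
    (h : ∀ i, OpenDense {x | P i x}) : OpenDense {x | ∀ i, P i x} := by
  rw [Set.ofPred_forall]
  exact ⟨isOpen_iInter_of_finite fun i => (h i).1,
    dense_iInter_of_isOpen (fun i => (h i).1) fun i => (h i).2⟩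

theorem imp {p : Prop} {P : X → Prop} (h : p → OpenDense {x | P x}) :
    OpenDense {x | p → P x} := by
  by_cases hp : p
  · simpa [hp] using h hp
  · simp only [hp, false_imp_iff, Set.ofPred_true]
    exact ⟨isOpen_univ, dense_univ⟩

theorem preimage {Y : Type*} [TopologicalSpace Y] {P : Y → Prop} (h : OpenDense {y | P y})
    {f : X → Y} (hf : Continuous f) (ho : IsOpenMap f) : OpenDense {x | P (f x)} :=
  ⟨h.1.preimage hf, h.2.preimage ho⟩

end OpenDense

section

variable {s : ℂ → ℂ} {b κ : ℂ} {G : ℂ → ℂ} (hG : IsGammaFunction s b κ G)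
include hG

theorem IsGammaFunction.eventually_reg (z : ℂ) : ∀ᶠ t in 𝓝[≠] z, Reg G t := by
  have h := hG.nonzero
  rw [Filter.Eventually, mem_codiscrete] at h
  have h2 : ∀ᶠ t in 𝓝[≠] z, G t ≠ 0 := by
    have := h z
    rw [disjoint_principal_right, compl_compl] at this
    exact this
  exact (hG.meromorphic z).eventually_analyticAt.and h2

theorem IsGammaFunction.openDense_reg {E : Type*} [AddCommGroup E] [Module ℂ E]
    [TopologicalSpace E] [ContinuousAdd E] [ContinuousSMul ℂ E] {f : E → ℂ} (hf : Continuous f)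
    (v : E) {a : ℂ} (ha : a ≠ 0) (h : ∀ p (t : ℂ), f (p + t • v) = f p + a * t) :
    OpenDense {p | Reg G (f p)} := by
  constructor
  · have : IsOpen {z | Reg G z} := isOpen_iff_mem_nhds.2 fun z hz =>
      hz.1.eventually_analyticAt.and (hz.1.continuousAt.eventually_ne hz.2)
    exact this.preimage hf
  · intro p
    have hT : Tendsto (fun t : ℂ => f p + a * t) (𝓝[≠] 0) (𝓝[≠] (f p)) := by
      refine tendsto_nhdsWithin_iff.2 ⟨?_, ?_⟩
      · have : Continuous fun t : ℂ => f p + a * t := by fun_prop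
        have h0 := this.tendsto 0
        simp only [mul_zero, add_zero] at h0
        exact h0.mono_left nhdsWithin_le_nhds
      · filter_upwards [self_mem_nhdsWithin] with t ht
        simpa using ⟨ha, ht⟩
    have hv : Tendsto (fun t : ℂ => p + t • v) (𝓝[≠] 0) (𝓝 p) := by
      have : Continuous fun t : ℂ => p + t • v := by fun_prop
      have h0 := this.tendsto 0
      simp only [zero_smul, add_zero] at h0
      exact h0.mono_left nhdsWithin_le_nhds
    -- Along the line in direction `v` the argument of `G` moves with nonzero speed, so it leaves
    -- the isolated exceptional points at once.
    refine mem_closure_of_tendsto hv ?_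
    filter_upwards [hT.eventually (hG.eventually_reg (f p))] with t ht
    simpa [h p t] using ht

end

section

variable {c : Case} {β : ℝ} (lam : ℝ) {κ : ℂ} {G : ℂ → ℂ} (hG : IsGammaFunction c.s β κ G)
include hG

theorem openDense_psiReg {N : ℕ} (g : Fin (2 * c.rho + 2) → ℝ) (n : ℤ) :
    OpenDense {x : Fin N → ℂ | PsiReg c β lam G g n x} := by
  refine .and (.forall_finite fun j => .forall_finite fun ε => ?_)
    (.and (.forall_finite fun j => .forall_finite fun ε => .forall_finite fun ν => ?_)
      (.forall_finite fun j => .forall_finite fun k => .imp fun hjk => .forall_finite fun ε =>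
        .forall_finite fun ε' => .and ?_ ?_))
  · refine hG.openDense_reg (by fun_prop) (Pi.single j 1)
      (mul_ne_zero (sgn_ne_zero ε) two_ne_zero) fun p t => ?_
    simp
    ring
  · refine hG.openDense_reg (by fun_prop) (Pi.single j 1) (sgn_ne_zero ε) fun p t => ?_
    simp
    ring
  · refine hG.openDense_reg (by fun_prop) (Pi.single j 1) (sgn_ne_zero ε) fun p t => ?_
    simp [Pi.single_eq_of_ne hjk.ne']
    ring
  · refine hG.openDense_reg (by fun_prop) (Pi.single j 1) (sgn_ne_zero ε) fun p t => ?_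
    simp [Pi.single_eq_of_ne hjk.ne']
    ring

theorem openDense_regularSet (N M : ℕ) (g : Fin (2 * c.rho + 2) → ℝ) :
    OpenDense (regularSet c β lam G N M g) := by
  -- Indexing the integers with `|n| ≤ 2` by a finite type turns the regular set into a finite
  -- intersection of open dense sets.
  have key : OpenDense {p : (Fin N → ℂ) × (Fin M → ℂ) | ∀ n : Finset.Icc (-2 : ℤ) 2,
      PsiReg c β lam G g n p.1 ∧ PsiReg c β lam G (dual c lam g) n p.2 ∧
      ∀ j k, ∀ ε ε' : ℤˣ, Reg G (sgn ε * p.1 j + sgn ε' * p.2 k -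
        Complex.I * lam * β / 2 + (n : ℤ) * Complex.I * β)} := by
    refine .forall_finite fun n => .and
      ((openDense_psiReg lam hG g n).preimage continuous_fst isOpenMap_fst) (.and
      ((openDense_psiReg lam hG (dual c lam g) n).preimage continuous_snd isOpenMap_snd)
      (.forall_finite fun j => .forall_finite fun k => .forall_finite fun ε =>
        .forall_finite fun ε' => ?_))
    refine hG.openDense_reg (by fun_prop) (Pi.single j 1, 0) (sgn_ne_zero ε) fun p t => ?_
    simp
    ring
  convert key using 1
  ext p
  simp only [regularSet, Set.mem_ofPred_eq, Subtype.forall, Finset.mem_Icc, abs_le]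

end

end KvD

end

theorem mainTheorem6 (c : KvD.Case) (β lam : ℝ) (g : Fin (2 * c.rho + 2) → ℝ) (N M : ℕ)
    (hβ : 0 < β)
    (hperiod : ∀ n : ℤ, n ≠ 0 → (n : ℂ) * (Complex.I * β) ∉ c.periods)
    (hlam : Complex.I * (1 - lam) * β ∉ c.periods)
    (hbalance : c.IsElliptic → 2 * lam * ((N : ℝ) - M - 1) + ∑ ν, g ν - 2 = 0)
    (κ k : ℂ) (G q σ : ℂ → ℂ)
    (hG : KvD.IsGammaFunction c.s β κ G)
    (hroot : KvD.IsRootBranch c.s β κ G q σ k) :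
    IsOpen (KvD.regularSet c β lam G N M g) ∧
    Dense (KvD.regularSet c β lam G N M g) ∧
    ∀ x : Fin N → ℂ, ∀ y : Fin M → ℂ, (x, y) ∈ KvD.regularSet c β lam G N M g →
      KvD.opH c β lam σ g (fun x' => KvD.kernelF c β lam G q g x' y) x -
        KvD.opH c β lam σ (KvD.dual c lam g) (fun y' => KvD.kernelF c β lam G q g x y') y -
        KvD.constC c β lam N M g * KvD.kernelF c β lam G q g x y = 0 := by
  refine ⟨(KvD.openDense_regularSet lam hG N M g).1, (KvD.openDense_regularSet lam hG N M g).2,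
    fun x y hxy => ?_⟩
  have h1 := KvD.opH_kernelF lam hG hroot hxy
  have h2 := KvD.opH_kernelF lam hG hroot (KvD.mem_regularSet_comm hxy)
  have h3 := KvD.reducedH_sub c β lam g hbalance hlam
    (KvD.nonSingular_of_psiReg lam hG fun n hn => (hxy n hn).1)
    (KvD.nonSingular_of_psiReg lam hG fun n hn => (hxy n hn).2.1)
    (KvD.crossNonSingular_of_reg lam hG fun n hn => (hxy n hn).2.2)
  -- Writing `F` with the variables exchanged puts the second operator in the form already
  -- evaluated. Both operators then multiply the same value of `F`.
  simp only [KvD.kernelF_comm c β lam G q g x]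
  simp only [KvD.kernelF_comm c β lam G q g x] at h1
  rw [h1, h2, ← h3]
  ring
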